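/- Let $\mu$ be an arbitrary Borel probability measure on $\mathbb{C}$, and let $Z_1, Z_2, \dots$ be independent complex random variables, defined on a common probability space, each with law $\mu$. For $n \ge 1$ put $P_n(z) = \prod_{j=1}^{n} (z - Z_j)$, and for integers $k \ge 0$ and $n > k$ let $$\nu_n^{(k)} = \frac{1}{n-k} \sum_{z \in \mathbb{C}\,:\, P_n^{(k)}(z) = 0} \delta_z$$ be the empirical measure of the zeros of the $k$-th derivative $P_n^{(k)}$, where the zeros are counted with multiplicity and $\delta_z$ is the point mass at $z$. Then, almost surely, for every integer $k \ge 0$ simultaneously, $\nu_n^{(k)}$ converges weakly to $\mu$ as $n \to \infty$; that is, $\int f \, d\nu_n^{(k)} \to \int f \, d\mu$ for every bounded continuous $f : \mathbb{C} \to \mathbb{R}$. -/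

import Mathlib

open MeasureTheory ProbabilityTheory Filter Topology Polynomial
open scoped NNReal

noncomputable section

/-- The polynomial `(X - z 0) ⋯ (X - z (n - 1))` with the first `n` terms of `z` as roots. -/
def rootPoly (z : ℕ → ℂ) (n : ℕ) : ℂ[X] :=
  ∏ j ∈ Finset.range n, (X - C (z j))

/-- The empirical measure `(n - k)⁻¹ ∑ δ_w` of the zeros `w`, counted with multiplicity, of the
`k`-th derivative of `rootPoly z n`. For `n > k` this is a probability measure; for `n ≤ k` the
`k`-th derivative is constant, `roots` is empty and the measure is zero. -/
def derivZeroMeasure (z : ℕ → ℂ) (k n : ℕ) : FiniteMeasure ℂ :=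
  ((n - k : ℕ) : ℝ≥0)⁻¹ •
    ((derivative^[k] (rootPoly z n)).roots.map fun w => (diracProba w).toFiniteMeasure).sum

end

/-!
If `μ` has finite support, the multiplicity of a root drops by at most `k` under `k`-fold
differentiation, so that the atoms of the zero measures have the same limits for all `k`.

If the support is infinite, the point is to show that `n⁻¹ log |P_n^(k) / P_n|` tends to `0` in
`L¹` on every disc. Averaging the logarithmic potentials of the zeros over annuli then shows that
the zeros of `P_n^(k)` are distributed like those of `P_n`, which follow `μ` by the law of large
numbers. That the quotient is not exponentially large is elementary. To see that it is not
exponentially small, write it as `k! e_k((z - Z_1)⁻¹, …, (z - Z_n)⁻¹)`. Resampling one block of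
variables at a time reduces the smallness of `e_k` to that of
`D(z) = ∑ (z - Z_j)⁻¹ - ∑ (z - Z'_j)⁻¹` for two independent samples of size `m = ⌊√n⌋`. If the
samples have different numbers of points in some disc, then `D` is not small somewhere on its
boundary circle, by the residue theorem. Since `D` is a quotient of polynomials of degree
`O(m)`, a Remez inequality makes it exponentially small only on a small set of `z`. As the support
is infinite, `μ` charges any number `L` of disjoint discs, and by Fourier inversion the two vectors
of disc counts coincide with probability `O(m ^ (-L / 2))`. For large `L` this is summable in `n`,
and Borel-Cantelli applies.
-/

open scoped ENNReal

noncomputable section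

section Decoupling

open Finset

/-- The generating polynomial `∏ (1 + x j T)` of the elementary symmetric functions of the family
`x`: its coefficient of `T ^ k` is `e_k(x)`. -/
def esymmGen {ι R : Type*} [CommSemiring R] (s : Finset ι) (x : ι → R) : R[X] :=
  ∏ j ∈ s, (1 + C (x j) * X)

lemma coeff_zero_esymmGen {ι R : Type*} [CommSemiring R] (s : Finset ι) (x : ι → R) :
    (esymmGen s x).coeff 0 = 1 := by
  simp [esymmGen, coeff_zero_eq_eval_zero, eval_prod]

lemma coeff_succ_esymmGen_insert {ι R : Type*} [CommSemiring R] [DecidableEq ι] {s : Finset ι}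
    {a : ι} (ha : a ∉ s) (x : ι → R) (i : ℕ) :
    (esymmGen (insert a s) x).coeff (i + 1) =
      (esymmGen s x).coeff (i + 1) + x a * (esymmGen s x).coeff i := by
  rw [esymmGen, prod_insert ha, add_mul, one_mul, coeff_add, mul_assoc, coeff_C_mul, coeff_X_mul,
    esymmGen]

lemma coeff_one_esymmGen {ι R : Type*} [CommSemiring R] (s : Finset ι) (x : ι → R) :
    (esymmGen s x).coeff 1 = ∑ j ∈ s, x j := by
  classical
  induction s using Finset.induction_on with
  | empty => simp [esymmGen, coeff_one]
  | insert a s ha ih =>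
    rw [coeff_succ_esymmGen_insert ha, coeff_zero_esymmGen, ih, sum_insert ha, mul_one, add_comm]

lemma norm_coeff_esymmGen_le {ι R : Type*} [NormedCommRing R] [NormOneClass R] (s : Finset ι)
    (x : ι → R) (i : ℕ) : ‖(esymmGen s x).coeff i‖ ≤ (∑ j ∈ s, ‖x j‖) ^ i := by
  classical
  induction s using Finset.induction_on generalizing i with
  | empty => rcases i with _ | i <;> simp [esymmGen, coeff_one]
  | insert a s ha ih =>
    rcases i with _ | i
    · simp [coeff_zero_esymmGen]
    · rw [coeff_succ_esymmGen_insert ha, sum_insert ha]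
      have : 0 ≤ ∑ j ∈ s, ‖x j‖ := sum_nonneg fun _ _ => norm_nonneg _
      calc _ ≤ (∑ j ∈ s, ‖x j‖) ^ (i + 1) + ‖x a‖ * (∑ j ∈ s, ‖x j‖) ^ i :=
            norm_add_le_of_le (ih _) <| (norm_mul_le _ _).trans <| by gcongr; exact ih _
        _ = (‖x a‖ + ∑ j ∈ s, ‖x j‖) * (∑ j ∈ s, ‖x j‖) ^ i := by ring
        _ ≤ (‖x a‖ + ∑ j ∈ s, ‖x j‖) * (‖x a‖ + ∑ j ∈ s, ‖x j‖) ^ i := by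
            gcongr
            exact le_add_of_nonneg_left (norm_nonneg _)
        _ = _ := (pow_succ' _ _).symm

lemma esymmGen_append {R : Type*} [CommSemiring R] {N M : ℕ} (a : Fin N → R) (b : Fin M → R) :
    esymmGen univ (Fin.append a b) = esymmGen univ a * esymmGen univ b := by
  simp [esymmGen, Fin.prod_univ_add]

lemma measurable_coeff_esymmGen {ι Y R : Type*} [CommSemiring R] [MeasurableSpace R]
    [MeasurableAdd₂ R] [MeasurableMul₂ R] [MeasurableSpace Y] (s : Finset ι) {x : Y → ι → R}
    (hx : ∀ j, Measurable fun y => x y j) (i : ℕ) :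
    Measurable fun y => (esymmGen s (x y)).coeff i := by
  classical
  induction s using Finset.induction_on generalizing i with
  | empty => simp [esymmGen]
  | insert a s ha ih =>
    rcases i with _ | i
    · simp [coeff_zero_esymmGen]
    · simp_rw [coeff_succ_esymmGen_insert ha]
      exact (ih _).add ((hx a).mul (ih _))

/-- The polynomial `(E_b(T) - E_b'(T)) / T` for the generating polynomials of two families. It
carries the effect of resampling: replacing `b` by `b'` changes `e_{k+1}` by its product with a
generating polynomial in degree `k`. -/
def esymmGenDiffQuot {ι R : Type*} [CommRing R] [Fintype ι] (b b' : ι → R) : R[X] :=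
  (esymmGen univ b - esymmGen univ b').divX

lemma coeff_zero_esymmGenDiffQuot {ι R : Type*} [CommRing R] [Fintype ι] (b b' : ι → R) :
    (esymmGenDiffQuot b b').coeff 0 = ∑ j, b j - ∑ j, b' j := by
  rw [esymmGenDiffQuot, coeff_divX, coeff_sub, coeff_one_esymmGen, coeff_one_esymmGen]

lemma esymmGenDiffQuot_mul_X {ι R : Type*} [CommRing R] [Fintype ι] (b b' : ι → R) :
    esymmGenDiffQuot b b' * X = esymmGen univ b - esymmGen univ b' := by
  conv_rhs => rw [← divX_mul_X_add (esymmGen univ b - esymmGen univ b')]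
  simp [esymmGenDiffQuot, coeff_zero_esymmGen]

lemma coeff_mul_esymmGenDiffQuot_mul {R : Type*} [CommRing R] {N M : ℕ} (c : R[X])
    (a : Fin N → R) (b b' : Fin M → R) (k : ℕ) :
    (c * esymmGenDiffQuot b b' * esymmGen univ a).coeff k =
      (c * esymmGen univ (Fin.append a b)).coeff (k + 1) -
        (c * esymmGen univ (Fin.append a b')).coeff (k + 1) := by
  rw [← coeff_mul_X, ← coeff_sub, esymmGen_append, esymmGen_append]
  congr 1
  linear_combination c * esymmGen univ a * esymmGenDiffQuot_mul_X b b'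

/-- The event that `c` has non-zero constant term and the coefficient of degree `k` of `c E_x` is
at most `η` times that constant term. The polynomial `c` stands for the contribution of variables
on which one conditions. -/
def SmallCoeff {ι R : Type*} [Fintype ι] [NormedCommRing R] (k : ℕ) (η : ℝ) (c : R[X])
    (x : ι → R) : Prop :=
  ‖(c * esymmGen univ x).coeff k‖ ≤ η * ‖c.coeff 0‖ ∧ c.coeff 0 ≠ 0

lemma not_smallCoeff_zero {ι R : Type*} [Fintype ι] [NormedCommRing R] {η : ℝ} (hη : η < 1)
    (c : R[X]) (x : ι → R) : ¬ SmallCoeff 0 η c x := by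
  rintro ⟨h, hc⟩
  rw [mul_coeff_zero, coeff_zero_esymmGen, mul_one] at h
  exact h.not_gt (mul_lt_of_lt_one_left (norm_pos_iff.2 hc) hη)

lemma smallCoeff_esymmGen_iff {R : Type*} [NormedCommRing R] [NormOneClass R]
    {N M k : ℕ} {η : ℝ} (a : Fin N → R) (b : Fin M → R) :
    SmallCoeff k η (esymmGen univ a) b ↔ ‖(esymmGen univ (Fin.append a b)).coeff k‖ ≤ η := by
  have : Nontrivial R := NormOneClass.nontrivial (G := R)
  simp [SmallCoeff, esymmGen_append, coeff_zero_esymmGen]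

section NormedField

variable {𝕜 : Type*} [NormedField 𝕜]

/-- Taking the difference of the two bounds cancels the terms of degree `k + 1` in the common
variables, so a pair of resampled blocks lowers the degree by one at the cost of a square root. -/
lemma SmallCoeff.sum_sub_sum_or {N M k : ℕ} {η : ℝ} (hη : 0 ≤ η) {c : 𝕜[X]} {a : Fin N → 𝕜}
    {b b' : Fin M → 𝕜} (h : SmallCoeff (k + 1) η c (Fin.append a b))
    (h' : SmallCoeff (k + 1) η c (Fin.append a b')) :
    ‖∑ j, b j - ∑ j, b' j‖ ≤ 2 * √η ∨ SmallCoeff k (√η) (c * esymmGenDiffQuot b b') a := by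
  refine or_iff_not_imp_left.2 fun hΔ => ?_
  rw [not_le] at hΔ
  have hne : ∑ j, b j - ∑ j, b' j ≠ 0 := norm_pos_iff.1 (lt_of_le_of_lt (by positivity) hΔ)
  have hcoeff : (c * esymmGenDiffQuot b b').coeff 0 = c.coeff 0 * (∑ j, b j - ∑ j, b' j) := by
    rw [mul_coeff_zero, coeff_zero_esymmGenDiffQuot]
  refine ⟨?_, hcoeff ▸ mul_ne_zero h.2 hne⟩
  rw [coeff_mul_esymmGenDiffQuot_mul, hcoeff, norm_mul]
  calc _ ≤ η * ‖c.coeff 0‖ + η * ‖c.coeff 0‖ := norm_sub_le_of_le h.1 h'.1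
    _ = √η * (‖c.coeff 0‖ * (2 * √η)) := by
        nth_rewrite 1 2 [← Real.mul_self_sqrt hη]
        ring
    _ ≤ _ := by gcongr

variable [MeasurableSpace 𝕜] [BorelSpace 𝕜] [SecondCountableTopology 𝕜]

lemma measurable_coeff_mul {Y : Type*} [MeasurableSpace Y] {p q : Y → 𝕜[X]}
    (hp : ∀ i, Measurable fun y => (p y).coeff i) (hq : ∀ i, Measurable fun y => (q y).coeff i)
    (i : ℕ) : Measurable fun y => (p y * q y).coeff i := by
  simp_rw [coeff_mul]
  exact Finset.measurable_sum _ fun _ _ => (hp _).mul (hq _)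

lemma measurable_coeff_esymmGenDiffQuot {ι Y : Type*} [Fintype ι] [MeasurableSpace Y]
    {b b' : Y → ι → 𝕜} (hb : ∀ j, Measurable fun y => b y j)
    (hb' : ∀ j, Measurable fun y => b' y j) (i : ℕ) :
    Measurable fun y => (esymmGenDiffQuot (b y) (b' y)).coeff i := by
  simp_rw [esymmGenDiffQuot, coeff_divX, coeff_sub]
  exact (measurable_coeff_esymmGen _ hb _).sub (measurable_coeff_esymmGen _ hb' _)

lemma measurableSet_smallCoeff {ι Y : Type*} [Fintype ι] [MeasurableSpace Y] {c : Y → 𝕜[X]}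
    {x : Y → ι → 𝕜} (hc : ∀ i, Measurable fun y => (c y).coeff i)
    (hx : ∀ j, Measurable fun y => x y j) (k : ℕ) (η : ℝ) :
    MeasurableSet {y | SmallCoeff k η (c y) (x y)} :=
  (measurableSet_le (measurable_coeff_mul hc (measurable_coeff_esymmGen _ hx) k).norm
    ((hc 0).norm.const_mul η)).inter ((hc 0) (measurableSet_singleton 0).compl)

end NormedField

lemma measurePreserving_finAppend {E : Type*} [MeasurableSpace E] (μ : Measure E) [SigmaFinite μ]
    (N M : ℕ) :
    MeasurePreserving (fun p : (Fin N → E) × (Fin M → E) => Fin.append p.1 p.2)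
      ((Measure.pi fun _ => μ).prod (Measure.pi fun _ => μ)) (Measure.pi fun _ => μ) := by
  convert (measurePreserving_piCongrLeft (α := fun _ => E) (fun _ => μ) finSumFinEquiv).comp
    (measurePreserving_sumPiEquivProdPi_symm (X := fun _ : Fin N ⊕ Fin M => E) fun _ => μ) with p
  ext i
  refine Fin.addCases (fun j => ?_) (fun j => ?_) i <;>
    simp [MeasurableEquiv.piCongrLeft, MeasurableEquiv.sumPiEquivProdPi, Equiv.piCongrLeft,
      Equiv.sumPiEquivProdPi]

lemma comp_finAppend {α β : Type*} (f : α → β) {N M : ℕ} (a : Fin N → α) (b : Fin M → α) :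
    f ∘ Fin.append a b = Fin.append (f ∘ a) (f ∘ b) := by
  ext i
  refine Fin.addCases (fun j => ?_) (fun j => ?_) i <;> simp

lemma pi_setOf_comp_mem_eq_prod {E F : Type*} [MeasurableSpace E] [MeasurableSpace F]
    (μ : Measure E) [SigmaFinite μ] {f : E → F} (hf : Measurable f) {N M : ℕ}
    {s : Set (Fin (N + M) → F)} (hs : MeasurableSet s) :
    (Measure.pi fun _ : Fin (N + M) => μ) {ζ | f ∘ ζ ∈ s} =
      ((Measure.pi fun _ : Fin N => μ).prod (Measure.pi fun _ : Fin M => μ))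
        {q | Fin.append (f ∘ q.1) (f ∘ q.2) ∈ s} := by
  have hmeas : MeasurableSet {ζ : Fin (N + M) → E | f ∘ ζ ∈ s} :=
    hs.preimage (measurable_pi_lambda _ fun j => hf.comp (measurable_pi_apply j))
  rw [← (measurePreserving_finAppend μ N M).measure_preimage hmeas.nullMeasurableSet]
  simp only [Set.preimage_ofPred_eq, comp_finAppend]

lemma le_add_inv_mul_self_mul_self (x : ℝ≥0∞) {t : ℝ≥0∞} (ht : t ≠ 0) (ht' : t ≠ ∞) :
    x ≤ t + t⁻¹ * (x * x) := by
  rcases le_total x t with h | h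
  · exact h.trans le_self_add
  · refine le_trans ?_ le_add_self
    calc x = t⁻¹ * t * x := by rw [ENNReal.inv_mul_cancel ht ht', one_mul]
      _ ≤ t⁻¹ * x * x := by gcongr
      _ = _ := mul_assoc _ _ _

lemma measurable_comp_apply {T E F ι Y : Type*} [MeasurableSpace T] [MeasurableSpace E]
    [MeasurableSpace F] [MeasurableSpace Y] {φ : T → E → F} (hφ : Measurable (Function.uncurry φ))
    {f : Y → T} {g : Y → ι → E} (hf : Measurable f) (hg : Measurable g) (j : ι) :
    Measurable fun y => (φ (f y) ∘ g y) j :=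
  hφ.comp (hf.prodMk ((measurable_pi_apply j).comp hg))

section Resampling

variable {X Y W : Type*} [MeasurableSpace X] [MeasurableSpace Y] [MeasurableSpace W]

/-- The second term is the probability that `s` holds for two conditionally independent copies of
the last variable. -/
lemma measure_prod_le_add_inv_mul (ν : Measure Y) [IsProbabilityMeasure ν] (ρ : Measure W)
    [SFinite ρ] {s : Set (Y × W)} (hs : MeasurableSet s) {t : ℝ≥0∞} (ht : t ≠ 0) (ht' : t ≠ ∞) :
    (ν.prod ρ) s ≤
      t + t⁻¹ * (ν.prod (ρ.prod ρ)) {r | (r.1, r.2.1) ∈ s ∧ (r.1, r.2.2) ∈ s} := by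
  have hpair : MeasurableSet {r : Y × W × W | (r.1, r.2.1) ∈ s ∧ (r.1, r.2.2) ∈ s} :=
    (hs.preimage (f := fun r : Y × W × W => (r.1, r.2.1)) (by fun_prop)).inter
      (hs.preimage (f := fun r : Y × W × W => (r.1, r.2.2)) (by fun_prop))
  rw [Measure.prod_apply hs, Measure.prod_apply hpair]
  calc _ ≤ ∫⁻ y, (t + t⁻¹ * (ρ (Prod.mk y ⁻¹' s) * ρ (Prod.mk y ⁻¹' s))) ∂ν :=
        lintegral_mono fun y => le_add_inv_mul_self_mul_self _ ht ht'
    _ = t + t⁻¹ * ∫⁻ y, ρ (Prod.mk y ⁻¹' s) * ρ (Prod.mk y ⁻¹' s) ∂ν := by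
        rw [lintegral_add_left measurable_const, lintegral_const, measure_univ, mul_one,
          lintegral_const_mul' _ _ (ENNReal.inv_ne_top.2 ht)]
    _ = _ := by
        simp_rw [← Measure.prod_prod]
        rfl

lemma lintegral_measure_prod_le_of_resample (lam : Measure X) [SFinite lam] (ν : Measure Y)
    [IsProbabilityMeasure ν] (ρ : Measure W) [IsProbabilityMeasure ρ] {S : X → Set (Y × W)}
    {A : X → Set (W × W)} {B : X → W × W → Set Y} (hS : ∀ x, MeasurableSet (S x))
    (hB : MeasurableSet {q : (X × W × W) × Y | q.2 ∈ B q.1.1 q.1.2})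
    (hSAB : ∀ x y w w', (y, w) ∈ S x → (y, w') ∈ S x → (w, w') ∈ A x ∨ y ∈ B x (w, w'))
    {t α β : ℝ≥0∞} (ht : t ≠ 0) (ht' : t ≠ ∞) (hα : ∫⁻ x, (ρ.prod ρ) (A x) ∂lam ≤ α)
    (hβ : ∀ p, ∫⁻ x, ν (B x p) ∂lam ≤ β) :
    ∫⁻ x, (ν.prod ρ) (S x) ∂lam ≤ t * lam Set.univ + t⁻¹ * (α + β) := by
  have hBmeas : Measurable fun q : X × W × W => ν (B q.1 q.2) := measurable_measure_prodMk_left hB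
  have hpair : ∀ x, (ν.prod (ρ.prod ρ)) {r | (r.1, r.2.1) ∈ S x ∧ (r.1, r.2.2) ∈ S x} ≤
      (ρ.prod ρ) (A x) + ∫⁻ p, ν (B x p) ∂(ρ.prod ρ) := by
    intro x
    have hBx : MeasurableSet {r : Y × W × W | r.1 ∈ B x r.2} :=
      hB.preimage (f := fun r : Y × W × W => ((x, r.2), r.1)) (by fun_prop)
    calc _ ≤ (ν.prod (ρ.prod ρ)) ((Set.univ ×ˢ A x) ∪ {r | r.1 ∈ B x r.2}) :=
          measure_mono fun r hr => (hSAB x r.1 r.2.1 r.2.2 hr.1 hr.2).imp_left (⟨trivial, ·⟩)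
      _ ≤ _ := (measure_union_le _ _).trans_eq <| by
          rw [Measure.prod_prod, measure_univ, one_mul, Measure.prod_apply_symm hBx]
          rfl
  calc _ ≤ ∫⁻ x, (t + t⁻¹ * ((ρ.prod ρ) (A x) + ∫⁻ p, ν (B x p) ∂(ρ.prod ρ))) ∂lam :=
        lintegral_mono fun x => (measure_prod_le_add_inv_mul ν ρ (hS x) ht ht').trans <| by
          gcongr
          exact hpair x
    _ = t * lam Set.univ + t⁻¹ * (∫⁻ x, (ρ.prod ρ) (A x) ∂lam +
          ∫⁻ p, ∫⁻ x, ν (B x p) ∂lam ∂(ρ.prod ρ)) := by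
        rw [lintegral_add_left measurable_const, lintegral_const,
          lintegral_const_mul' _ _ (ENNReal.inv_ne_top.2 ht),
          lintegral_add_right _ hBmeas.lintegral_prod_right', lintegral_lintegral_swap]
        exact hBmeas.aemeasurable
    _ ≤ _ := by
        gcongr
        exact (lintegral_mono hβ).trans_eq (by simp)

end Resampling

section Anticoncentration

variable {T E 𝕜 : Type*} [MeasurableSpace T] [MeasurableSpace E] [NormedField 𝕜]
  {φ : T → E → 𝕜} {lam : Measure T} [IsFiniteMeasure lam] {μ : Measure E} [IsProbabilityMeasure μ]

/-- For independent points `ζ j` and `ζ' j` with law `μ`, the difference of the sums of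
`⌊√n⌋` terms `φ t (ζ j)` and `φ t (ζ' j)` is exponentially small in `n` only with a probability
that decays faster than any power of `n`, on average over `t` with respect to `lam`. -/
def RapidAnticoncentration (φ : T → E → 𝕜) (lam : Measure T) (μ : Measure E) : Prop :=
  ∀ ε > 0, ∀ A : ℕ, ∀ᶠ n : ℕ in atTop,
    ∫⁻ t, ((Measure.pi fun _ : Fin n.sqrt => μ).prod (Measure.pi fun _ : Fin n.sqrt => μ))
      {p | ‖∑ j, φ t (p.1 j) - ∑ j, φ t (p.2 j)‖ ≤ Real.exp (-ε * n)} ∂lam ≤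
        (n.sqrt : ℝ≥0∞)⁻¹ ^ A

variable [MeasurableSpace 𝕜] [BorelSpace 𝕜] [SecondCountableTopology 𝕜]

lemma measurable_coeff_mul_esymmGenDiffQuot_comp (hφ : Measurable (Function.uncurry φ))
    {c : T → 𝕜[X]} (hc : ∀ i, Measurable fun t => (c t).coeff i) {Y : Type*} [MeasurableSpace Y]
    {M : ℕ} {f : Y → T} {b b' : Y → Fin M → E} (hf : Measurable f) (hb : Measurable b)
    (hb' : Measurable b') (i : ℕ) :
    Measurable fun y => (c (f y) * esymmGenDiffQuot (φ (f y) ∘ b y) (φ (f y) ∘ b' y)).coeff i :=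
  measurable_coeff_mul (fun i => (hc i).comp hf)
    (measurable_coeff_esymmGenDiffQuot (measurable_comp_apply hφ hf hb)
      (measurable_comp_apply hφ hf hb')) i

lemma lintegral_smallCoeff_succ_le (hφ : Measurable (Function.uncurry φ)) {N M k : ℕ} {η : ℝ}
    (hη : 0 ≤ η) {c : T → 𝕜[X]} (hc : ∀ i, Measurable fun t => (c t).coeff i) {s α β : ℝ≥0∞}
    (hs : s ≠ 0) (hs' : s ≠ ∞)
    (hα : ∫⁻ t, ((Measure.pi fun _ : Fin M => μ).prod (Measure.pi fun _ : Fin M => μ))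
      {p | ‖∑ j, φ t (p.1 j) - ∑ j, φ t (p.2 j)‖ ≤ 2 * √η} ∂lam ≤ α)
    (hβ : ∀ c' : T → 𝕜[X], (∀ i, Measurable fun t => (c' t).coeff i) →
      ∫⁻ t, (Measure.pi fun _ : Fin N => μ) {ζ | SmallCoeff k (√η) (c' t) (φ t ∘ ζ)} ∂lam ≤ β) :
    ∫⁻ t, (Measure.pi fun _ : Fin (N + M) => μ) {ζ | SmallCoeff (k + 1) η (c t) (φ t ∘ ζ)} ∂lam ≤
      s * lam Set.univ + s⁻¹ * (α + β) := by
  have hφt : ∀ t, Measurable (φ t) := fun t => hφ.comp measurable_prodMk_left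
  have hS : ∀ t, MeasurableSet {q : (Fin N → E) × (Fin M → E) |
      SmallCoeff (k + 1) η (c t) (Fin.append (φ t ∘ q.1) (φ t ∘ q.2))} := fun t => by
    simp_rw [← comp_finAppend]
    exact measurableSet_smallCoeff (fun _ => measurable_const) (measurable_comp_apply hφ
      measurable_const (measurePreserving_finAppend μ N M).measurable) _ _
  have hpi : ∀ t, (Measure.pi fun _ : Fin (N + M) => μ)
      {ζ | SmallCoeff (k + 1) η (c t) (φ t ∘ ζ)} =
      ((Measure.pi fun _ : Fin N => μ).prod (Measure.pi fun _ : Fin M => μ))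
        {q | SmallCoeff (k + 1) η (c t) (Fin.append (φ t ∘ q.1) (φ t ∘ q.2))} := fun t =>
    pi_setOf_comp_mem_eq_prod μ (hφt t) (measurableSet_smallCoeff (c := fun _ => c t) (x := id)
      (fun _ => measurable_const) (fun j => measurable_pi_apply j) (k + 1) η)
  rw [lintegral_congr hpi]
  exact lintegral_measure_prod_le_of_resample
    (B := fun t p => {a | SmallCoeff k (√η)
      (c t * esymmGenDiffQuot (φ t ∘ p.1) (φ t ∘ p.2)) (φ t ∘ a)}) lam _ _ hS
    (measurableSet_smallCoeff (measurable_coeff_mul_esymmGenDiffQuot_comp hφ hc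
      (by fun_prop) (by fun_prop) (by fun_prop))
      (measurable_comp_apply hφ (by fun_prop) measurable_snd) _ _)
    (fun t a b b' h h' => h.sum_sub_sum_or hη h') hs hs' hα
    fun p => hβ _ (measurable_coeff_mul_esymmGenDiffQuot_comp hφ hc measurable_id
      measurable_const measurable_const)

lemma tendsto_natSqrt_atTop : Tendsto Nat.sqrt atTop atTop :=
  tendsto_atTop.2 fun b => (eventually_ge_atTop (b * b)).mono fun _ hn => Nat.le_sqrt.2 hn

lemma eventually_mul_inv_sqrt_pow_succ_le {K : ℝ≥0∞} (hK : K ≠ ∞) (A : ℕ) :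
    ∀ᶠ n : ℕ in atTop, (n.sqrt : ℝ≥0∞)⁻¹ ^ (A + 1) * K ≤ (n.sqrt : ℝ≥0∞)⁻¹ ^ A := by
  obtain ⟨b, hb⟩ := ENNReal.exists_nat_gt hK
  filter_upwards [tendsto_natSqrt_atTop.eventually_ge_atTop (max b 1)] with n hn
  have hKn : K ≤ n.sqrt := hb.le.trans (by exact_mod_cast (le_max_left b 1).trans hn)
  have hn0 : (n.sqrt : ℝ≥0∞) ≠ 0 := by
    exact_mod_cast (zero_lt_one.trans_le ((le_max_right b 1).trans hn)).ne'
  calc _ ≤ (n.sqrt : ℝ≥0∞)⁻¹ ^ (A + 1) * n.sqrt := by gcongr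
    _ = _ := by rw [pow_succ, mul_assoc, ENNReal.inv_mul_cancel hn0 (by simp), mul_one]

lemma eventually_two_mul_sqrt_exp_le {ε : ℝ} (hε : 0 < ε) :
    ∀ᶠ n : ℕ in atTop, 2 * √(Real.exp (-ε * n)) ≤ Real.exp (-(ε / 4) * n) := by
  have h : Tendsto (fun n : ℕ => ε / 4 * (n : ℝ)) atTop atTop :=
    tendsto_natCast_atTop_atTop.const_mul_atTop (by positivity)
  filter_upwards [h.eventually_ge_atTop (Real.log 2)] with n hn
  have h2 : (2 : ℝ) ≤ Real.exp (ε / 4 * n) := (Real.log_le_iff_le_exp two_pos).1 hn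
  rw [← Real.exp_half]
  calc _ ≤ Real.exp (ε / 4 * n) * Real.exp (-ε * n / 2) := by gcongr
    _ = _ := by
      rw [← Real.exp_add]
      ring_nf

/-- Each step of the induction on `k` resamples a block of `⌊√n⌋` variables. The resampled block is
absorbed into `c`, whence the uniformity in `c`. -/
lemma RapidAnticoncentration.eventually_lintegral_smallCoeff_le
    (hφ : Measurable (Function.uncurry φ)) (h : RapidAnticoncentration φ lam μ) (k : ℕ) :
    ∀ ε > 0, ∀ A : ℕ, ∀ᶠ n : ℕ in atTop, ∀ c : T → 𝕜[X],
      (∀ i, Measurable fun t => (c t).coeff i) →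
      ∫⁻ t, (Measure.pi fun _ : Fin (n.sqrt * k) => μ)
        {ζ | SmallCoeff k (Real.exp (-ε * n)) (c t) (φ t ∘ ζ)} ∂lam ≤ (n.sqrt : ℝ≥0∞)⁻¹ ^ A := by
  induction k with
  | zero =>
    intro ε hε A
    filter_upwards [eventually_gt_atTop 0] with n hn c _
    have hlt : Real.exp (-ε * n) < 1 := by
      rw [Real.exp_lt_one_iff, neg_mul, neg_lt_zero]
      positivity
    simp only [not_smallCoeff_zero hlt, Set.ofPred_false, measure_empty, lintegral_zero, zero_le]
  | succ k ih =>
    intro ε hε A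
    have hK : lam Set.univ + 2 ≠ ∞ := by finiteness
    filter_upwards [h (ε / 4) (by positivity) (2 * (A + 1)),
      ih (ε / 2) (by positivity) (2 * (A + 1)), eventually_two_mul_sqrt_exp_le hε,
      eventually_mul_inv_sqrt_pow_succ_le hK A,
      tendsto_natSqrt_atTop.eventually_gt_atTop 0] with n hsum hk hexp hpow hn c hc
    set s : ℝ≥0∞ := (n.sqrt : ℝ≥0∞)⁻¹ ^ (A + 1)
    have hs : s ≠ 0 := pow_ne_zero _ (by simp)
    have hs' : s ≠ ∞ := ENNReal.pow_ne_top (by simpa using hn.ne')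
    have hsq : s⁻¹ * (n.sqrt : ℝ≥0∞)⁻¹ ^ (2 * (A + 1)) = s := by
      rw [two_mul, pow_add, ← mul_assoc, ENNReal.inv_mul_cancel hs hs', one_mul]
    calc _ ≤ s * lam Set.univ + s⁻¹ *
          ((n.sqrt : ℝ≥0∞)⁻¹ ^ (2 * (A + 1)) + (n.sqrt : ℝ≥0∞)⁻¹ ^ (2 * (A + 1))) := by
          refine lintegral_smallCoeff_succ_le (N := n.sqrt * k) (M := n.sqrt) hφ
            (Real.exp_pos _).le hc hs hs' (le_trans ?_ hsum) fun c' hc' => ?_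
          · gcongr
          · convert hk c' hc' using 6
            rw [← Real.exp_half]
            ring_nf
      _ = s * (lam Set.univ + 2) := by
          rw [mul_add s⁻¹, hsq]
          ring
      _ ≤ _ := hpow

/-- Conditioning on the first `N` variables, whose generating polynomial plays the role of `c`. -/
lemma pi_norm_coeff_esymmGen_le_eq_lintegral {f : E → 𝕜} (hf : Measurable f) {N M : ℕ} (k : ℕ)
    (η : ℝ) :
    (Measure.pi fun _ : Fin (N + M) => μ) {ζ | ‖(esymmGen univ (f ∘ ζ)).coeff k‖ ≤ η} =
      ∫⁻ a, (Measure.pi fun _ : Fin M => μ) {b | SmallCoeff k η (esymmGen univ (f ∘ a)) (f ∘ b)}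
        ∂Measure.pi fun _ : Fin N => μ := by
  have hgen : MeasurableSet {x : Fin (N + M) → 𝕜 | ‖(esymmGen univ x).coeff k‖ ≤ η} :=
    measurableSet_le (measurable_coeff_esymmGen _ (fun j => measurable_pi_apply j) k).norm
      measurable_const
  have happ : Measurable fun q : (Fin N → E) × (Fin M → E) => Fin.append (f ∘ q.1) (f ∘ q.2) := by
    simp_rw [← comp_finAppend]
    exact measurable_pi_lambda _ fun j => hf.comp ((measurable_pi_apply j).comp
      (measurePreserving_finAppend μ N M).measurable)
  refine (pi_setOf_comp_mem_eq_prod μ hf hgen).trans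
    ((Measure.prod_apply (hgen.preimage happ)).trans ?_)
  simp only [Set.preimage_ofPred_eq, smallCoeff_esymmGen_iff]

lemma lintegral_norm_coeff_esymmGen_le (hφ : Measurable (Function.uncurry φ)) {N M k : ℕ} {η : ℝ}
    {β : ℝ≥0∞} (hβ : ∀ c : T → 𝕜[X], (∀ i, Measurable fun t => (c t).coeff i) →
      ∫⁻ t, (Measure.pi fun _ : Fin M => μ) {ζ | SmallCoeff k η (c t) (φ t ∘ ζ)} ∂lam ≤ β) :
    ∫⁻ t, (Measure.pi fun _ : Fin (N + M) => μ)
      {ζ : Fin (N + M) → E | ‖(esymmGen univ (φ t ∘ ζ)).coeff k‖ ≤ η} ∂lam ≤ β := by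
  have hset : MeasurableSet {r : (T × (Fin N → E)) × (Fin M → E) |
      SmallCoeff k η (esymmGen univ (φ r.1.1 ∘ r.1.2)) (φ r.1.1 ∘ r.2)} :=
    measurableSet_smallCoeff
      (measurable_coeff_esymmGen _ (measurable_comp_apply hφ (by fun_prop) (by fun_prop)))
      (measurable_comp_apply hφ (by fun_prop) measurable_snd) k η
  have hmeas : Measurable fun q : T × (Fin N → E) => (Measure.pi fun _ : Fin M => μ)
      {b | SmallCoeff k η (esymmGen univ (φ q.1 ∘ q.2)) (φ q.1 ∘ b)} :=
    measurable_measure_prodMk_left (ν := Measure.pi fun _ : Fin M => μ) hset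
  have hφt : ∀ t, Measurable (φ t) := fun t => hφ.comp measurable_prodMk_left
  rw [lintegral_congr fun t => pi_norm_coeff_esymmGen_le_eq_lintegral (hφt t) k η,
    lintegral_lintegral_swap hmeas.aemeasurable]
  calc _ ≤ ∫⁻ _, β ∂Measure.pi fun _ : Fin N => μ := lintegral_mono fun a =>
        hβ _ (measurable_coeff_esymmGen _ (measurable_comp_apply hφ measurable_id measurable_const))
    _ = β := by simp

end Anticoncentration

end Decoupling

section PoleSum

/-- The sum of the reciprocal distances from `z` to the points of `s`, a bound for the variation
of `log ‖p‖` at `z` when `s` consists of the roots of `p`. -/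
def poleSum (s : Multiset ℂ) (z : ℂ) : ℝ≥0 := (s.map fun w => ‖z - w‖₊⁻¹).sum

lemma poleSum_zero (z : ℂ) : poleSum 0 z = 0 := by simp [poleSum]

lemma poleSum_cons (a : ℂ) (s : Multiset ℂ) (z : ℂ) :
    poleSum (a ::ₘ s) z = ‖z - a‖₊⁻¹ + poleSum s z := by simp [poleSum]

lemma poleSum_add (s t : Multiset ℂ) (z : ℂ) : poleSum (s + t) z = poleSum s z + poleSum t z := by
  simp [poleSum]

lemma measurable_poleSum (s : Multiset ℂ) : Measurable (poleSum s) := by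
  induction s using Multiset.induction_on with
  | empty =>
    simp_rw [funext poleSum_zero]
    exact measurable_const
  | cons a s ih =>
    simp_rw [funext (poleSum_cons a s)]
    fun_prop

lemma lintegral_poleSum_le {lam : Measure ℂ} {K : ℝ≥0∞}
    (hK : ∀ w, ∫⁻ z, ↑‖z - w‖₊⁻¹ ∂lam ≤ K) (s : Multiset ℂ) :
    ∫⁻ z, poleSum s z ∂lam ≤ s.card * K := by
  induction s using Multiset.induction_on with
  | empty => simp [poleSum_zero]
  | cons a s ih =>
    simp only [poleSum_cons, ENNReal.coe_add, Multiset.card_cons, Nat.cast_add, Nat.cast_one]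
    rw [lintegral_add_left (by fun_prop), add_comm, add_mul, one_mul]
    exact add_le_add ih (hK a)

lemma one_add_le_exp_add_exp_neg_mul {a : ℝ} (ha : 0 ≤ a) (x : ℝ) :
    1 + x ≤ Real.exp (a + Real.exp (-a) * x) := by
  have hexp : Real.exp (-a) ≤ 1 := Real.exp_le_one_iff.2 (by linarith)
  calc 1 + x = Real.exp a * (Real.exp (-a) * (1 + x) - 1 + 1) := by
        rw [sub_add_cancel, ← mul_assoc, ← Real.exp_add, add_neg_cancel, Real.exp_zero, one_mul]
    _ ≤ Real.exp a * Real.exp (Real.exp (-a) * (1 + x) - 1) := by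
        gcongr
        exact Real.add_one_le_exp _
    _ = Real.exp (a + (Real.exp (-a) * (1 + x) - 1)) := (Real.exp_add _ _).symm
    _ ≤ _ := by
        gcongr
        linarith

lemma norm_sub_le_exp_mul {z z' w : ℂ} {ρ a : ℝ} (hρ : ‖z - z'‖ ≤ ρ) (ha : 0 ≤ a) (hw : z' ≠ w) :
    ‖z - w‖ ≤ Real.exp (a + Real.exp (-a) * (ρ * ‖z' - w‖⁻¹)) * ‖z' - w‖ := by
  have hw0 : 0 < ‖z' - w‖ := norm_sub_pos_iff.2 hw
  calc ‖z - w‖ ≤ ‖z - z'‖ + ‖z' - w‖ := norm_sub_le_norm_sub_add_norm_sub z z' w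
    _ ≤ ρ + ‖z' - w‖ := by gcongr
    _ = (1 + ρ * ‖z' - w‖⁻¹) * ‖z' - w‖ := by field_simp; ring
    _ ≤ _ := by
      gcongr
      exact one_add_le_exp_add_exp_neg_mul ha _

lemma prod_norm_sub_le_exp_mul {z z' : ℂ} {ρ a : ℝ} (hρ : ‖z - z'‖ ≤ ρ) (ha : 0 ≤ a)
    {s : Multiset ℂ} (hz' : z' ∉ s) :
    (s.map fun w => ‖z - w‖).prod ≤
      Real.exp (s.card * a + Real.exp (-a) * (ρ * poleSum s z')) *
        (s.map fun w => ‖z' - w‖).prod := by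
  induction s using Multiset.induction_on with
  | empty => simp [poleSum_zero]
  | cons w s ih =>
    simp only [Multiset.mem_cons, not_or] at hz'
    have hprod : 0 ≤ (s.map fun w => ‖z - w‖).prod :=
      Multiset.prod_nonneg fun x hx => by
        obtain ⟨w, -, rfl⟩ := Multiset.mem_map.1 hx
        exact norm_nonneg _
    simp only [Multiset.map_cons, Multiset.prod_cons]
    calc _ ≤ Real.exp (a + Real.exp (-a) * (ρ * ‖z' - w‖⁻¹)) * ‖z' - w‖ *
          (Real.exp (s.card * a + Real.exp (-a) * (ρ * poleSum s z')) *
            (s.map fun w => ‖z' - w‖).prod) := by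
          gcongr
          exacts [norm_sub_le_exp_mul hρ ha hz'.1, ih hz'.2]
      _ = _ := by
          rw [mul_mul_mul_comm, ← Real.exp_add, poleSum_cons, Multiset.card_cons]
          push_cast
          ring_nf

lemma norm_eval_eq_prod_roots (p : ℂ[X]) (z : ℂ) :
    ‖p.eval z‖ = ‖p.leadingCoeff‖ * (p.roots.map fun w => ‖z - w‖).prod := by
  rw [(IsAlgClosed.splits p).eval_eq_prod_roots, norm_mul]
  congr 1
  refine (map_multiset_prod (normHom : ℂ →*₀ ℝ) _).trans ?_
  rw [Multiset.map_map]
  rfl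

lemma norm_eval_le_exp_mul {p : ℂ[X]} {z z' : ℂ} {ρ a : ℝ} (hρ : ‖z - z'‖ ≤ ρ) (ha : 0 ≤ a)
    (hz' : p.eval z' ≠ 0) :
    ‖p.eval z‖ ≤ Real.exp (p.natDegree * a + Real.exp (-a) * (ρ * poleSum p.roots z')) *
      ‖p.eval z'‖ := by
  have hroot : z' ∉ p.roots := fun h => hz' (isRoot_of_mem_roots h)
  rw [norm_eval_eq_prod_roots p z, norm_eval_eq_prod_roots p z', mul_left_comm,
    ← (IsAlgClosed.splits p).natDegree_eq_card_roots.symm]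
  gcongr
  exact prod_norm_sub_le_exp_mul hρ ha hroot

lemma finite_setOf_eval_eq_zero {p : ℂ[X]} (hp : p ≠ 0) : {z | p.eval z = 0}.Finite :=
  (p.roots.toFinset.finite_toSet).subset fun z hz => by simpa [hp] using hz

lemma mul_exp_le_poleSum {p : ℂ[X]} {d : ℕ} (hpd : p.natDegree ≤ d) {z₀ z : ℂ} {ρ a : ℝ}
    (hρ : ‖z₀ - z‖ ≤ ρ) (ha : 0 ≤ a) (hz : p.eval z ≠ 0)
    (h : Real.exp (d * (a + 1)) * ‖p.eval z‖ ≤ ‖p.eval z₀‖) :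
    d * Real.exp a ≤ ρ * poleSum p.roots z := by
  have hexp : Real.exp (d * (a + 1)) ≤
      Real.exp (p.natDegree * a + Real.exp (-a) * (ρ * poleSum p.roots z)) :=
    le_of_mul_le_mul_right (h.trans (norm_eval_le_exp_mul hρ ha hz)) (norm_pos_iff.2 hz)
  have hna : (p.natDegree : ℝ) * a ≤ d * a := by gcongr
  have hd : (d : ℝ) ≤ Real.exp (-a) * (ρ * poleSum p.roots z) := by
    linarith [Real.exp_le_exp.1 hexp]
  calc d * Real.exp a ≤ Real.exp (-a) * (ρ * poleSum p.roots z) * Real.exp a := by gcongr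
    _ = _ := by rw [mul_right_comm, ← Real.exp_add, neg_add_cancel, Real.exp_zero, one_mul]

lemma setOf_norm_eval_small_subset {p : ℂ[X]} {d : ℕ} (hpd : p.natDegree ≤ d) {z₀ : ℂ}
    {s : Set ℂ} {ρ : ℝ≥0} (hρ : ∀ z ∈ s, ‖z₀ - z‖ ≤ ρ) {a : ℝ} (ha : 0 ≤ a) :
    {z ∈ s | Real.exp (d * (a + 1)) * ‖p.eval z‖ ≤ ‖p.eval z₀‖} ⊆
      {z | p.eval z = 0} ∪
        s ∩ {z | ENNReal.ofReal (d * Real.exp a) ≤ ρ * poleSum p.roots z} := by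
  rintro z ⟨hz, h⟩
  refine or_iff_not_imp_left.2 fun hpz => ⟨hz, ?_⟩
  rw [Set.mem_ofPred_eq, ← ENNReal.coe_mul, ← ENNReal.ofReal_coe_nnreal]
  exact ENNReal.ofReal_le_ofReal (mul_exp_le_poleSum hpd (hρ z hz) ha hpz h)

/-- A Remez type inequality: a polynomial of degree `d` is rarely smaller than `e ^ (-d (a + 1))`
times its value at a given point. -/
lemma measure_norm_eval_small_le {lam : Measure ℂ} [NullSingletonClass lam] {s : Set ℂ}
    {K : ℝ≥0∞} (hK : ∀ w, ∫⁻ z in s, ↑‖z - w‖₊⁻¹ ∂lam ≤ K) {p : ℂ[X]} (hp : p ≠ 0) {d : ℕ}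
    (hd : 0 < d) (hpd : p.natDegree ≤ d) {z₀ : ℂ} {ρ : ℝ≥0} (hρ : ∀ z ∈ s, ‖z₀ - z‖ ≤ ρ)
    {a : ℝ} (ha : 0 ≤ a) :
    lam {z ∈ s | Real.exp (d * (a + 1)) * ‖p.eval z‖ ≤ ‖p.eval z₀‖} ≤
      ρ * K * ENNReal.ofReal (Real.exp (-a)) := by
  have hS : Measurable fun z => (ρ : ℝ≥0∞) * poleSum p.roots z :=
    ((measurable_poleSum _).coe_nnreal_ennreal).const_mul _
  have hd0 : (d : ℝ≥0∞) ≠ 0 := by exact_mod_cast hd.ne'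
  calc _ ≤ lam {z | p.eval z = 0} +
        lam (s ∩ {z | ENNReal.ofReal (d * Real.exp a) ≤ ρ * poleSum p.roots z}) :=
        (measure_mono (setOf_norm_eval_small_subset hpd hρ ha)).trans (measure_union_le _ _)
    _ = (lam.restrict s) {z | ENNReal.ofReal (d * Real.exp a) ≤ ρ * poleSum p.roots z} := by
        rw [(finite_setOf_eval_eq_zero hp).measure_zero, zero_add,
          Measure.restrict_apply (measurableSet_le measurable_const hS), Set.inter_comm]
    _ ≤ (∫⁻ z in s, ρ * poleSum p.roots z ∂lam) / ENNReal.ofReal (d * Real.exp a) :=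
        meas_ge_le_lintegral_div hS.aemeasurable
          (ENNReal.ofReal_pos.2 (by positivity)).ne' ENNReal.ofReal_ne_top
    _ ≤ ρ * (d * K) / ENNReal.ofReal (d * Real.exp a) := by
        gcongr
        rw [lintegral_const_mul _ (measurable_poleSum _).coe_nnreal_ennreal]
        gcongr
        refine (lintegral_poleSum_le hK _).trans ?_
        gcongr
        exact (card_roots' p).trans hpd
    _ = _ := by
        rw [ENNReal.ofReal_mul d.cast_nonneg, ENNReal.ofReal_natCast, mul_left_comm,
          ENNReal.mul_div_mul_left _ _ hd0 (ENNReal.natCast_ne_top d), Real.exp_neg,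
          ENNReal.ofReal_inv_of_pos (Real.exp_pos a), div_eq_mul_inv]

end PoleSum

lemma lintegral_inv_nnnorm_ball_lt_top {E : Type*} [NormedAddCommGroup E] [NormedSpace ℝ E]
    [FiniteDimensional ℝ E] [MeasurableSpace E] [BorelSpace E] (lam : Measure E)
    [lam.IsAddHaarMeasure] (hE : 1 < Module.finrank ℝ E) (r : ℝ) :
    ∫⁻ z in Metric.ball 0 r, ↑‖z‖₊⁻¹ ∂lam < ∞ := by
  have hint : IntegrableOn (fun z : E => ‖z‖⁻¹) (Metric.ball 0 r) lam :=
    integrableOn_ball_of_norm_le_rpow (C := 1) (α := 1) hE.le (by exact_mod_cast hE)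
      (Eventually.of_forall fun z => by simp [Real.rpow_neg_one]) (by fun_prop)
  simpa [HasFiniteIntegral, enorm_eq_nnnorm] using hint.hasFiniteIntegral

lemma exists_lintegral_inv_nnnorm_sub_le {E : Type*} [NormedAddCommGroup E] [NormedSpace ℝ E]
    [FiniteDimensional ℝ E] [MeasurableSpace E] [BorelSpace E] (lam : Measure E)
    [lam.IsAddHaarMeasure] (hE : 1 < Module.finrank ℝ E) {s : Set E} (hs : lam s ≠ ∞) :
    ∃ K : ℝ≥0∞, K ≠ ∞ ∧ ∀ w, ∫⁻ z in s, ↑‖z - w‖₊⁻¹ ∂lam ≤ K := by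
  refine ⟨∫⁻ z in Metric.ball 0 1, ↑‖z‖₊⁻¹ ∂lam + lam s,
    ENNReal.add_ne_top.2 ⟨(lintegral_inv_nnnorm_ball_lt_top lam hE 1).ne, hs⟩, fun w => ?_⟩
  set f : E → ℝ≥0∞ := (Metric.ball 0 1).indicator fun z => ↑‖z‖₊⁻¹
  have hpt : ∀ z, (↑‖z - w‖₊⁻¹ : ℝ≥0∞) ≤ f (z - w) + 1 := by
    intro z
    by_cases h : z - w ∈ Metric.ball (0 : E) 1
    · simp only [f, Set.indicator_of_mem h, le_self_add]
    · refine le_add_left (ENNReal.coe_le_one_iff.2 (inv_le_one_of_one_le₀ ?_))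
      exact_mod_cast not_lt.1 (mt mem_ball_zero_iff.2 h)
  calc _ ≤ ∫⁻ z in s, (f (z - w) + 1) ∂lam := lintegral_mono hpt
    _ = ∫⁻ z in s, f (z - w) ∂lam + lam s := by
      rw [lintegral_add_right _ measurable_const, setLIntegral_one]
    _ ≤ ∫⁻ z, f (z - w) ∂lam + lam s :=
      add_le_add_left (setLIntegral_le_lintegral s _) _
    _ = _ := by
      rw [lintegral_sub_right_eq_self f, lintegral_indicator Metric.isOpen_ball.measurableSet]

section CauchyTransform

variable {ι : Type*}

lemma taylor_prod_X_sub_C (s : Finset ι) (a : ι → ℂ) {z : ℂ} (hz : ∀ j ∈ s, z - a j ≠ 0) :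
    taylor z (∏ j ∈ s, (X - C (a j))) =
      C (∏ j ∈ s, (z - a j)) * ∏ j ∈ s, (1 + C (z - a j)⁻¹ * X) := by
  rw [map_prod C, ← Finset.prod_mul_distrib]
  refine (map_prod (taylorAlgHom z) _ _).trans (Finset.prod_congr rfl fun j hj => ?_)
  rw [mul_add, ← mul_assoc, ← C_mul, mul_inv_cancel₀ (hz j hj), taylorAlgHom_apply, map_sub,
    taylor_X, taylor_C, C_sub, C_1]
  ring

lemma eval_iterate_derivative_prod (s : Finset ι) (a : ι → ℂ) {z : ℂ}
    (hz : ∀ j ∈ s, z - a j ≠ 0) (k : ℕ) :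
    (derivative^[k] (∏ j ∈ s, (X - C (a j)))).eval z =
      k.factorial * (esymmGen s fun j => (z - a j)⁻¹).coeff k * ∏ j ∈ s, (z - a j) := by
  rw [← factorial_smul_hasseDeriv, LinearMap.smul_apply, eval_smul, ← taylor_coeff,
    taylor_prod_X_sub_C s a hz, coeff_C_mul, nsmul_eq_mul, esymmGen]
  ring

variable [Fintype ι]

lemma eval_derivative_prod (a : ι → ℂ) {z : ℂ} (hz : ∀ j, z ≠ a j) :
    (derivative (∏ j, (X - C (a j)))).eval z = (∑ j, (z - a j)⁻¹) * ∏ j, (z - a j) := by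
  simpa [coeff_one_esymmGen] using
    eval_iterate_derivative_prod Finset.univ a (fun j _ => sub_ne_zero.2 (hz j)) 1

lemma eval_wronskian_prod {a b : ι → ℂ} {z : ℂ} (ha : ∀ j, z ≠ a j) (hb : ∀ j, z ≠ b j) :
    (wronskian (∏ j, (X - C (b j))) (∏ j, (X - C (a j)))).eval z =
      (∑ j, (z - a j)⁻¹ - ∑ j, (z - b j)⁻¹) * ((∏ j, (z - a j)) * ∏ j, (z - b j)) := by
  rw [wronskian, eval_sub, eval_mul, eval_mul, eval_derivative_prod a ha, eval_derivative_prod b hb,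
    eval_prod, eval_prod]
  simp only [eval_sub, eval_X, eval_C]
  ring

lemma wronskian_prod_ne_zero {a b : ι → ℂ} {z : ℂ} (ha : ∀ j, z ≠ a j) (hb : ∀ j, z ≠ b j)
    (hab : ∑ j, (z - a j)⁻¹ - ∑ j, (z - b j)⁻¹ ≠ 0) :
    wronskian (∏ j, (X - C (b j))) (∏ j, (X - C (a j))) ≠ 0 := by
  intro h
  have hz := eval_wronskian_prod ha hb
  rw [h, eval_zero, eq_comm] at hz
  exact mul_ne_zero hab (mul_ne_zero (Finset.prod_ne_zero_iff.2 fun j _ => sub_ne_zero.2 (ha j))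
    (Finset.prod_ne_zero_iff.2 fun j _ => sub_ne_zero.2 (hb j))) hz

lemma natDegree_wronskian_prod_le (a b : ι → ℂ) :
    (wronskian (∏ j, (X - C (b j))) (∏ j, (X - C (a j)))).natDegree ≤ 2 * Fintype.card ι := by
  by_cases hw : wronskian (∏ j, (X - C (b j))) (∏ j, (X - C (a j))) = 0
  · simp [hw]
  · have := natDegree_wronskian_lt_add hw
    simp only [natDegree_finsetProd_X_sub_C_eq_card, Finset.card_univ] at this
    omega

/-- The number of points of `ζ` in the open ball with centre `y` and radius `r`. -/
def ballCount (y : ℂ) (r : ℝ) (ζ : ι → ℂ) : ℤ :=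
  ∑ j, (Metric.ball y r).indicator 1 (ζ j)

lemma circleIntegral_sub_inv {y a : ℂ} {r : ℝ} (hr : 0 ≤ r) (ha : ‖a - y‖ ≠ r) :
    ∮ z in C(y, r), (z - a)⁻¹ =
      2 * Real.pi * Complex.I * ((Metric.ball y r).indicator (1 : ℂ → ℤ) a : ℤ) := by
  by_cases h : a ∈ Metric.ball y r
  · simp [circleIntegral.integral_sub_inv_of_mem_ball h, Set.indicator_of_mem h]
  · have hne : ∀ z ∈ Metric.closedBall y r, z - a ≠ 0 := by
      refine fun z hz => sub_ne_zero.2 fun hza => h ?_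
      rw [hza, mem_closedBall_iff_norm] at hz
      exact mem_ball_iff_norm.2 (hz.lt_of_ne ha)
    have hdiff : DifferentiableOn ℂ (fun z => (z - a)⁻¹) (Metric.closedBall y r) := by
      fun_prop (disch := assumption)
    rw [Set.indicator_of_notMem h, Int.cast_zero, mul_zero]
    exact (hdiff.diffContOnCl_ball subset_rfl).circleIntegral_eq_zero hr

lemma circleIntegrable_sub_inv {y a : ℂ} {r : ℝ} (hr : 0 ≤ r) (ha : ‖a - y‖ ≠ r) :
    CircleIntegrable (fun z => (z - a)⁻¹) y r :=
  circleIntegrable_sub_inv_iff.2 (.inr (by simpa [abs_of_nonneg hr, mem_sphere_iff_norm] using ha))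

lemma circleIntegral_sum_sub_inv {y : ℂ} {r : ℝ} (hr : 0 ≤ r) {ζ : ι → ℂ}
    (hζ : ∀ j, ‖ζ j - y‖ ≠ r) :
    ∮ z in C(y, r), ∑ j, (z - ζ j)⁻¹ = 2 * Real.pi * Complex.I * ballCount y r ζ := by
  rw [circleIntegral.integral_fun_sum fun j _ => circleIntegrable_sub_inv hr (hζ j),
    Finset.sum_congr rfl fun j _ => circleIntegral_sub_inv hr (hζ j), ← Finset.mul_sum, ballCount]
  push_cast
  rfl

lemma circleIntegral_sum_sub_sum {y : ℂ} {r : ℝ} (hr : 0 ≤ r) {ζ ζ' : ι → ℂ}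
    (hζ : ∀ j, ‖ζ j - y‖ ≠ r) (hζ' : ∀ j, ‖ζ' j - y‖ ≠ r) :
    ∮ z in C(y, r), (∑ j, (z - ζ j)⁻¹ - ∑ j, (z - ζ' j)⁻¹) =
      2 * Real.pi * Complex.I * (ballCount y r ζ - ballCount y r ζ' : ℤ) := by
  have hint : ∀ ξ : ι → ℂ, (∀ j, ‖ξ j - y‖ ≠ r) →
      CircleIntegrable (fun z => ∑ j, (z - ξ j)⁻¹) y r := fun ξ hξ => by
    simpa only [Finset.sum_fn] using
      CircleIntegrable.sum Finset.univ fun j _ => circleIntegrable_sub_inv hr (hξ j)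
  rw [circleIntegral.integral_sub (hint ζ hζ) (hint ζ' hζ'), circleIntegral_sum_sub_inv hr hζ,
    circleIntegral_sum_sub_inv hr hζ', ← mul_sub, Int.cast_sub]

lemma exists_lt_norm_sum_sub_sum {y : ℂ} {r : ℝ} (hr : 0 < r) {ζ ζ' : ι → ℂ}
    (hζ : ∀ j, ‖ζ j - y‖ ≠ r) (hζ' : ∀ j, ‖ζ' j - y‖ ≠ r)
    (hne : ballCount y r ζ ≠ ballCount y r ζ') :
    ∃ z₀, ‖z₀ - y‖ = r ∧ (2 * r)⁻¹ < ‖∑ j, (z₀ - ζ j)⁻¹ - ∑ j, (z₀ - ζ' j)⁻¹‖ := by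
  by_contra! hsmall
  have hcount : (1 : ℝ) ≤ ‖((ballCount y r ζ - ballCount y r ζ' : ℤ) : ℂ)‖ := by
    rw [Complex.norm_intCast]
    exact_mod_cast Int.one_le_abs (sub_ne_zero.2 hne)
  have hpi : 2 * Real.pi ≤ Real.pi :=
    calc 2 * Real.pi ≤ 2 * Real.pi * ‖((ballCount y r ζ - ballCount y r ζ' : ℤ) : ℂ)‖ :=
        le_mul_of_one_le_right (by positivity) hcount
      _ = ‖∮ z in C(y, r), (∑ j, (z - ζ j)⁻¹ - ∑ j, (z - ζ' j)⁻¹)‖ := by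
        rw [circleIntegral_sum_sub_sum hr.le hζ hζ']
        simp [abs_of_pos Real.pi_pos]
      _ ≤ 2 * Real.pi * r * (2 * r)⁻¹ :=
        circleIntegral.norm_integral_le_of_norm_le_const hr.le fun z hz =>
          hsmall z (mem_sphere_iff_norm.1 hz)
      _ = Real.pi := by field_simp
  linarith [Real.pi_pos]

lemma prod_norm_sub_le {z z₀ : ℂ} {ρ h : ℝ} (hh : 0 < h) (hρ : ‖z - z₀‖ ≤ ρ) {ζ : ι → ℂ}
    (hζ : ∀ j, h ≤ ‖z₀ - ζ j‖) :
    ∏ j, ‖z - ζ j‖ ≤ (1 + ρ / h) ^ Fintype.card ι * ∏ j, ‖z₀ - ζ j‖ := by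
  have hρ0 : 0 ≤ ρ := (norm_nonneg _).trans hρ
  rw [← Finset.card_univ, ← Finset.prod_const, ← Finset.prod_mul_distrib]
  refine Finset.prod_le_prod (fun j _ => norm_nonneg _) fun j _ => ?_
  calc ‖z - ζ j‖ ≤ ‖z - z₀‖ + ‖z₀ - ζ j‖ := norm_sub_le_norm_sub_add_norm_sub _ _ _
    _ ≤ ρ / h * h + ‖z₀ - ζ j‖ := by rwa [div_mul_cancel₀ _ hh.ne', add_le_add_iff_right]
    _ ≤ ρ / h * ‖z₀ - ζ j‖ + ‖z₀ - ζ j‖ := by gcongr; exact hζ j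
    _ = _ := by ring

lemma norm_eval_wronskian_prod_le {z z₀ : ℂ} {ρ h η δ : ℝ} (hh : 0 < h) (hρ : ‖z - z₀‖ ≤ ρ)
    {a b : ι → ℂ} (ha : ∀ j, h ≤ ‖z₀ - a j‖) (hb : ∀ j, h ≤ ‖z₀ - b j‖)
    (hza : ∀ j, z ≠ a j) (hzb : ∀ j, z ≠ b j)
    (hη : ‖∑ j, (z - a j)⁻¹ - ∑ j, (z - b j)⁻¹‖ ≤ η)
    (hδ : δ ≤ ‖∑ j, (z₀ - a j)⁻¹ - ∑ j, (z₀ - b j)⁻¹‖) {T : ℝ} (hT : 0 ≤ T)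
    (hTη : T * ((1 + ρ / h) ^ (2 * Fintype.card ι) * η) ≤ δ) :
    T * ‖(wronskian (∏ j, (X - C (b j))) (∏ j, (X - C (a j)))).eval z‖ ≤
      ‖(wronskian (∏ j, (X - C (b j))) (∏ j, (X - C (a j)))).eval z₀‖ := by
  have hne : ∀ ξ : ι → ℂ, (∀ j, h ≤ ‖z₀ - ξ j‖) → ∀ j, z₀ ≠ ξ j := fun ξ hξ j =>
    sub_ne_zero.1 (norm_pos_iff.1 (hh.trans_le (hξ j)))
  have hη0 : 0 ≤ η := (norm_nonneg _).trans hη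
  have hρ0 : 0 ≤ ρ := (norm_nonneg _).trans hρ
  rw [eval_wronskian_prod hza hzb, eval_wronskian_prod (hne a ha) (hne b hb)]
  simp only [norm_mul, norm_prod]
  calc _ ≤ T * (η * (((1 + ρ / h) ^ Fintype.card ι * ∏ j, ‖z₀ - a j‖) *
          ((1 + ρ / h) ^ Fintype.card ι * ∏ j, ‖z₀ - b j‖))) := by
        gcongr
        exacts [prod_norm_sub_le hh hρ ha, prod_norm_sub_le hh hρ hb]
    _ = T * ((1 + ρ / h) ^ (2 * Fintype.card ι) * η) *
          ((∏ j, ‖z₀ - a j‖) * ∏ j, ‖z₀ - b j‖) := by ring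
    _ ≤ _ := by
        gcongr
        exact hTη.trans hδ

lemma le_norm_sub_of_le_abs_norm_sub_sub {y z₀ w : ℂ} {h : ℝ} (hw : h ≤ |‖w - y‖ - ‖z₀ - y‖|) :
    h ≤ ‖z₀ - w‖ := by
  refine hw.trans ((abs_norm_sub_norm_le _ _).trans_eq ?_)
  rw [sub_sub_sub_cancel_right, norm_sub_rev]

/-- Since the Wronskian has degree less than `2 * m` for `m` points, a Cauchy transform difference
which is large somewhere is small only on a small set. -/
lemma measure_norm_sum_sub_sum_le {lam : Measure ℂ} [NullSingletonClass lam] {s : Set ℂ}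
    {K : ℝ≥0∞} (hK : ∀ w, ∫⁻ z in s, ↑‖z - w‖₊⁻¹ ∂lam ≤ K) {y : ℂ} {r : ℝ} (hr : 0 < r)
    {ρ : ℝ≥0} (hρ : ∀ z ∈ s, ‖z - y‖ + r ≤ ρ) {h : ℝ} (hh : 0 < h) {ζ ζ' : ι → ℂ}
    (hζ : ∀ j, h ≤ |‖ζ j - y‖ - r|) (hζ' : ∀ j, h ≤ |‖ζ' j - y‖ - r|)
    (hne : ballCount y r ζ ≠ ballCount y r ζ') {a η : ℝ} (ha : 0 ≤ a)
    (hη : Real.exp (2 * Fintype.card ι * (a + 1)) *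
      ((1 + ρ / h) ^ (2 * Fintype.card ι) * η) ≤ (2 * r)⁻¹) :
    lam {z ∈ s | ‖∑ j, (z - ζ j)⁻¹ - ∑ j, (z - ζ' j)⁻¹‖ ≤ η} ≤
      ρ * K * ENNReal.ofReal (Real.exp (-a)) := by
  have hoff : ∀ ξ : ι → ℂ, (∀ j, h ≤ |‖ξ j - y‖ - r|) → ∀ j, ‖ξ j - y‖ ≠ r := fun ξ hξ j hj =>
    hh.not_ge (by simpa [hj] using hξ j)
  obtain ⟨z₀, rfl, hz₀⟩ := exists_lt_norm_sum_sub_sum hr (hoff ζ hζ) (hoff ζ' hζ') hne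
  have hfar := fun j => le_norm_sub_of_le_abs_norm_sub_sub (hζ j)
  have hfar' := fun j => le_norm_sub_of_le_abs_norm_sub_sub (hζ' j)
  have hρ' : ∀ z ∈ s, ‖z - z₀‖ ≤ ρ := fun z hz =>
    (norm_sub_le_norm_sub_add_norm_sub z y z₀).trans (by rw [norm_sub_rev y]; exact hρ z hz)
  set W := wronskian (∏ j, (X - C (ζ' j))) (∏ j, (X - C (ζ j)))
  have hne₀ : ∀ ξ : ι → ℂ, (∀ j, h ≤ ‖z₀ - ξ j‖) → ∀ j, z₀ ≠ ξ j := fun ξ hξ j =>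
    sub_ne_zero.1 (norm_pos_iff.1 (hh.trans_le (hξ j)))
  have hW0 : W ≠ 0 := wronskian_prod_ne_zero (hne₀ ζ hfar) (hne₀ ζ' hfar')
    (norm_pos_iff.1 (hz₀.trans' (by positivity)))
  have hcard : 0 < 2 * Fintype.card ι := by
    refine Nat.mul_pos two_pos (Fintype.card_pos_iff.2 (not_isEmpty_iff.1 fun hι => hne ?_))
    simp [ballCount]
  have hsubset : {z ∈ s | ‖∑ j, (z - ζ j)⁻¹ - ∑ j, (z - ζ' j)⁻¹‖ ≤ η} ⊆
      (Set.range ζ ∪ Set.range ζ') ∪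
        {z ∈ s | Real.exp ((2 * Fintype.card ι : ℕ) * (a + 1)) * ‖W.eval z‖ ≤ ‖W.eval z₀‖} := by
    rintro z ⟨hz, hzη⟩
    refine or_iff_not_imp_left.2 fun hrange => ⟨hz, ?_⟩
    simp only [Set.mem_union, Set.mem_range, not_or, not_exists] at hrange
    exact norm_eval_wronskian_prod_le hh (hρ' z hz) hfar hfar' (fun j hj => hrange.1 j hj.symm)
      (fun j hj => hrange.2 j hj.symm) hzη hz₀.le (Real.exp_pos _).le (by exact_mod_cast hη)
  have hnull : lam (Set.range ζ ∪ Set.range ζ') = 0 :=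
    ((Set.finite_range ζ).union (Set.finite_range ζ')).measure_zero _
  calc _ ≤ _ := (measure_mono hsubset).trans (measure_union_le _ _)
    _ ≤ _ := by
      rw [hnull, zero_add]
      exact measure_norm_eval_small_le hK hW0 hcard (natDegree_wronskian_prod_le ζ ζ')
        (fun z hz => by rw [norm_sub_rev]; exact hρ' z hz) ha

end CauchyTransform

section TorusFourier

variable {ι : Type*} [Fintype ι]

/-- The product of copies of Lebesgue measure on `(-π, π]`: unnormalised Haar measure on the torus
dual to the lattice `ι → ℤ`. -/
def torusMeasure (ι : Type*) [Fintype ι] : Measure (ι → ℝ) :=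
  Measure.pi fun _ => volume.restrict (Set.Ioc (-Real.pi) Real.pi)

instance : IsFiniteMeasure (torusMeasure ι) := by
  unfold torusMeasure
  infer_instance

/-- The character `θ ↦ exp (i θ·k)` of the torus. -/
def torusChar (θ : ι → ℝ) (k : ι → ℤ) : ℂ := Complex.exp (((∑ l, θ l * k l : ℝ) : ℂ) * Complex.I)

lemma norm_torusChar (θ : ι → ℝ) (k : ι → ℤ) : ‖torusChar θ k‖ = 1 :=
  Complex.norm_exp_ofReal_mul_I _

lemma re_torusChar (θ : ι → ℝ) (k : ι → ℤ) : (torusChar θ k).re = Real.cos (∑ l, θ l * k l) :=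
  Complex.exp_ofReal_mul_I_re _

lemma torusChar_zero (θ : ι → ℝ) : torusChar θ 0 = 1 := by simp [torusChar]

lemma torusChar_add (θ : ι → ℝ) (k k' : ι → ℤ) :
    torusChar θ (k + k') = torusChar θ k * torusChar θ k' := by
  rw [torusChar, torusChar, torusChar, ← Complex.exp_add, ← add_mul, ← Complex.ofReal_add,
    ← Finset.sum_add_distrib]
  simp only [Pi.add_apply, Int.cast_add, mul_add]

lemma torusChar_neg (θ : ι → ℝ) (k : ι → ℤ) :
    torusChar θ (-k) = starRingEnd ℂ (torusChar θ k) := by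
  rw [torusChar, torusChar, ← Complex.exp_conj, map_mul, Complex.conj_I, Complex.conj_ofReal]
  simp

lemma torusChar_sum {κ : Type*} (s : Finset κ) (θ : ι → ℝ) (k : κ → ι → ℤ) :
    torusChar θ (∑ j ∈ s, k j) = ∏ j ∈ s, torusChar θ (k j) := by
  classical
  induction s using Finset.induction_on with
  | empty => simp [torusChar_zero]
  | insert a s ha ih => rw [Finset.sum_insert ha, Finset.prod_insert ha, torusChar_add, ih]

lemma measurable_torusChar {Y : Type*} [MeasurableSpace Y] {f : Y → ι → ℝ} {g : Y → ι → ℤ}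
    (hf : Measurable f) (hg : Measurable g) : Measurable fun y => torusChar (f y) (g y) := by
  have hcast : Measurable fun k : ℤ => (k : ℝ) := measurable_from_top
  unfold torusChar
  fun_prop

lemma integral_exp_mul_int {k : ℤ} (hk : k ≠ 0) :
    ∫ x in Set.Ioc (-Real.pi) Real.pi, Complex.exp (k * Complex.I * (x : ℂ)) = 0 := by
  rw [← intervalIntegral.integral_of_le (by linarith [Real.pi_pos]),
    integral_exp_mul_complex (mul_ne_zero (Int.cast_ne_zero.2 hk) Complex.I_ne_zero),
    (Complex.exp_eq_exp_iff_exists_int (y := k * Complex.I * (-Real.pi : ℝ))).2 ⟨k, by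
      push_cast; ring⟩, sub_self, zero_div]

lemma torusMeasure_real_univ : (torusMeasure ι).real Set.univ = (2 * Real.pi) ^ Fintype.card ι := by
  simp [measureReal_def, torusMeasure, Measure.pi_univ, ENNReal.toReal_pow, Real.pi_pos.le, two_mul]

lemma integral_torusChar (k : ι → ℤ) :
    ∫ θ, torusChar θ k ∂torusMeasure ι =
      if k = 0 then (((2 * Real.pi) ^ Fintype.card ι : ℝ) : ℂ) else 0 := by
  split_ifs with hk
  · simp [hk, torusChar_zero, torusMeasure_real_univ]
  · obtain ⟨l, hl⟩ := Function.ne_iff.1 hk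
    have hprod : ∀ θ : ι → ℝ, torusChar θ k = ∏ i, Complex.exp (k i * Complex.I * (θ i : ℂ)) :=
      fun θ => by
        rw [torusChar, ← Complex.exp_sum, Complex.ofReal_sum, Finset.sum_mul]
        push_cast
        simp only [mul_comm, mul_left_comm]
    simp_rw [hprod]
    rw [torusMeasure, integral_fintype_prod_eq_prod (𝕜 := ℂ)
      fun i (x : ℝ) => Complex.exp (k i * Complex.I * (x : ℂ))]
    exact Finset.prod_eq_zero (Finset.mem_univ l) (integral_exp_mul_int hl)

lemma ae_torusMeasure_abs_le_pi : ∀ᵐ θ ∂torusMeasure ι, ∀ l, |θ l| ≤ Real.pi := by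
  refine ae_all_iff.2 fun l => (Measure.quasiMeasurePreserving_eval
    (fun _ : ι => volume.restrict (Set.Ioc (-Real.pi) Real.pi)) l).ae
    (p := fun x => |x| ≤ Real.pi) ?_
  filter_upwards [ae_restrict_mem measurableSet_Ioc] with x hx
  exact abs_le.2 ⟨hx.1.le, hx.2⟩

lemma integral_exp_neg_mul_sum_sq_le {c : ℝ} (hc : 0 < c) :
    ∫ θ, Real.exp (-c * ∑ l, θ l ^ 2) ∂torusMeasure ι ≤ √(Real.pi / c) ^ Fintype.card ι := by
  simp_rw [Finset.mul_sum, Real.exp_sum]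
  rw [torusMeasure, integral_fintype_prod_eq_pow (𝕜 := ℝ) fun x : ℝ => Real.exp (-c * x ^ 2)]
  gcongr
  rw [← integral_gaussian]
  exact setIntegral_le_integral (integrable_exp_neg_mul_sq hc)
    (.of_forall fun x => (Real.exp_pos _).le)

variable {Y : Type*} [MeasurableSpace Y] {μ : Measure Y}

lemma integral_torusChar_sub [SFinite μ] (θ : ι → ℝ) (v : Y → ι → ℤ) :
    ∫ q : Y × Y, torusChar θ (v q.1 - v q.2) ∂(μ.prod μ) =
      ((‖∫ a, torusChar θ (v a) ∂μ‖ ^ 2 : ℝ) : ℂ) := by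
  simp_rw [sub_eq_add_neg, torusChar_add, torusChar_neg]
  rw [integral_prod_mul (fun a => torusChar θ (v a)) fun a => starRingEnd ℂ (torusChar θ (v a)),
    integral_conj, Complex.mul_conj, Complex.normSq_eq_norm_sq]

lemma integrable_torusChar [IsFiniteMeasure μ] {f : Y → ι → ℝ} {g : Y → ι → ℤ}
    (hf : Measurable f) (hg : Measurable g) : Integrable (fun y => torusChar (f y) (g y)) μ :=
  .of_bound (measurable_torusChar hf hg).aestronglyMeasurable 1 (.of_forall fun _ =>
    (norm_torusChar _ _).le)

/-- Plancherel's formula for the law of `v`. -/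
lemma two_pi_pow_mul_measureReal_eq_integral [IsFiniteMeasure μ] {v : Y → ι → ℤ}
    (hv : Measurable v) :
    (2 * Real.pi) ^ Fintype.card ι * (μ.prod μ).real {q | v q.1 = v q.2} =
      ∫ θ, ‖∫ a, torusChar θ (v a) ∂μ‖ ^ 2 ∂torusMeasure ι := by
  classical
  have hdiff : Measurable fun q : Y × Y => v q.1 - v q.2 := by fun_prop
  have hset : MeasurableSet {q : Y × Y | v q.1 = v q.2} :=
    measurableSet_eq_fun (hv.comp measurable_fst) (hv.comp measurable_snd)
  have hint : Integrable (fun r : (Y × Y) × (ι → ℝ) => torusChar r.2 (v r.1.1 - v r.1.2))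
      ((μ.prod μ).prod (torusMeasure ι)) :=
    integrable_torusChar measurable_snd (hdiff.comp measurable_fst)
  have hswap := integral_integral_swap
    (f := fun (q : Y × Y) θ => torusChar θ (v q.1 - v q.2)) hint
  simp only [integral_torusChar_sub, integral_torusChar, sub_eq_zero] at hswap
  rw [integral_complex_ofReal] at hswap
  rw [← Complex.ofReal_inj, ← hswap]
  have hind : (fun q : Y × Y =>
      if v q.1 = v q.2 then (((2 * Real.pi) ^ Fintype.card ι : ℝ) : ℂ) else 0) =
        {q | v q.1 = v q.2}.indicator fun _ => (((2 * Real.pi) ^ Fintype.card ι : ℝ) : ℂ) := by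
    ext q
    simp only [Set.indicator_apply, Set.mem_ofPred_eq]
  rw [hind, integral_indicator_const _ hset, Complex.real_smul]
  push_cast
  ring

lemma integral_torusChar_sum_pi [SigmaFinite μ] {κ : Type*} [Fintype κ] (θ : ι → ℝ)
    (v : Y → ι → ℤ) :
    ∫ ζ : κ → Y, torusChar θ (∑ j, v (ζ j)) ∂Measure.pi (fun _ => μ) =
      (∫ a, torusChar θ (v a) ∂μ) ^ Fintype.card κ := by
  simp_rw [torusChar_sum]
  exact integral_fintype_prod_eq_pow (𝕜 := ℂ) fun a => torusChar θ (v a)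

variable [DecidableEq ι]

lemma re_torusChar_sub_le (θ : ι → ℝ) (k k' : ι → ℤ) :
    (torusChar θ (k - k')).re ≤ 1 - ∑ l, (({Pi.single l 1} : Set (ι → ℤ)) ×ˢ {0}).indicator
      (fun _ => 1 - Real.cos (θ l)) (k, k') := by
  by_cases hk : ∃ l, k = Pi.single l 1 ∧ k' = 0
  · obtain ⟨l, rfl, rfl⟩ := hk
    have hsum : ∑ i, θ i * ((Pi.single l 1 : ι → ℤ) i : ℝ) = θ l := by
      simp [Pi.single_apply]
    rw [sub_zero, re_torusChar, hsum, Finset.sum_eq_single l]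
    · simp
    · intro i _ hi
      exact Set.indicator_of_notMem (fun h => by simpa [hi] using congr_fun h.1 i) _
    · simp
  · push Not at hk
    rw [Finset.sum_eq_zero fun l _ => Set.indicator_of_notMem (fun h => hk l h.1 h.2) _, sub_zero,
      re_torusChar]
    exact Real.cos_le_one _

variable [IsProbabilityMeasure μ] {v : Y → ι → ℤ} {p : ℝ}

lemma norm_integral_torusChar_sq_le_one_sub (hv : Measurable v) (hp : 0 ≤ p)
    (hsingle : ∀ l, p ≤ μ.real (v ⁻¹' {Pi.single l 1})) (hzero : p ≤ μ.real (v ⁻¹' {0}))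
    (θ : ι → ℝ) :
    ‖∫ a, torusChar θ (v a) ∂μ‖ ^ 2 ≤ 1 - ∑ l, p ^ 2 * (1 - Real.cos (θ l)) := by
  have hdiff : Measurable fun q : Y × Y => v q.1 - v q.2 := by fun_prop
  have hint := integrable_torusChar (μ := μ.prod μ) (measurable_const (a := θ)) hdiff
  set A : ι → Set (Y × Y) := fun l => (v ⁻¹' {Pi.single l 1}) ×ˢ (v ⁻¹' {0})
  have hA : ∀ l, MeasurableSet (A l) := fun l =>
    (hv (measurableSet_singleton _)).prod (hv (measurableSet_singleton _))
  have hmeasA : ∀ l, p ^ 2 ≤ (μ.prod μ).real (A l) := fun l => by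
    rw [measureReal_prod_prod, sq]
    exact mul_le_mul (hsingle l) hzero hp measureReal_nonneg
  have hintA : ∀ l, Integrable ((A l).indicator fun _ => 1 - Real.cos (θ l)) (μ.prod μ) :=
    fun l => (integrable_const _).indicator (hA l)
  have hintsum := integrable_finsetSum Finset.univ fun l _ => hintA l
  calc ‖∫ a, torusChar θ (v a) ∂μ‖ ^ 2
      = (∫ q : Y × Y, torusChar θ (v q.1 - v q.2) ∂(μ.prod μ)).re := by
        rw [integral_torusChar_sub, Complex.ofReal_re]
    _ = ∫ q : Y × Y, (torusChar θ (v q.1 - v q.2)).re ∂(μ.prod μ) := (integral_re hint).symm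
    _ ≤ ∫ q, (1 - ∑ l, (A l).indicator (fun _ => 1 - Real.cos (θ l)) q) ∂(μ.prod μ) :=
        integral_mono hint.re ((integrable_const 1).sub hintsum) fun q =>
          re_torusChar_sub_le θ (v q.1) (v q.2)
    _ = 1 - ∑ l, (μ.prod μ).real (A l) * (1 - Real.cos (θ l)) := by
        rw [integral_sub (integrable_const 1) hintsum, integral_finsetSum _ fun l _ => hintA l]
        simp [integral_indicator_const, hA]
    _ ≤ _ := by
        gcongr with l
        · linarith [Real.cos_le_one (θ l)]
        · exact hmeasA l

lemma norm_integral_torusChar_sq_le_exp (hv : Measurable v) (hp : 0 ≤ p)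
    (hsingle : ∀ l, p ≤ μ.real (v ⁻¹' {Pi.single l 1})) (hzero : p ≤ μ.real (v ⁻¹' {0}))
    {θ : ι → ℝ} (hθ : ∀ l, |θ l| ≤ Real.pi) :
    ‖∫ a, torusChar θ (v a) ∂μ‖ ^ 2 ≤ Real.exp (-(2 * p ^ 2 / Real.pi ^ 2) * ∑ l, θ l ^ 2) := by
  calc _ ≤ 1 - ∑ l, p ^ 2 * (1 - Real.cos (θ l)) :=
        norm_integral_torusChar_sq_le_one_sub hv hp hsingle hzero θ
    _ ≤ 1 - ∑ l, p ^ 2 * (2 / Real.pi ^ 2 * θ l ^ 2) := by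
        gcongr with l
        linarith [Real.cos_le_one_sub_mul_cos_sq (hθ l)]
    _ = 1 - 2 * p ^ 2 / Real.pi ^ 2 * ∑ l, θ l ^ 2 := by
        rw [Finset.mul_sum]
        ring_nf
    _ ≤ _ := by
        rw [neg_mul]
        exact Real.one_sub_le_exp_neg _

lemma collision_probability_le (hv : Measurable v) (hp : 0 < p)
    (hsingle : ∀ l, p ≤ μ.real (v ⁻¹' {Pi.single l 1})) (hzero : p ≤ μ.real (v ⁻¹' {0}))
    {κ : Type*} [Fintype κ] [Nonempty κ] :
    ((Measure.pi fun _ : κ => μ).prod (Measure.pi fun _ : κ => μ)).real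
      {q | ∑ j, v (q.1 j) = ∑ j, v (q.2 j)} ≤
        √(Real.pi / (Fintype.card κ * (2 * p ^ 2 / Real.pi ^ 2))) ^ Fintype.card ι := by
  set ν := Measure.pi fun _ : κ => μ
  set c := 2 * p ^ 2 / Real.pi ^ 2
  have hc : 0 < Fintype.card κ * c := by positivity
  have hsum : Measurable fun ζ : κ → Y => ∑ j, v (ζ j) :=
    Finset.measurable_sum _ fun j _ => hv.comp (measurable_pi_apply j)
  have hpi : (1 : ℝ) ≤ (2 * Real.pi) ^ Fintype.card ι :=
    one_le_pow₀ (by linarith [Real.pi_gt_three])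
  calc _ ≤ (2 * Real.pi) ^ Fintype.card ι * (ν.prod ν).real
          {q | ∑ j, v (q.1 j) = ∑ j, v (q.2 j)} := le_mul_of_one_le_left measureReal_nonneg hpi
    _ = ∫ θ, ‖∫ ζ, torusChar θ (∑ j, v (ζ j)) ∂ν‖ ^ 2 ∂torusMeasure ι :=
        two_pi_pow_mul_measureReal_eq_integral hsum
    _ ≤ ∫ θ, Real.exp (-(Fintype.card κ * c) * ∑ l, θ l ^ 2) ∂torusMeasure ι := by
        refine integral_mono_of_nonneg (.of_forall fun θ => by positivity) ?_ ?_
        · refine .of_bound (Continuous.aestronglyMeasurable (by fun_prop)) 1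
            (.of_forall fun θ => ?_)
          rw [Real.norm_of_nonneg (Real.exp_pos _).le, Real.exp_le_one_iff, neg_mul, neg_nonpos]
          positivity
        · filter_upwards [ae_torusMeasure_abs_le_pi] with θ hθ
          calc ‖∫ ζ, torusChar θ (∑ j, v (ζ j)) ∂ν‖ ^ 2
              = (‖∫ a, torusChar θ (v a) ∂μ‖ ^ 2) ^ Fintype.card κ := by
                rw [integral_torusChar_sum_pi, norm_pow, pow_right_comm]
            _ ≤ Real.exp (-c * ∑ l, θ l ^ 2) ^ Fintype.card κ := by
                gcongr
                exact norm_integral_torusChar_sq_le_exp hv hp.le hsingle hzero hθ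
            _ = _ := by rw [← Real.exp_nat_mul]; ring_nf
    _ ≤ _ := integral_exp_neg_mul_sum_sq_le hc

end TorusFourier

section SeparatingDiscs

lemma exists_mem_Ioo_measure_closedBall_le (ν : Measure ℝ) [IsLocallyFiniteMeasure ν] {a b : ℝ}
    (hab : a < b) : ∃ r ∈ Set.Ioo a b, ∃ K : ℝ≥0∞, K ≠ ∞ ∧
      ∀ᶠ h in 𝓝[>] 0, ν (Metric.closedBall r h) ≤ K * ENNReal.ofReal h := by
  have hIoo : volume (Set.Ioo a b) ≠ 0 := by simpa using hab
  obtain ⟨r, hr, hlim, hfin⟩ := Measure.exists_mem_of_measure_ne_zero_of_ae hIoo <|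
    ae_restrict_of_ae <| (Besicovitch.ae_tendsto_rnDeriv ν volume).and (ν.rnDeriv_lt_top volume)
  set d := ν.rnDeriv volume r
  refine ⟨r, hr, (d + 1) * 2, by finiteness, ?_⟩
  filter_upwards [hlim.eventually_lt_const (ENNReal.lt_add_right hfin.ne one_ne_zero),
    self_mem_nhdsWithin] with h hlt hh
  rw [Real.volume_closedBall, ENNReal.div_lt_iff (.inl (by simpa using hh))
    (.inl ENNReal.ofReal_ne_top), ENNReal.ofReal_mul zero_le_two, ENNReal.ofReal_ofNat,
    ← mul_assoc] at hlt
  exact hlt.le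

lemma exists_mem_Ioo_measure_annulus_le (μ : Measure ℂ) [IsFiniteMeasure μ] (y : ℂ) {a b : ℝ}
    (hab : a < b) : ∃ r ∈ Set.Ioo a b, ∃ K : ℝ≥0∞, K ≠ ∞ ∧
      ∀ᶠ h in 𝓝[>] 0, μ {w | |‖w - y‖ - r| ≤ h} ≤ K * ENNReal.ofReal h := by
  have hmeas : Measurable fun w : ℂ => ‖w - y‖ := by fun_prop
  obtain ⟨r, hr, K, hK, hle⟩ := exists_mem_Ioo_measure_closedBall_le (μ.map fun w => ‖w - y‖) hab
  refine ⟨r, hr, K, hK, hle.mono fun h hh => ?_⟩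
  rwa [Measure.map_apply hmeas Metric.isClosed_closedBall.measurableSet] at hh

/-- The vector recording which of the discs `Metric.ball (y l) (r l)` contain a given point. Its
sum along a sample is the vector of the counts `ballCount (y l) (r l)`. -/
def discVector {ι : Type*} (y : ι → ℂ) (r : ι → ℝ) (a : ℂ) : ι → ℤ :=
  fun l => (Metric.ball (y l) (r l)).indicator 1 a

variable {ι : Type*} {y : ι → ℂ} {r : ι → ℝ}

lemma measurable_discVector : Measurable (discVector y r) :=
  measurable_pi_lambda _ fun _ => measurable_one.indicator Metric.isOpen_ball.measurableSet

lemma sum_discVector_apply {κ : Type*} [Fintype κ] (ζ : κ → ℂ) (l : ι) :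
    (∑ j, discVector y r (ζ j)) l = ballCount (y l) (r l) ζ :=
  Finset.sum_apply _ _ _

lemma discVector_eq_single [DecidableEq ι]
    (hd : Pairwise fun l l' => Disjoint (Metric.ball (y l) (r l)) (Metric.ball (y l') (r l')))
    {l : ι} {a : ℂ} (ha : a ∈ Metric.ball (y l) (r l)) : discVector y r a = Pi.single l 1 := by
  ext l'
  obtain rfl | hl := eq_or_ne l' l
  · simp [discVector, Set.indicator_of_mem ha]
  · rw [Pi.single_eq_of_ne hl]
    exact Set.indicator_of_notMem (Set.disjoint_left.1 (hd hl.symm) ha) _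

lemma discVector_eq_zero {a : ℂ} (ha : ∀ l, a ∉ Metric.ball (y l) (r l)) :
    discVector y r a = 0 :=
  funext fun l => Set.indicator_of_notMem (ha l) _

lemma exists_pos_forall_le {κ : Type*} [Finite κ] {f : κ → ℝ} (hf : ∀ i, 0 < f i) :
    ∃ p > 0, ∀ i, p ≤ f i := by
  have h : ∀ᶠ p in 𝓝[>] (0 : ℝ), ∀ i, p ≤ f i := eventually_all.2 fun i =>
    nhdsWithin_le_nhds (eventually_le_nhds (hf i))
  obtain ⟨p, hle, hp⟩ := (h.and self_mem_nhdsWithin).exists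
  exact ⟨p, hp, hle⟩

lemma measureReal_pos_of_mem_support {μ : Measure ℂ} [IsFiniteMeasure μ] {x : ℂ}
    (hx : x ∈ μ.support) {U : Set ℂ} (hU : U ∈ 𝓝 x) : 0 < μ.real U :=
  ENNReal.toReal_pos ((Measure.mem_support_iff_forall x).1 hx U hU).ne' (measure_ne_top μ U)

lemma exists_discVector_of_infinite_support {μ : Measure ℂ} [IsFiniteMeasure μ]
    (hμ : μ.support.Infinite) (L : ℕ) : ∃ (y : Fin L → ℂ) (r : Fin L → ℝ), (∀ l, 0 < r l) ∧
      (∃ p > 0, (∀ l, p ≤ μ.real (discVector y r ⁻¹' {Pi.single l 1})) ∧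
        p ≤ μ.real (discVector y r ⁻¹' {0})) ∧
      ∃ K : ℝ≥0∞, K ≠ ∞ ∧
        ∀ᶠ h in 𝓝[>] 0, μ {w | ∃ l, |‖w - y l‖ - r l| ≤ h} ≤ K * ENNReal.ofReal h := by
  obtain ⟨t, ht, htc⟩ := hμ.exists_subset_card_eq (L + 1)
  let e : Fin (L + 1) ≃ t := (t.equivFinOfCardEq htc).symm
  let x (i : Fin (L + 1)) : ℂ := e i
  have hx (i) : x i ∈ μ.support := ht (e i).2
  have hxinj : Function.Injective x := Subtype.val_injective.comp e.injective
  obtain ⟨U, hU, hdisj⟩ := t.finite_toSet.t2_separation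
  have hUx (i) : U (x i) ∈ 𝓝 (x i) := (hU (x i)).2.mem_nhds (hU (x i)).1
  have hUdisj {i j} (hij : i ≠ j) : Disjoint (U (x i)) (U (x j)) :=
    hdisj (e i).2 (e j).2 (hxinj.ne hij)
  choose δ hδ hδU using fun i => Metric.mem_nhds_iff.1 (hUx i)
  choose r hr K hK hrK using fun l : Fin L =>
    exists_mem_Ioo_measure_annulus_le μ (x l.castSucc) (hδ l.castSucc)
  have hball (l : Fin L) : Metric.ball (x l.castSucc) (r l) ⊆ U (x l.castSucc) :=
    (Metric.ball_subset_ball (hr l).2.le).trans (hδU _)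
  obtain ⟨p, hp, hple⟩ := exists_pos_forall_le fun l =>
    measureReal_pos_of_mem_support (hx l.castSucc) (Metric.ball_mem_nhds _ (hr l).1)
  have hp₀ := measureReal_pos_of_mem_support (hx (Fin.last L)) (hUx _)
  refine ⟨fun l => x l.castSucc, r, fun l => (hr l).1,
    ⟨min p (μ.real (U (x (Fin.last L)))), lt_min hp hp₀, fun l => ?_, ?_⟩,
    ∑ l, K l, ENNReal.sum_ne_top.2 fun l _ => hK l, ?_⟩
  · refine (min_le_left _ _).trans ((hple l).trans (measureReal_mono fun a ha => ?_))
    refine discVector_eq_single (fun l l' hl => ?_) ha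
    exact (hUdisj ((Fin.castSucc_injective L).ne hl)).mono (hball l) (hball l')
  · refine (min_le_right _ _).trans (measureReal_mono fun a ha => discVector_eq_zero fun l hl => ?_)
    exact Set.disjoint_left.1 (hUdisj (Fin.castSucc_ne_last l)) (hball l hl) ha
  · filter_upwards [eventually_all.2 hrK] with h hh
    rw [Set.ofPred_exists, Finset.sum_mul]
    exact (measure_iUnion_fintype_le _ _).trans (Finset.sum_le_sum fun l _ => hh l)

end SeparatingDiscs

section CauchyAnticoncentration

variable {κ : Type*} [Fintype κ]

lemma prod_pi_exists_mem_le {Y : Type*} [MeasurableSpace Y] (μ : Measure Y)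
    [IsProbabilityMeasure μ] {B : Set Y} (hB : MeasurableSet B) :
    ((Measure.pi fun _ : κ => μ).prod (Measure.pi fun _ : κ => μ))
      {q | ∃ j, q.1 j ∈ B ∨ q.2 j ∈ B} ≤ Fintype.card κ * (2 * μ B) := by
  set ν := Measure.pi fun _ : κ => μ
  have hfst (j : κ) : (ν.prod ν) {q | q.1 j ∈ B} = μ B :=
    ((measurePreserving_eval (fun _ : κ => μ) j).comp
      measurePreserving_fst).measure_preimage hB.nullMeasurableSet
  have hsnd (j : κ) : (ν.prod ν) {q | q.2 j ∈ B} = μ B :=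
    ((measurePreserving_eval (fun _ : κ => μ) j).comp
      measurePreserving_snd).measure_preimage hB.nullMeasurableSet
  calc (ν.prod ν) {q | ∃ j, q.1 j ∈ B ∨ q.2 j ∈ B}
      = (ν.prod ν) (⋃ j, {q | q.1 j ∈ B} ∪ {q | q.2 j ∈ B}) := by
        congr 1
        ext q
        simp
    _ ≤ ∑ j, (ν.prod ν) ({q | q.1 j ∈ B} ∪ {q | q.2 j ∈ B}) := measure_iUnion_fintype_le _ _
    _ ≤ ∑ _j : κ, 2 * μ B := by
        refine Finset.sum_le_sum fun j _ => (measure_union_le _ _).trans_eq ?_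
        rw [hfst, hsnd, two_mul]
    _ = _ := by simp

lemma prod_pi_exists_mem_le_inv_pow [Nonempty κ] {Y : Type*} [MeasurableSpace Y] {μ : Measure Y}
    [IsProbabilityMeasure μ] {B : Set Y} (hB : MeasurableSet B) {K : ℝ≥0∞} {A : ℕ}
    (hμB : μ B ≤ K * (Fintype.card κ : ℝ≥0∞)⁻¹ ^ (A + 1)) :
    ((Measure.pi fun _ : κ => μ).prod (Measure.pi fun _ : κ => μ))
      {q | ∃ j, q.1 j ∈ B ∨ q.2 j ∈ B} ≤ (Fintype.card κ : ℝ≥0∞)⁻¹ ^ A * (2 * K) := by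
  set m := (Fintype.card κ : ℝ≥0∞)
  have hm : m * m⁻¹ ^ (A + 1) = m⁻¹ ^ A := by
    rw [pow_succ', ← mul_assoc, ENNReal.mul_inv_cancel (by simp) (ENNReal.natCast_ne_top _),
      one_mul]
  calc _ ≤ m * (2 * μ B) := prod_pi_exists_mem_le μ hB
    _ ≤ m * (2 * (K * m⁻¹ ^ (A + 1))) := by gcongr
    _ = _ := by rw [← hm]; ring

variable {ι : Type*} {y : ι → ℂ} {r : ι → ℝ} {μ : Measure ℂ} [IsProbabilityMeasure μ]

lemma collision_probability_le_mul_inv_pow [Fintype ι] [DecidableEq ι] [Nonempty κ] {p : ℝ}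
    (hp : 0 < p) (hsingle : ∀ l, p ≤ μ.real (discVector y r ⁻¹' {Pi.single l 1}))
    (hzero : p ≤ μ.real (discVector y r ⁻¹' {0})) {B : ℕ} (hB : Fintype.card ι = 2 * B) :
    ((Measure.pi fun _ : κ => μ).prod (Measure.pi fun _ : κ => μ))
      {q | ∑ j, discVector y r (q.1 j) = ∑ j, discVector y r (q.2 j)} ≤
        ENNReal.ofReal ((Real.pi / (2 * p ^ 2 / Real.pi ^ 2)) ^ B) *
          (Fintype.card κ : ℝ≥0∞)⁻¹ ^ B := by
  set c := 2 * p ^ 2 / Real.pi ^ 2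
  have hκ : (0 : ℝ) < Fintype.card κ := by exact_mod_cast Fintype.card_pos
  have hpow : √(Real.pi / (Fintype.card κ * c)) ^ Fintype.card ι =
      (Real.pi / c) ^ B * (Fintype.card κ : ℝ)⁻¹ ^ B := by
    rw [hB, pow_mul, Real.sq_sqrt (by positivity), ← mul_pow]
    congr 1
    field_simp
  rw [← ofReal_measureReal]
  refine (ENNReal.ofReal_le_ofReal
    ((collision_probability_le measurable_discVector hp hsingle hzero).trans_eq hpow)).trans_eq ?_
  rw [ENNReal.ofReal_mul (by positivity), ENNReal.ofReal_pow (inv_nonneg.2 hκ.le),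
    ENNReal.ofReal_inv_of_pos hκ, ENNReal.ofReal_natCast]

lemma measurableSet_norm_sum_inv_sub_le (η : ℝ) :
    MeasurableSet {s : ℂ × (κ → ℂ) × (κ → ℂ) |
      ‖∑ j, (s.1 - s.2.1 j)⁻¹ - ∑ j, (s.1 - s.2.2 j)⁻¹‖ ≤ η} :=
  measurableSet_le (by fun_prop) measurable_const

lemma lintegral_measure_setOf_le {X Y : Type*} [MeasurableSpace X] [MeasurableSpace Y]
    {lam : Measure X} [SFinite lam] {ν : Measure Y} [IsProbabilityMeasure ν] {S : Set (X × Y)}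
    (hS : MeasurableSet S) {G : Set Y} {C : ℝ≥0∞} (hC : ∀ y ∉ G, lam {x | (x, y) ∈ S} ≤ C) :
    ∫⁻ x, ν {y | (x, y) ∈ S} ∂lam ≤ lam Set.univ * ν G + C := by
  calc ∫⁻ x, ν {y | (x, y) ∈ S} ∂lam
      = ∫⁻ y, lam {x | (x, y) ∈ S} ∂ν :=
        (Measure.prod_apply hS).symm.trans (Measure.prod_apply_symm hS)
    _ ≤ ∫⁻ y, (G.indicator (fun _ => lam Set.univ) y + C) ∂ν := by
        refine lintegral_mono fun y => ?_
        by_cases hy : y ∈ G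
        · rw [Set.indicator_of_mem hy]
          exact le_add_right (measure_mono (Set.subset_univ _))
        · exact le_add_left (hC y hy)
    _ = ∫⁻ y, G.indicator (fun _ => lam Set.univ) y ∂ν + C := by
        rw [lintegral_add_right _ measurable_const, lintegral_const, measure_univ (μ := ν), mul_one]
    _ ≤ _ := by
        gcongr
        exact lintegral_indicator_const_le _ _

lemma lintegral_prod_pi_norm_sum_sub_le [Finite ι] {lam : Measure ℂ} [SFinite lam]
    [NullSingletonClass lam] {s : Set ℂ} {K : ℝ≥0∞} (hK : ∀ w, ∫⁻ z in s, ↑‖z - w‖₊⁻¹ ∂lam ≤ K)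
    (hr : ∀ l, 0 < r l) {ρ : ℝ≥0} (hρ : ∀ l, ∀ z ∈ s, ‖z - y l‖ + r l ≤ ρ) {h : ℝ} (hh : 0 < h)
    {a η : ℝ} (ha : 0 ≤ a) (hη : ∀ l, Real.exp (2 * Fintype.card κ * (a + 1)) *
      ((1 + ρ / h) ^ (2 * Fintype.card κ) * η) ≤ (2 * r l)⁻¹) :
    ∫⁻ z in s, ((Measure.pi fun _ : κ => μ).prod (Measure.pi fun _ : κ => μ))
        {q | ‖∑ j, (z - q.1 j)⁻¹ - ∑ j, (z - q.2 j)⁻¹‖ ≤ η} ∂lam ≤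
      lam s * (((Measure.pi fun _ : κ => μ).prod (Measure.pi fun _ : κ => μ))
          {q | ∃ j, q.1 j ∈ {w | ∃ l, |‖w - y l‖ - r l| ≤ h} ∨
            q.2 j ∈ {w | ∃ l, |‖w - y l‖ - r l| ≤ h}} +
        ((Measure.pi fun _ : κ => μ).prod (Measure.pi fun _ : κ => μ))
          {q | ∑ j, discVector y r (q.1 j) = ∑ j, discVector y r (q.2 j)}) +
        ρ * K * ENNReal.ofReal (Real.exp (-a)) := by
  set ν := Measure.pi fun _ : κ => μ
  set G₁ : Set ((κ → ℂ) × (κ → ℂ)) := {q | ∃ j, q.1 j ∈ {w | ∃ l, |‖w - y l‖ - r l| ≤ h} ∨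
    q.2 j ∈ {w | ∃ l, |‖w - y l‖ - r l| ≤ h}}
  set G₂ : Set ((κ → ℂ) × (κ → ℂ)) :=
    {q | ∑ j, discVector y r (q.1 j) = ∑ j, discVector y r (q.2 j)}
  have hgood : ∀ q ∉ G₁ ∪ G₂,
      lam.restrict s {z | ‖∑ j, (z - q.1 j)⁻¹ - ∑ j, (z - q.2 j)⁻¹‖ ≤ η} ≤
        ρ * K * ENNReal.ofReal (Real.exp (-a)) := by
    intro q hq
    simp only [G₁, G₂, Set.mem_union, Set.mem_ofPred_eq, not_or, not_exists, not_le,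
      funext_iff, not_forall, sum_discVector_apply] at hq
    obtain ⟨hfar, l, hl⟩ := hq
    rw [Measure.restrict_apply (measurableSet_le (by fun_prop) measurable_const), Set.inter_comm]
    exact measure_norm_sum_sub_sum_le hK (hr l) (hρ l) hh (fun j => ((hfar j).1 l).le)
      (fun j => ((hfar j).2 l).le) hl ha (hη l)
  refine (lintegral_measure_setOf_le (measurableSet_norm_sum_inv_sub_le η) hgood).trans ?_
  rw [Measure.restrict_apply_univ]
  gcongr
  exact measure_union_le _ _

lemma eventually_exp_mul_pow_mul_exp_le {ε ρ r : ℝ} (hε : 0 < ε) (hρ : 0 ≤ ρ) (hr : 0 < r) :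
    ∀ᶠ n : ℕ in atTop, Real.exp (2 * n.sqrt * (ε / 8 * n.sqrt + 1)) *
      ((1 + ρ / Real.exp (-(ε / 8 * n.sqrt))) ^ (2 * n.sqrt) * Real.exp (-ε * n)) ≤ (2 * r)⁻¹ := by
  set b := 1 + Real.log (1 + ρ)
  have hsqrt : Tendsto (fun n : ℕ => (n.sqrt : ℝ)) atTop atTop :=
    tendsto_natCast_atTop_atTop.comp tendsto_natSqrt_atTop
  filter_upwards [hsqrt.eventually_ge_atTop (8 * b / ε), hsqrt.eventually_ge_atTop 1,
    hsqrt.eventually_ge_atTop (4 * Real.log (2 * r) / ε)] with n hb hone hlog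
  rw [div_le_iff₀ hε] at hb hlog
  set m := n.sqrt
  set a := ε / 8 * m with ha
  have ha0 : 0 ≤ a := by positivity
  have hmn : (m : ℝ) ^ 2 ≤ n := by exact_mod_cast n.sqrt_le'
  have hbase : 1 + ρ / Real.exp (-a) ≤ Real.exp (Real.log (1 + ρ) + a) := by
    rw [Real.exp_add, Real.exp_log (by positivity), Real.exp_neg, div_inv_eq_mul, add_mul, one_mul]
    gcongr
    exact Real.one_le_exp ha0
  have hquad : 2 * m * (a + 1) + (2 * m * (Real.log (1 + ρ) + a) + -ε * n) ≤
      -Real.log (2 * r) := by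
    have hlin : 2 * m * b ≤ ε / 4 * m ^ 2 := by nlinarith
    have hconst : Real.log (2 * r) ≤ ε / 4 * m ^ 2 := by nlinarith
    nlinarith
  calc _ ≤ Real.exp (2 * m * (a + 1)) *
        (Real.exp (Real.log (1 + ρ) + a) ^ (2 * m) * Real.exp (-ε * n)) := by gcongr
    _ = Real.exp (2 * m * (a + 1) + (2 * m * (Real.log (1 + ρ) + a) + -ε * n)) := by
        rw [← Real.exp_nat_mul, ← Real.exp_add, ← Real.exp_add]
        push_cast
        rfl
    _ ≤ Real.exp (-Real.log (2 * r)) := Real.exp_le_exp.2 hquad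
    _ = _ := by rw [Real.exp_neg, Real.exp_log (by positivity)]

lemma eventually_ofReal_exp_neg_le_inv_pow {c : ℝ} (hc : 0 < c) (B : ℕ) :
    ∀ᶠ m : ℕ in atTop, ENNReal.ofReal (Real.exp (-(c * m))) ≤ (m : ℝ≥0∞)⁻¹ ^ B := by
  have hlim := (isLittleO_pow_exp_pos_mul_atTop B hc).comp_tendsto tendsto_natCast_atTop_atTop
  filter_upwards [hlim.bound one_pos, eventually_gt_atTop 0] with m hm hpos
  have hpos' : (0 : ℝ) < m := by exact_mod_cast hpos
  rw [Function.comp_apply, Function.comp_apply, one_mul, Real.norm_of_nonneg (by positivity),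
    Real.norm_of_nonneg (Real.exp_pos _).le] at hm
  rw [← ENNReal.ofReal_natCast, ← ENNReal.ofReal_inv_of_pos hpos',
    ← ENNReal.ofReal_pow (by positivity), inv_pow, Real.exp_neg]
  exact ENNReal.ofReal_le_ofReal (inv_anti₀ (by positivity) hm)

lemma exists_norm_sub_add_le [Finite ι] {s : Set ℂ} (hs : Bornology.IsBounded s) (y : ι → ℂ)
    (r : ι → ℝ) : ∃ ρ : ℝ≥0, ∀ l, ∀ z ∈ s, ‖z - y l‖ + r l ≤ ρ := by
  have hfin : (Set.range fun l => ‖y l‖ + r l).Finite := Set.finite_range _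
  obtain ⟨R, hR⟩ := hs.exists_norm_le
  obtain ⟨b, hb⟩ := hfin.bddAbove
  refine ⟨(R + b).toNNReal, fun l z hz => le_trans ?_ (Real.le_coe_toNNReal _)⟩
  linarith [norm_sub_le z (y l), hR z hz, hb (Set.mem_range_self l)]

lemma tendsto_exp_neg_mul_natSqrt {c : ℝ} (hc : 0 < c) :
    Tendsto (fun n : ℕ => Real.exp (-(c * n.sqrt))) atTop (𝓝[>] 0) :=
  tendsto_nhdsWithin_iff.2 ⟨Real.tendsto_exp_neg_atTop_nhds_zero.comp <|
    (tendsto_natCast_atTop_atTop.comp tendsto_natSqrt_atTop).const_mul_atTop hc,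
    .of_forall fun _ => Real.exp_pos _⟩

lemma measurableSet_near_circles [Countable ι] (y : ι → ℂ) (r : ι → ℝ) (h : ℝ) :
    MeasurableSet {w | ∃ l, |‖w - y l‖ - r l| ≤ h} := by
  rw [Set.ofPred_exists]
  exact .iUnion fun l => measurableSet_le (by fun_prop) measurable_const

theorem rapidAnticoncentration_of_infinite_support (hμ : μ.support.Infinite) {s : Set ℂ}
    (hs : Bornology.IsBounded s) :
    RapidAnticoncentration (fun z w : ℂ => (z - w)⁻¹) (volume.restrict s) μ := by
  intro ε hε A
  obtain ⟨y, r, hr, ⟨p, hp, hsingle, hzero⟩, K, hK, hKle⟩ :=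
    exists_discVector_of_infinite_support hμ (2 * (A + 1))
  obtain ⟨ρ, hρ⟩ := exists_norm_sub_add_le hs y r
  obtain ⟨K', hK', hK'le⟩ := exists_lintegral_inv_nnnorm_sub_le volume
    (by simp [Complex.finrank_real_complex]) (hs.measure_lt_top (μ := (volume : Measure ℂ))).ne
  have ha : 0 < ε / 8 := by positivity
  set D := volume s
  set C := ENNReal.ofReal ((Real.pi / (2 * p ^ 2 / Real.pi ^ 2)) ^ (A + 1))
  have hKK : D * (2 * K + C) + ρ * K' ≠ ∞ := by
    have hD : D ≠ ∞ := hs.measure_lt_top.ne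
    finiteness
  filter_upwards [tendsto_natSqrt_atTop.eventually_gt_atTop 0,
    (tendsto_exp_neg_mul_natSqrt ha).eventually hKle,
    eventually_all.2 fun l => eventually_exp_mul_pow_mul_exp_le hε ρ.2 (hr l),
    tendsto_natSqrt_atTop.eventually (eventually_ofReal_exp_neg_le_inv_pow ha (A + 2)),
    eventually_mul_inv_sqrt_pow_succ_le hKK A] with n hm hannulus hη hsmall hfinal
  set m := n.sqrt
  set h := Real.exp (-(ε / 8 * m))
  have : Nonempty (Fin m) := ⟨⟨0, hm⟩⟩
  set ν := Measure.pi fun _ : Fin m => μ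
  have hsmall' : ENNReal.ofReal h ≤ (m : ℝ≥0∞)⁻¹ ^ (A + 1) := by
    refine hsmall.trans (pow_le_pow_right_of_le_one' (ENNReal.inv_le_one.2 ?_) (Nat.le_succ _))
    exact_mod_cast hm
  have hnear : (ν.prod ν) {q | ∃ j, q.1 j ∈ {w | ∃ l, |‖w - y l‖ - r l| ≤ h} ∨
      q.2 j ∈ {w | ∃ l, |‖w - y l‖ - r l| ≤ h}} ≤ (m : ℝ≥0∞)⁻¹ ^ (A + 1) * (2 * K) :=
    (prod_pi_exists_mem_le_inv_pow (measurableSet_near_circles y r h)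
      (hannulus.trans (by rw [Fintype.card_fin]; gcongr))).trans_eq (by rw [Fintype.card_fin])
  have hcollide := collision_probability_le_mul_inv_pow (κ := Fin m) hp hsingle hzero
    (Fintype.card_fin _)
  rw [Fintype.card_fin] at hcollide
  calc _ ≤ _ := lintegral_prod_pi_norm_sum_sub_le hK'le hr hρ (Real.exp_pos _)
        (by positivity : 0 ≤ ε / 8 * m) (fun l => by rw [Fintype.card_fin]; exact hη l)
    _ ≤ D * ((m : ℝ≥0∞)⁻¹ ^ (A + 1) * (2 * K) + C * (m : ℝ≥0∞)⁻¹ ^ (A + 1)) +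
          ρ * K' * (m : ℝ≥0∞)⁻¹ ^ (A + 1) := by
        gcongr
    _ = (m : ℝ≥0∞)⁻¹ ^ (A + 1) * (D * (2 * K + C) + ρ * K') := by ring
    _ ≤ _ := hfinal

end CauchyAnticoncentration

section AlmostSure

lemma summable_inv_natSqrt_pow_four : Summable fun n : ℕ => (n.sqrt : ℝ)⁻¹ ^ 4 := by
  refine .of_nonneg_of_le (fun n => by positivity) (fun n => ?_)
    ((Real.summable_nat_pow_inv.2 one_lt_two).mul_left 16)
  obtain rfl | hn := n.eq_zero_or_pos
  · simp
  have hm : 1 ≤ n.sqrt := Nat.sqrt_pos.2 hn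
  have hle : n ≤ 4 * n.sqrt ^ 2 := by nlinarith [Nat.lt_succ_sqrt n]
  have hle' : (n : ℝ) ≤ 4 * (n.sqrt : ℝ) ^ 2 := by exact_mod_cast hle
  rw [inv_pow, ← div_eq_mul_inv, le_div_iff₀ (by positivity), inv_mul_le_iff₀ (by positivity)]
  calc (n : ℝ) ^ 2 ≤ (4 * (n.sqrt : ℝ) ^ 2) ^ 2 := by gcongr
    _ = _ := by ring

lemma tsum_inv_natSqrt_pow_four_ne_top (N : ℕ) :
    ∑' n : ℕ, ((n + (N + 1)).sqrt : ℝ≥0∞)⁻¹ ^ 4 ≠ ∞ := by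
  have h := ((summable_nat_add_iff (N + 1)).2 summable_inv_natSqrt_pow_four).tsum_ofReal_ne_top
  convert h using 4 with n
  have hpos : (0 : ℝ) < (n + (N + 1)).sqrt := by exact_mod_cast Nat.sqrt_pos.2 (by lia)
  rw [ENNReal.ofReal_pow (by positivity), ENNReal.ofReal_inv_of_pos hpos, ENNReal.ofReal_natCast]

lemma ae_tendsto_zero_of_lintegral_le {Ω : Type*} [MeasurableSpace Ω] {P : Measure Ω}
    {f : ℕ → Ω → ℝ≥0∞} (hf : ∀ n, Measurable (f n))
    (h : ∀ᶠ n in atTop, ∫⁻ ω, f n ω ∂P ≤ (n.sqrt : ℝ≥0∞)⁻¹ ^ 4) :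
    ∀ᵐ ω ∂P, Tendsto (fun n => f n ω) atTop (𝓝 0) := by
  obtain ⟨N, hN⟩ := eventually_atTop.1 h
  have hfin : ∫⁻ ω, ∑' n, f (n + (N + 1)) ω ∂P ≠ ∞ := by
    rw [lintegral_tsum fun n => (hf _).aemeasurable]
    exact ne_top_of_le_ne_top (tsum_inv_natSqrt_pow_four_ne_top N)
      (ENNReal.tsum_le_tsum fun n => hN _ (by lia))
  filter_upwards [ae_lt_top (Measurable.tsum fun n => hf _) hfin] with ω hω
  exact (tendsto_add_atTop_iff_nat (N + 1)).1 (ENNReal.tendsto_atTop_zero_of_tsum_ne_top hω.ne)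

variable {T E 𝕜 : Type*} [MeasurableSpace T] [MeasurableSpace E] [NormedField 𝕜]
  [MeasurableSpace 𝕜] [BorelSpace 𝕜] [SecondCountableTopology 𝕜] {φ : T → E → 𝕜}
  {lam : Measure T} [IsFiniteMeasure lam] {μ : Measure E} [IsProbabilityMeasure μ]

lemma RapidAnticoncentration.eventually_lintegral_norm_coeff_esymmGen_le
    (hφ : Measurable (Function.uncurry φ)) (h : RapidAnticoncentration φ lam μ) (k : ℕ) {ε : ℝ}
    (hε : 0 < ε) (A : ℕ) : ∀ᶠ n : ℕ in atTop,
      ∫⁻ t, (Measure.pi fun _ : Fin n => μ)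
        {ζ | ‖(esymmGen Finset.univ (φ t ∘ ζ)).coeff k‖ ≤ Real.exp (-ε * n)} ∂lam ≤
          (n.sqrt : ℝ≥0∞)⁻¹ ^ A := by
  filter_upwards [h.eventually_lintegral_smallCoeff_le hφ k ε hε A,
    tendsto_natSqrt_atTop.eventually_ge_atTop k] with n hn hk
  have hle : n.sqrt * k ≤ n := (Nat.mul_le_mul_left _ hk).trans n.sqrt_le
  obtain ⟨N, hN⟩ := Nat.exists_eq_add_of_le' hle
  have hmain := lintegral_norm_coeff_esymmGen_le (N := N) hφ hn
  rwa [← hN] at hmain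

lemma RapidAnticoncentration.ae_tendsto_measure_norm_coeff_esymmGen_le
    (hφ : Measurable (Function.uncurry φ)) (h : RapidAnticoncentration φ lam μ) {Ω : Type*}
    [MeasurableSpace Ω] {P : Measure Ω} [IsProbabilityMeasure P] {Z : ℕ → Ω → E}
    (hmeas : ∀ j, Measurable (Z j)) (hlaw : ∀ j, P.map (Z j) = μ) (hindep : iIndepFun Z P) (k : ℕ)
    {ε : ℝ} (hε : 0 < ε) :
    ∀ᵐ ω ∂P, Tendsto (fun n : ℕ => lam {t | ‖(esymmGen Finset.univ
      fun j : Fin n => φ t (Z j ω)).coeff k‖ ≤ Real.exp (-ε * n)}) atTop (𝓝 0) := by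
  have hset (n : ℕ) : MeasurableSet {q : (Fin n → E) × T |
      ‖(esymmGen Finset.univ (φ q.2 ∘ q.1)).coeff k‖ ≤ Real.exp (-ε * n)} :=
    measurableSet_le (measurable_coeff_esymmGen _
      (measurable_comp_apply hφ measurable_snd measurable_fst) k).norm measurable_const
  have hsample (n : ℕ) : Measurable fun ω (j : Fin n) => Z j ω :=
    measurable_pi_lambda _ fun j => hmeas j
  have hpi (n : ℕ) : P.map (fun ω (j : Fin n) => Z j ω) = Measure.pi fun _ : Fin n => μ := by
    have hprecomp : iIndepFun (fun j : Fin n => Z j) P := hindep.precomp Fin.val_injective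
    rw [hprecomp.map_fun_eq_pi_map fun j : Fin n => (hmeas j).aemeasurable]
    simp_rw [hlaw]
  refine ae_tendsto_zero_of_lintegral_le
    (fun n => (measurable_measure_prodMk_left (hset n)).comp (hsample n)) ?_
  filter_upwards [h.eventually_lintegral_norm_coeff_esymmGen_le hφ k hε 4] with n hn
  refine le_trans (le_of_eq ?_) hn
  calc _ = ∫⁻ ζ, lam {t | ‖(esymmGen Finset.univ (φ t ∘ ζ)).coeff k‖ ≤ Real.exp (-ε * n)}
        ∂P.map fun ω (j : Fin n) => Z j ω :=
        (lintegral_map (measurable_measure_prodMk_left (hset n)) (hsample n)).symm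
    _ = _ := by
        rw [hpi n]
        exact (Measure.prod_apply (hset n)).symm.trans (Measure.prod_apply_symm (hset n))

lemma measure_norm_eval_iterate_derivative_rootPoly_le {lam : Measure ℂ} [NullSingletonClass lam]
    (s : Set ℂ) (z : ℕ → ℂ) (n k : ℕ) (η : ℝ) :
    lam {w ∈ s | ‖(derivative^[k] (rootPoly z n)).eval w‖ ≤ η * ‖(rootPoly z n).eval w‖} ≤
      lam.restrict s {w | ‖(esymmGen Finset.univ fun j : Fin n => (w - z j)⁻¹).coeff k‖ ≤ η} := by
  have hset : MeasurableSet
      {w | ‖(esymmGen Finset.univ fun j : Fin n => (w - z j)⁻¹).coeff k‖ ≤ η} :=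
    measurableSet_le (measurable_coeff_esymmGen _ (fun j => by fun_prop) k).norm measurable_const
  rw [Measure.restrict_apply hset]
  have hroots : lam (z '' Finset.range n) = 0 :=
    ((Finset.range n).finite_toSet.image z).measure_zero lam
  refine (measure_mono ?_).trans ((measure_union_le _ _).trans_eq
    ((congrArg _ hroots).trans (add_zero _)))
  rintro w ⟨hw, hle⟩
  refine or_iff_not_imp_right.2 fun hroot => ⟨?_, hw⟩
  have hne : ∀ j ∈ Finset.range n, w - z j ≠ 0 := fun j hj h0 =>
    hroot ⟨j, hj, (sub_eq_zero.1 h0).symm⟩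
  rw [rootPoly, eval_iterate_derivative_prod _ _ hne, eval_prod] at hle
  simp only [eval_sub, eval_X, eval_C, norm_mul, Complex.norm_natCast] at hle
  have hcoeff := le_of_mul_le_mul_right hle (norm_pos_iff.2 (Finset.prod_ne_zero_iff.2 hne))
  rw [esymmGen, Finset.prod_range] at hcoeff
  have hfact : (1 : ℝ) ≤ k.factorial := by exact_mod_cast k.factorial_pos
  exact (le_mul_of_one_le_left (norm_nonneg _) hfact).trans hcoeff

lemma ae_tendsto_volume_norm_eval_iterate_derivative_le {Ω : Type*} [MeasurableSpace Ω]
    {P : Measure Ω} [IsProbabilityMeasure P] {μ : Measure ℂ} [IsProbabilityMeasure μ]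
    (hμ : μ.support.Infinite) {Z : ℕ → Ω → ℂ} (hmeas : ∀ j, Measurable (Z j))
    (hlaw : ∀ j, P.map (Z j) = μ) (hindep : iIndepFun Z P) (k : ℕ) {s : Set ℂ}
    (hs : Bornology.IsBounded s) {ε : ℝ} (hε : 0 < ε) :
    ∀ᵐ ω ∂P, Tendsto (fun n : ℕ => volume {w ∈ s |
      ‖(derivative^[k] (rootPoly (fun j => Z j ω) n)).eval w‖ ≤
        Real.exp (-ε * n) * ‖(rootPoly (fun j => Z j ω) n).eval w‖}) atTop (𝓝 0) := by
  have : IsFiniteMeasure (volume.restrict s) := isFiniteMeasure_restrict.2 hs.measure_lt_top.ne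
  have hφ : Measurable (Function.uncurry fun z w : ℂ => (z - w)⁻¹) := by fun_prop
  filter_upwards [(rapidAnticoncentration_of_infinite_support hμ
    hs).ae_tendsto_measure_norm_coeff_esymmGen_le hφ hmeas hlaw hindep k hε] with ω hω
  exact tendsto_of_tendsto_of_tendsto_of_le_of_le tendsto_const_nhds hω (fun _ => zero_le)
    fun n => measure_norm_eval_iterate_derivative_rootPoly_le s _ n k _

end AlmostSure

section LogRatio

/-- The absolute value of `log (‖q‖ / ‖p‖)` at `z`, where the logarithm of `0` counts as `0`. -/
def absLogRatio (p q : ℂ[X]) (z : ℂ) : ℝ := |Real.log ‖q.eval z‖ - Real.log ‖p.eval z‖|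

lemma measurable_absLogRatio (p q : ℂ[X]) : Measurable (absLogRatio p q) := by
  have hp := p.continuous.measurable
  have hq := q.continuous.measurable
  unfold absLogRatio
  fun_prop

lemma norm_eval_le_exp_mul_of_lt_absLogRatio {p q : ℂ[X]} {z : ℂ} {t : ℝ}
    (h : t < absLogRatio p q z) :
    ‖q.eval z‖ ≤ Real.exp (-t) * ‖p.eval z‖ ∨ ‖p.eval z‖ ≤ Real.exp (-t) * ‖q.eval z‖ := by
  rcases eq_or_ne (q.eval z) 0 with hq | hq
  · exact Or.inl (by rw [hq, norm_zero]; positivity)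
  rcases eq_or_ne (p.eval z) 0 with hp | hp
  · exact Or.inr (by rw [hp, norm_zero]; positivity)
  have key : ∀ {x y : ℝ}, 0 < x → 0 < y → Real.log x - Real.log y < -t →
      x ≤ Real.exp (-t) * y := fun {x y} hx hy hxy => by
    rw [← Real.exp_log hx, ← Real.exp_log hy, ← Real.exp_add]
    exact Real.exp_le_exp.2 (by linarith)
  rcases lt_abs.1 h with h | h
  · exact Or.inr (key (norm_pos_iff.2 hp) (norm_pos_iff.2 hq) (by linarith))
  · exact Or.inl (key (norm_pos_iff.2 hq) (norm_pos_iff.2 hp) (by linarith))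

lemma tendsto_measure_lt_absLogRatio {lam : Measure ℂ} {p q : ℕ → ℂ[X]} {ε : ℝ}
    (hqp : Tendsto (fun n : ℕ => lam {z | ‖(q n).eval z‖ ≤ Real.exp (-ε * n) * ‖(p n).eval z‖})
      atTop (𝓝 0))
    (hpq : Tendsto (fun n : ℕ => lam {z | ‖(p n).eval z‖ ≤ Real.exp (-ε * n) * ‖(q n).eval z‖})
      atTop (𝓝 0)) :
    Tendsto (fun n : ℕ => lam {z | ε * n < absLogRatio (p n) (q n) z}) atTop (𝓝 0) := by
  refine tendsto_of_tendsto_of_tendsto_of_le_of_le tendsto_const_nhds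
    (by simpa only [add_zero] using hqp.add hpq) (fun _ => zero_le) fun n => ?_
  refine (measure_mono fun z hz => ?_).trans (measure_union_le _ _)
  simp_rw [neg_mul]
  exact norm_eval_le_exp_mul_of_lt_absLogRatio hz

lemma log_norm_eval_sub_le {p : ℂ[X]} {z z' : ℂ} {ρ a : ℝ} (hρ : ‖z - z'‖ ≤ ρ) (ha : 0 ≤ a)
    (hz : p.eval z ≠ 0) (hz' : p.eval z' ≠ 0) :
    Real.log ‖p.eval z‖ - Real.log ‖p.eval z'‖ ≤
      p.natDegree * a + Real.exp (-a) * (ρ * poleSum p.roots z') := by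
  have h := Real.log_le_log (norm_pos_iff.2 hz) (norm_eval_le_exp_mul hρ ha hz')
  rw [Real.log_mul (Real.exp_pos _).ne' (norm_ne_zero_iff.2 hz'), Real.log_exp] at h
  exact sub_le_iff_le_add.2 h

/-- The poles at the reference point `z'` enter with the full weight `ρ`, those at `z` with the
small weight `ρ e⁻ᵃ`, at the price of the term `n a`. -/
lemma absLogRatio_le {p q : ℂ[X]} {n : ℕ} (hpn : p.natDegree ≤ n) (hqn : q.natDegree ≤ n)
    {z z' : ℂ} {ρ a : ℝ} (hρ : ‖z - z'‖ ≤ ρ) (ha : 0 ≤ a) (hpz : p.eval z ≠ 0)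
    (hqz : q.eval z ≠ 0) (hpz' : p.eval z' ≠ 0) (hqz' : q.eval z' ≠ 0) :
    absLogRatio p q z ≤ absLogRatio p q z' + n * a + ρ * poleSum (p.roots + q.roots) z' +
      Real.exp (-a) * (ρ * poleSum (p.roots + q.roots) z) := by
  have hρ' : ‖z' - z‖ ≤ ρ := by rwa [norm_sub_rev]
  have hρ0 : 0 ≤ ρ := (norm_nonneg _).trans hρ
  have upper : ∀ {f : ℂ[X]}, f.eval z ≠ 0 → f.eval z' ≠ 0 →
      Real.log ‖f.eval z‖ - Real.log ‖f.eval z'‖ ≤ ρ * poleSum f.roots z' := fun hz hz' => by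
    simpa using log_norm_eval_sub_le hρ le_rfl hz hz'
  have lower : ∀ {f : ℂ[X]}, f.natDegree ≤ n → f.eval z ≠ 0 → f.eval z' ≠ 0 →
      Real.log ‖f.eval z'‖ - Real.log ‖f.eval z‖ ≤
        n * a + Real.exp (-a) * (ρ * poleSum f.roots z) := fun hf hz hz' =>
    (log_norm_eval_sub_le hρ' ha hz' hz).trans (by gcongr)
  have nonneg : ∀ (s : Multiset ℂ) y, 0 ≤ ρ * poleSum s y ∧ 0 ≤ Real.exp (-a) * (ρ * poleSum s y) :=
    fun s y => ⟨by positivity, by positivity⟩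
  have habs := abs_le.1 (le_refl (absLogRatio p q z'))
  simp only [poleSum_add, NNReal.coe_add, mul_add]
  refine abs_le.2 ⟨?_, ?_⟩
  · linarith [upper hpz hpz', lower hqn hqz hqz', nonneg q.roots z', nonneg p.roots z, habs.1]
  · linarith [upper hqz hqz', lower hpn hpz hpz', nonneg p.roots z', nonneg q.roots z, habs.2]

lemma ofReal_absLogRatio_le {p q : ℂ[X]} {n : ℕ} (hpn : p.natDegree ≤ n) (hqn : q.natDegree ≤ n)
    {z z' : ℂ} {ρ ε a : ℝ} (hρ : ‖z - z'‖ ≤ ρ) (hε : 0 ≤ ε) (ha : 0 ≤ a) (hpz : p.eval z ≠ 0)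
    (hqz : q.eval z ≠ 0) (hpz' : p.eval z' ≠ 0) (hqz' : q.eval z' ≠ 0)
    (hz' : absLogRatio p q z' ≤ ε * n) {c : ℝ≥0∞}
    (hc : (poleSum (p.roots + q.roots) z' : ℝ≥0∞) ≤ n * c) :
    ENNReal.ofReal (absLogRatio p q z) ≤
      n * ENNReal.ofReal ε + n * (ENNReal.ofReal a + ENNReal.ofReal ρ * c) +
        ENNReal.ofReal (Real.exp (-a)) * (ENNReal.ofReal ρ * poleSum (p.roots + q.roots) z) := by
  have hρ0 : 0 ≤ ρ := (norm_nonneg _).trans hρ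
  set S := poleSum (p.roots + q.roots)
  have h : absLogRatio p q z ≤ ε * n + n * a + ρ * S z' + Real.exp (-a) * (ρ * S z) :=
    (absLogRatio_le hpn hqn hρ ha hpz hqz hpz' hqz').trans (by gcongr)
  refine (ENNReal.ofReal_le_ofReal h).trans ?_
  rw [ENNReal.ofReal_add (by positivity) (by positivity),
    ENNReal.ofReal_add (by positivity) (by positivity),
    ENNReal.ofReal_add (by positivity) (by positivity), ENNReal.ofReal_mul hε,
    ENNReal.ofReal_mul n.cast_nonneg, ENNReal.ofReal_natCast, ENNReal.ofReal_mul hρ0,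
    ENNReal.ofReal_mul (Real.exp_pos _).le, ENNReal.ofReal_mul hρ0, ENNReal.ofReal_coe_nnreal,
    ENNReal.ofReal_coe_nnreal, mul_comm (ENNReal.ofReal ε), mul_add, mul_left_comm (n : ℝ≥0∞),
    ← add_assoc]
  gcongr

lemma lintegral_poleSum_roots_add_le {lam : Measure ℂ} {K : ℝ≥0∞}
    (hK : ∀ w, ∫⁻ z, ↑‖z - w‖₊⁻¹ ∂lam ≤ K) {p q : ℂ[X]} {n : ℕ} (hpn : p.natDegree ≤ n)
    (hqn : q.natDegree ≤ n) : ∫⁻ z, poleSum (p.roots + q.roots) z ∂lam ≤ n * (2 * K) := by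
  calc _ ≤ ((p.roots + q.roots).card : ℝ≥0∞) * K := lintegral_poleSum_le hK _
    _ ≤ ((n + n : ℕ) : ℝ≥0∞) * K := by
      rw [Multiset.card_add]
      gcongr
      exacts [(card_roots' p).trans hpn, (card_roots' q).trans hqn]
    _ = _ := by push_cast; ring

lemma exists_notMem_le_two_mul_lintegral_div {α : Type*} [MeasurableSpace α] {lam : Measure α}
    [IsFiniteMeasure lam] (hlam : lam ≠ 0) {f : α → ℝ≥0∞} (hf : Measurable f) {B N : Set α}
    (hBm : MeasurableSet B) (hB : lam B ≤ lam Set.univ / 2) (hN : lam N = 0) :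
    ∃ x, x ∉ B ∧ x ∉ N ∧ f x ≤ 2 * (∫⁻ y, f y ∂lam) / lam Set.univ := by
  have hhalf : lam Set.univ / 2 ≤ lam Bᶜ := by
    rw [measure_compl hBm (measure_ne_top _ _)]
    refine ENNReal.le_sub_of_add_le_left (measure_ne_top _ _) ?_
    exact (add_le_add_left hB _).trans (ENNReal.add_halves _).le
  have huniv : lam Set.univ ≠ 0 := Measure.measure_univ_ne_zero.2 hlam
  have hpos : lam Bᶜ ≠ 0 :=
    ((ENNReal.half_pos huniv).trans_le hhalf).ne'
  obtain ⟨x, hx, hfx⟩ := exists_notMem_null_le_laverage (μ := lam.restrict Bᶜ) (N := B ∪ N)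
    (by rwa [Ne, Measure.restrict_eq_zero]) hf.aemeasurable
    (measure_union_null (by simp [Measure.restrict_apply hBm])
      (Measure.absolutelyContinuous_of_le Measure.restrict_le_self hN))
  refine ⟨x, fun h => hx (Or.inl h), fun h => hx (Or.inr h), hfx.trans ?_⟩
  rw [setLAverage_eq]
  calc _ ≤ (∫⁻ y, f y ∂lam) / (lam Set.univ / 2) :=
        ENNReal.div_le_div (setLIntegral_le_lintegral _ _) hhalf
    _ = _ := by
      rw [div_eq_mul_inv, div_eq_mul_inv (lam Set.univ), ENNReal.mul_inv (Or.inr (by simp))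
        (Or.inr (by simp)), inv_inv, div_eq_mul_inv]
      ring

variable {lam : Measure ℂ} [IsFiniteMeasure lam] [NullSingletonClass lam] {s : Set ℂ} {ρ : ℝ}
  {K : ℝ≥0∞}

/-- Half of the mass leaves room for a reference point at which both polynomials are nonzero, their
quotient is moderate and their poles are far. -/
lemma exists_absLogRatio_le (hlam : lam ≠ 0) (hs : ∀ᵐ z ∂lam, z ∈ s)
    (hK : ∀ w, ∫⁻ z, ↑‖z - w‖₊⁻¹ ∂lam ≤ K) {p q : ℂ[X]} {n : ℕ} (hp : p ≠ 0) (hq : q ≠ 0)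
    (hpn : p.natDegree ≤ n) (hqn : q.natDegree ≤ n) {t : ℝ}
    (hB : lam {z | t < absLogRatio p q z} ≤ lam Set.univ / 2) :
    ∃ z ∈ s, p.eval z ≠ 0 ∧ q.eval z ≠ 0 ∧ absLogRatio p q z ≤ t ∧
      (poleSum (p.roots + q.roots) z : ℝ≥0∞) ≤ n * (4 * K / lam Set.univ) := by
  have hroots : lam ({z | p.eval z = 0} ∪ {z | q.eval z = 0}) = 0 :=
    ((finite_setOf_eval_eq_zero hp).union (finite_setOf_eval_eq_zero hq)).measure_zero _
  obtain ⟨z, hzB, hzN, hz⟩ := exists_notMem_le_two_mul_lintegral_div hlam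
    (measurable_poleSum (p.roots + q.roots)).coe_nnreal_ennreal
    (measurableSet_lt measurable_const (measurable_absLogRatio p q)) hB
    (measure_union_null hroots hs)
  simp only [Set.mem_union, Set.mem_ofPred_eq, not_or, not_lt] at hzB hzN
  refine ⟨z, not_not.1 hzN.2, hzN.1.1, hzN.1.2, hzB, hz.trans ?_⟩
  rw [← mul_div_assoc]
  refine ENNReal.div_le_div_right ?_ _
  calc 2 * ∫⁻ y, poleSum (p.roots + q.roots) y ∂lam
      ≤ 2 * (n * (2 * K)) := by gcongr; exact lintegral_poleSum_roots_add_le hK hpn hqn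
    _ = n * (4 * K) := by ring

lemma lintegral_absLogRatio_le (hlam : lam ≠ 0) (hs : ∀ᵐ z ∂lam, z ∈ s)
    (hρ : ∀ z ∈ s, ∀ z' ∈ s, ‖z - z'‖ ≤ ρ) (hK : ∀ w, ∫⁻ z, ↑‖z - w‖₊⁻¹ ∂lam ≤ K) {p q : ℂ[X]}
    {n : ℕ} (hp : p ≠ 0) (hq : q ≠ 0) (hpn : p.natDegree ≤ n) (hqn : q.natDegree ≤ n) {ε a : ℝ}
    (hε : 0 ≤ ε) (ha : 0 ≤ a)
    (hB : lam {z | ε * n < absLogRatio p q z} ≤ lam Set.univ / 2) :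
    ∫⁻ z, ENNReal.ofReal (absLogRatio p q z) ∂lam ≤
      n * (ENNReal.ofReal ε * lam Set.univ +
        (ENNReal.ofReal a + ENNReal.ofReal ρ * (4 * K / lam Set.univ)) *
          lam {z | ε * n < absLogRatio p q z} +
        ENNReal.ofReal (Real.exp (-a)) * (ENNReal.ofReal ρ * (2 * K))) := by
  set S := poleSum (p.roots + q.roots)
  set B := {z | ε * n < absLogRatio p q z}
  set c : ℝ≥0∞ := ENNReal.ofReal a + ENNReal.ofReal ρ * (4 * K / lam Set.univ)
  have hBm : MeasurableSet B := measurableSet_lt measurable_const (measurable_absLogRatio p q)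
  have hSm : Measurable fun z => (S z : ℝ≥0∞) := (measurable_poleSum _).coe_nnreal_ennreal
  have hεn : ENNReal.ofReal (ε * n) = n * ENNReal.ofReal ε := by
    rw [ENNReal.ofReal_mul hε, ENNReal.ofReal_natCast, mul_comm]
  obtain ⟨z', hz's, hpz', hqz', hz't, hz'S⟩ := exists_absLogRatio_le hlam hs hK hp hq hpn hqn hB
  have hpt : ∀ᵐ z ∂lam, ENNReal.ofReal (absLogRatio p q z) ≤
      n * ENNReal.ofReal ε + B.indicator (fun _ => n * c) z +
        ENNReal.ofReal (Real.exp (-a)) * (ENNReal.ofReal ρ * S z) := by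
    filter_upwards [hs, (finite_setOf_eval_eq_zero hp).countable.ae_notMem lam,
      (finite_setOf_eval_eq_zero hq).countable.ae_notMem lam] with z hzs hpz hqz
    by_cases hzB : z ∈ B
    · rw [Set.indicator_of_mem hzB]
      exact ofReal_absLogRatio_le hpn hqn (hρ z hzs z' hz's) hε ha hpz hqz hpz' hqz' hz't hz'S
    · refine le_add_right (le_add_right ?_)
      rw [← hεn]
      exact ENNReal.ofReal_le_ofReal (not_lt.1 hzB)
  calc ∫⁻ z, ENNReal.ofReal (absLogRatio p q z) ∂lam
      ≤ ∫⁻ z, (n * ENNReal.ofReal ε + B.indicator (fun _ => n * c) z +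
          ENNReal.ofReal (Real.exp (-a)) * (ENNReal.ofReal ρ * S z)) ∂lam := lintegral_mono_ae hpt
    _ = n * ENNReal.ofReal ε * lam Set.univ + n * c * lam B +
        ENNReal.ofReal (Real.exp (-a)) * (ENNReal.ofReal ρ * ∫⁻ z, S z ∂lam) := by
      rw [lintegral_add_right _ (by fun_prop), lintegral_add_left measurable_const,
        lintegral_const, lintegral_indicator_const hBm, lintegral_const_mul _ (by fun_prop),
        lintegral_const_mul _ hSm]
    _ ≤ n * ENNReal.ofReal ε * lam Set.univ + n * c * lam B +
        ENNReal.ofReal (Real.exp (-a)) * (ENNReal.ofReal ρ * (n * (2 * K))) := by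
      gcongr
      exact lintegral_poleSum_roots_add_le hK hpn hqn
    _ = _ := by ring

lemma tendsto_lintegral_absLogRatio (hlam : lam ≠ 0) (hs : ∀ᵐ z ∂lam, z ∈ s)
    (hρ : ∀ z ∈ s, ∀ z' ∈ s, ‖z - z'‖ ≤ ρ) (hKtop : K ≠ ∞)
    (hK : ∀ w, ∫⁻ z, ↑‖z - w‖₊⁻¹ ∂lam ≤ K) {p q : ℕ → ℂ[X]} (hp : ∀ᶠ n in atTop, p n ≠ 0)
    (hq : ∀ᶠ n in atTop, q n ≠ 0) (hpn : ∀ n, (p n).natDegree ≤ n)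
    (hqn : ∀ n, (q n).natDegree ≤ n)
    (hB : ∀ ε > 0, Tendsto (fun n : ℕ => lam {z | ε * n < absLogRatio (p n) (q n) z})
      atTop (𝓝 0)) :
    Tendsto (fun n : ℕ => (n : ℝ≥0∞)⁻¹ * ∫⁻ z, ENNReal.ofReal (absLogRatio (p n) (q n) z) ∂lam)
      atTop (𝓝 0) := by
  have huniv : lam Set.univ ≠ 0 := Measure.measure_univ_ne_zero.2 hlam
  refine ENNReal.tendsto_nhds_zero.2 fun τ hτ => ?_
  have hτ3 : 0 < τ / 3 := ENNReal.div_pos hτ.ne' ENNReal.ofNat_ne_top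
  have hε_lim : Tendsto (fun ε : ℝ => ENNReal.ofReal ε * lam Set.univ) (𝓝[>] 0) (𝓝 0) := by
    have h := ENNReal.Tendsto.mul_const (b := lam Set.univ)
      (ENNReal.tendsto_ofReal (tendsto_id (x := 𝓝 (0 : ℝ)))) (Or.inr (measure_ne_top _ _))
    rw [ENNReal.ofReal_zero, zero_mul] at h
    exact h.mono_left nhdsWithin_le_nhds
  have ha_lim : Tendsto (fun a : ℝ => ENNReal.ofReal (Real.exp (-a)) *
      (ENNReal.ofReal ρ * (2 * K))) atTop (𝓝 0) := by
    simpa using ENNReal.Tendsto.mul_const (b := ENNReal.ofReal ρ * (2 * K))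
      (ENNReal.tendsto_ofReal Real.tendsto_exp_neg_atTop_nhds_zero) (Or.inr (by finiteness))
  obtain ⟨ε, hε1, hε⟩ :=
    ((ENNReal.tendsto_nhds_zero.1 hε_lim _ hτ3).and self_mem_nhdsWithin).exists
  obtain ⟨a, ha1, ha⟩ :=
    ((ENNReal.tendsto_nhds_zero.1 ha_lim _ hτ3).and (eventually_ge_atTop 0)).exists
  have hB_lim := ENNReal.Tendsto.const_mul
    (a := ENNReal.ofReal a + ENNReal.ofReal ρ * (4 * K / lam Set.univ)) (hB ε hε)
    (Or.inr (ENNReal.add_ne_top.2 ⟨ENNReal.ofReal_ne_top, ENNReal.mul_ne_top ENNReal.ofReal_ne_top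
      (ENNReal.div_ne_top (by finiteness) huniv)⟩))
  rw [mul_zero] at hB_lim
  filter_upwards [hp, hq, eventually_ne_atTop 0, ENNReal.tendsto_nhds_zero.1 hB_lim _ hτ3,
    ENNReal.tendsto_nhds_zero.1 (hB ε hε) _ (ENNReal.half_pos huniv)]
    with n hpn0 hqn0 hn hn1 hn2
  have hn0 : (n : ℝ≥0∞) ≠ 0 := Nat.cast_ne_zero.2 hn
  rw [← ENNReal.div_eq_inv_mul,
    ENNReal.div_le_iff_le_mul (Or.inl hn0) (Or.inl (ENNReal.natCast_ne_top n))]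
  refine (lintegral_absLogRatio_le hlam hs hρ hK hpn0 hqn0 (hpn n) (hqn n) (le_of_lt hε) ha
    hn2).trans ?_
  rw [mul_comm τ]
  gcongr
  exact (add_le_add (add_le_add hε1 hn1) ha1).trans (ENNReal.add_thirds τ).le

end LogRatio

section CircleAverage

lemma enorm_circleAverage_le {E : Type*} [NormedAddCommGroup E] [NormedSpace ℝ E] (f : ℂ → E)
    (c : ℂ) (r : ℝ) :
    ‖Real.circleAverage f c r‖ₑ ≤
      ∫⁻ θ in Set.Ioo (-Real.pi) Real.pi, ‖f (circleMap c r θ)‖ₑ := by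
  have h : Real.circleAverage f c r =
      (2 * Real.pi)⁻¹ • ∫ θ in Set.Ioo (-Real.pi) Real.pi, f (circleMap c r θ) := by
    rw [Real.circleAverage_eq_integral_add (-Real.pi),
      intervalIntegral.integral_comp_add_right (fun θ => f (circleMap c r θ)),
      intervalIntegral.integral_of_le (by linarith [Real.pi_pos]), integral_Ioc_eq_integral_Ioo]
    ring_nf
  rw [h, enorm_smul]
  refine (mul_le_of_le_one_left zero_le ?_).trans (enorm_integral_le_lintegral_enorm _)
  rw [Real.enorm_of_nonneg (by positivity), ENNReal.ofReal_le_one]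
  exact inv_le_one_of_one_le₀ (by linarith [Real.pi_gt_three])

lemma apply_circleMap_le_polarCoord (f : ℂ → ℝ≥0∞) {ρ R r : ℝ} (hρ : 0 < ρ)
    (hr : r ∈ Set.Ioo ρ R) (c : ℂ) (θ : ℝ) :
    f (circleMap c r θ) ≤ ENNReal.ofReal ρ⁻¹ * (ENNReal.ofReal r *
      (Metric.ball c R).indicator f (Complex.polarCoord.symm (r, θ) + c)) := by
  have hr0 : 0 < r := hρ.trans hr.1
  have hcircle : Complex.polarCoord.symm (r, θ) + c = circleMap c r θ := by
    rw [Complex.polarCoord_symm_apply, circleMap, Complex.exp_mul_I]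
    push_cast
    ring
  have hball : circleMap c r θ ∈ Metric.ball c R := by
    simpa [circleMap, abs_of_pos hr0] using hr.2
  rw [hcircle, Set.indicator_of_mem hball, ← mul_assoc, ← ENNReal.ofReal_mul (by positivity),
    ← div_eq_inv_mul]
  exact le_mul_of_one_le_left zero_le (ENNReal.one_le_ofReal.2 ((one_le_div hρ).2 hr.1.le))

lemma lintegral_lintegral_circleMap_le {f : ℂ → ℝ≥0∞} (hf : Measurable f) {ρ : ℝ} (hρ : 0 < ρ)
    (R : ℝ) (c : ℂ) :
    ∫⁻ r in Set.Ioo ρ R, ∫⁻ θ in Set.Ioo (-Real.pi) Real.pi, f (circleMap c r θ) ≤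
      ENNReal.ofReal ρ⁻¹ * ∫⁻ z in Metric.ball c R, f z := by
  set g : ℂ → ℝ≥0∞ := fun z => (Metric.ball c R).indicator f (z + c)
  have hg : Measurable g := (hf.indicator Metric.isOpen_ball.measurableSet).comp (by fun_prop)
  have hpolar : Measurable fun y : ℝ × ℝ => Complex.polarCoord.symm y := by
    simp only [Complex.polarCoord_symm_apply]
    fun_prop
  have hgm : Measurable fun y : ℝ × ℝ => ENNReal.ofReal y.1 * g (Complex.polarCoord.symm y) :=
    measurable_fst.ennreal_ofReal.mul (hg.comp hpolar)
  calc _ ≤ ∫⁻ r in Set.Ioo ρ R, ∫⁻ θ in Set.Ioo (-Real.pi) Real.pi,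
        ENNReal.ofReal ρ⁻¹ * (ENNReal.ofReal r * g (Complex.polarCoord.symm (r, θ))) :=
      setLIntegral_mono' measurableSet_Ioo fun r hr => lintegral_mono fun θ =>
        apply_circleMap_le_polarCoord f hρ hr c θ
    _ ≤ ∫⁻ r in Set.Ioi 0, ∫⁻ θ in Set.Ioo (-Real.pi) Real.pi,
        ENNReal.ofReal ρ⁻¹ * (ENNReal.ofReal r * g (Complex.polarCoord.symm (r, θ))) :=
      lintegral_mono_set fun r hr => hρ.trans hr.1
    _ = ENNReal.ofReal ρ⁻¹ * ∫⁻ z, g z := by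
      rw [← Complex.lintegral_comp_polarCoord_symm, polarCoord_target, Measure.volume_eq_prod,
        ← Measure.prod_restrict, lintegral_prod _ (by simpa using hgm.aemeasurable),
        ← lintegral_const_mul _ (by simpa using hgm.lintegral_prod_right')]
      refine lintegral_congr fun r => ?_
      simp only [smul_eq_mul]
      exact lintegral_const_mul _ (hgm.comp measurable_prodMk_left)
    _ = _ := by
      rw [lintegral_add_right_eq_self ((Metric.ball c R).indicator f) c,
        lintegral_indicator Metric.isOpen_ball.measurableSet]

lemma lintegral_enorm_circleAverage_le {V : ℂ → ℝ} (hV : Measurable V) {ρ : ℝ} (hρ : 0 < ρ)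
    (R : ℝ) (c : ℂ) :
    ∫⁻ r in Set.Ioo ρ R, ‖Real.circleAverage V c r‖ₑ ≤
      ENNReal.ofReal ρ⁻¹ * ∫⁻ z in Metric.ball c R, ‖V z‖ₑ :=
  (lintegral_mono fun r => enorm_circleAverage_le V c r).trans
    (lintegral_lintegral_circleMap_le hV.enorm hρ R c)

end CircleAverage

section AnnulusProfile

/-- For `r ≥ ρ`, the average of `log ‖·‖` over the circle of radius `r` around a point at distance
`x` from `0`. The truncation at `ρ` makes it continuous in `r` and `x`. -/
def logMax (ρ r x : ℝ) : ℝ := Real.log (max ρ (max r x))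

/-- The potential of a point at distance `x`, averaged over the circles with radii in `[2ρ, 3ρ]`,
minus its average over those with radii in `[ρ, 2ρ]`, both multiplied by `ρ`. It is a bump function
of `x ≥ 0` that vanishes for `x ≥ 3ρ`. -/
def annulusProfile (ρ x : ℝ) : ℝ := ∫ r in ρ..2 * ρ, (logMax ρ (r + ρ) x - logMax ρ r x)

variable {ρ : ℝ}

lemma continuous_logMax (hρ : 0 < ρ) : Continuous fun y : ℝ × ℝ => logMax ρ y.1 y.2 :=
  Continuous.log (by fun_prop) fun _ => (hρ.trans_le (le_max_left _ _)).ne'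

lemma continuous_logMax_left (hρ : 0 < ρ) (x : ℝ) : Continuous fun r => logMax ρ r x :=
  (continuous_logMax hρ).comp (by fun_prop : Continuous fun r : ℝ => (r, x))

lemma continuous_logMax_shift_sub (hρ : 0 < ρ) (x : ℝ) :
    Continuous fun r => logMax ρ (r + ρ) x - logMax ρ r x :=
  ((continuous_logMax_left hρ x).comp (continuous_add_const ρ)).sub (continuous_logMax_left hρ x)

lemma circleAverage_log_norm_sub_eq_logMax {r : ℝ} (hρ : 0 < ρ) (hr : ρ ≤ r) (c w : ℂ) :
    Real.circleAverage (fun z => Real.log ‖z - w‖) c r = logMax ρ r ‖w - c‖ := by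
  have hr0 : 0 < r := hρ.trans_le hr
  rw [circleAverage_log_norm_sub_const_eq_log_radius_add_posLog hr0.ne', logMax,
    max_eq_right (hr.trans (le_max_left _ _)), norm_sub_rev w c]
  rcases le_total ‖c - w‖ r with h | h
  · rw [max_eq_left h, add_eq_left, Real.posLog_eq_zero_iff, abs_of_nonneg (by positivity)]
    exact inv_mul_le_one_of_le₀ h hr0.le
  · have h0 : 0 < ‖c - w‖ := hr0.trans_le h
    rw [max_eq_right h, Real.posLog_eq_log, Real.log_mul (by positivity) h0.ne', Real.log_inv]
    · ring
    · rw [abs_of_nonneg (by positivity), ← div_eq_inv_mul]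
      exact (one_le_div hr0).2 h

lemma continuous_annulusProfile (hρ : 0 < ρ) : Continuous (annulusProfile ρ) := by
  refine intervalIntegral.continuous_parametric_intervalIntegral_of_continuous' ?_ _ _
  exact ((continuous_logMax hρ).comp (by fun_prop : Continuous fun y : ℝ × ℝ => (y.2 + ρ, y.1))).sub
    ((continuous_logMax hρ).comp (by fun_prop : Continuous fun y : ℝ × ℝ => (y.2, y.1)))

lemma annulusProfile_nonneg (hρ : 0 < ρ) (x : ℝ) : 0 ≤ annulusProfile ρ x := by
  refine intervalIntegral.integral_nonneg (by linarith) fun r _ => sub_nonneg.2 ?_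
  refine Real.log_le_log (hρ.trans_le (le_max_left _ _)) ?_
  gcongr
  linarith

lemma annulusProfile_eq_zero {x : ℝ} (hρ : 0 < ρ) (hx : 3 * ρ ≤ x) : annulusProfile ρ x = 0 := by
  rw [annulusProfile, ← intervalIntegral.integral_zero (a := ρ) (b := 2 * ρ)]
  refine intervalIntegral.integral_congr fun r hr => ?_
  rw [Set.uIcc_of_le (by linarith)] at hr
  simp only [logMax]
  rw [max_eq_right (a := r + ρ) (by linarith [hr.2]), max_eq_right (a := r) (by linarith [hr.2]),
    sub_self]

lemma annulusProfile_zero_pos (hρ : 0 < ρ) : 0 < annulusProfile ρ 0 := by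
  refine intervalIntegral.intervalIntegral_pos_of_pos_on ?_ (fun r hr => sub_pos.2 ?_)
    (by linarith)
  · exact (continuous_logMax_shift_sub hρ 0).intervalIntegrable _ _
  · refine Real.log_lt_log (hρ.trans_le (le_max_left _ _)) ?_
    have hr1 := hr.1
    rw [max_eq_left (a := r) (by linarith), max_eq_left (a := r + ρ) (by linarith),
      max_eq_right hr1.le, max_eq_right (by linarith)]
    linarith

lemma continuous_annulusProfile_norm (hρ : 0 < ρ) : Continuous fun z : ℂ => annulusProfile ρ ‖z‖ :=
  (continuous_annulusProfile hρ).comp continuous_norm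

lemma lintegral_annulusProfile_norm_ne_top (hρ : 0 < ρ) :
    ∫⁻ z : ℂ, ENNReal.ofReal (annulusProfile ρ ‖z‖) ≠ ∞ := by
  have hint : Integrable fun z : ℂ => annulusProfile ρ ‖z‖ := by
    refine (continuous_annulusProfile_norm hρ).integrable_of_hasCompactSupport ?_
    refine HasCompactSupport.intro (isCompact_closedBall (0 : ℂ) (3 * ρ)) fun z hz => ?_
    rw [mem_closedBall_zero_iff, not_le] at hz
    exact annulusProfile_eq_zero hρ hz.le
  exact hint.lintegral_lt_top.ne

lemma lintegral_annulusProfile_norm_ne_zero (hρ : 0 < ρ) :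
    ∫⁻ z : ℂ, ENNReal.ofReal (annulusProfile ρ ‖z‖) ≠ 0 := by
  have hcont := continuous_annulusProfile_norm hρ
  refine ((lintegral_pos_iff_support hcont.measurable.ennreal_ofReal).2 ?_).ne'
  refine ((isOpen_lt continuous_const hcont).measure_pos volume
    ⟨0, by simpa using annulusProfile_zero_pos hρ⟩).trans_le (measure_mono fun z hz => ?_)
  exact (ENNReal.ofReal_pos.2 hz).ne'

lemma abs_integral_shift_sub_le {A : ℝ → ℝ} (hA : Continuous A) (hρ : 0 ≤ ρ) :
    |∫ r in ρ..2 * ρ, (A (r + ρ) - A r)| ≤ ∫ r in ρ..3 * ρ, |A r| := by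
  have hshift : ∫ r in ρ..2 * ρ, A (r + ρ) = ∫ r in 2 * ρ..3 * ρ, A r := by
    rw [intervalIntegral.integral_comp_add_right]
    ring_nf
  have hA' : Continuous fun r => A (r + ρ) := hA.comp (continuous_add_const ρ)
  rw [intervalIntegral.integral_sub (hA'.intervalIntegrable _ _)
    (hA.intervalIntegrable _ _), hshift,
    ← intervalIntegral.integral_add_adjacent_intervals (b := 2 * ρ)
      (hA.abs.intervalIntegrable _ _) (hA.abs.intervalIntegrable _ _), add_comm]
  exact (abs_sub _ _).trans (add_le_add
    (intervalIntegral.abs_integral_le_integral_abs (by linarith))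
    (intervalIntegral.abs_integral_le_integral_abs (by linarith)))

end AnnulusProfile

section LogPotential

/-- The sum of `log ‖z - w‖` over the points `w` of a multiset. -/
def logPotential (s : Multiset ℂ) (z : ℂ) : ℝ := (s.map fun w => Real.log ‖z - w‖).sum

lemma logPotential_zero : logPotential 0 = fun _ => 0 := by
  ext
  simp [logPotential]

lemma logPotential_cons (a : ℂ) (s : Multiset ℂ) :
    logPotential (a ::ₘ s) = (fun z => Real.log ‖z - a‖) + logPotential s := by
  ext
  simp [logPotential]

lemma measurable_logPotential (s : Multiset ℂ) : Measurable (logPotential s) := by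
  induction s using Multiset.induction_on with
  | empty => simp only [logPotential_zero, measurable_const]
  | cons a s ih =>
    rw [logPotential_cons]
    exact Measurable.add (by fun_prop) ih

lemma circleIntegrable_logPotential (s : Multiset ℂ) (c : ℂ) (r : ℝ) :
    CircleIntegrable (logPotential s) c r := by
  induction s using Multiset.induction_on with
  | empty => exact logPotential_zero ▸ circleIntegrable_const _ _ _
  | cons a s ih =>
    rw [logPotential_cons]
    exact (circleIntegrable_log_norm_sub_const r).add ih

variable {ρ : ℝ}

lemma circleAverage_logPotential {r : ℝ} (hρ : 0 < ρ) (hr : ρ ≤ r) (s : Multiset ℂ) (c : ℂ) :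
    Real.circleAverage (logPotential s) c r = (s.map fun w => logMax ρ r ‖w - c‖).sum := by
  induction s using Multiset.induction_on with
  | empty => simp only [logPotential_zero, Real.circleAverage_const, Multiset.map_zero,
      Multiset.sum_zero]
  | cons a s ih =>
    rw [logPotential_cons, Real.circleAverage_add (circleIntegrable_log_norm_sub_const r)
      (circleIntegrable_logPotential s c r), ih, circleAverage_log_norm_sub_eq_logMax hρ hr,
      Multiset.map_cons, Multiset.sum_cons]

lemma circleAverage_const_add_logPotential_sub {r : ℝ} (hρ : 0 < ρ) (hr : ρ ≤ r) (κ : ℝ)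
    (s t : Multiset ℂ) (c : ℂ) :
    Real.circleAverage ((fun _ => κ) + (logPotential s - logPotential t)) c r =
      κ + ((s.map fun w => logMax ρ r ‖w - c‖).sum -
        (t.map fun w => logMax ρ r ‖w - c‖).sum) := by
  have hs := circleIntegrable_logPotential s c r
  have ht := circleIntegrable_logPotential t c r
  rw [Real.circleAverage_add (circleIntegrable_const _ _ _) (hs.sub ht), Real.circleAverage_const,
    Real.circleAverage_sub hs ht, circleAverage_logPotential hρ hr,
    circleAverage_logPotential hρ hr]

lemma continuous_sum_logMax (hρ : 0 < ρ) (s : Multiset ℂ) (c : ℂ) :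
    Continuous fun r => (s.map fun w => logMax ρ r ‖w - c‖).sum :=
  continuous_multiset_sum _ fun _ _ => continuous_logMax_left hρ _

lemma continuous_sum_logMax_shift_sub (hρ : 0 < ρ) (s : Multiset ℂ) (c : ℂ) :
    Continuous fun r => (s.map fun w => logMax ρ (r + ρ) ‖w - c‖).sum -
      (s.map fun w => logMax ρ r ‖w - c‖).sum :=
  ((continuous_sum_logMax hρ s c).comp (continuous_add_const ρ)).sub (continuous_sum_logMax hρ s c)

lemma sum_annulusProfile (hρ : 0 < ρ) (s : Multiset ℂ) (c : ℂ) :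
    (s.map fun w => annulusProfile ρ ‖w - c‖).sum =
      ∫ r in ρ..2 * ρ, ((s.map fun w => logMax ρ (r + ρ) ‖w - c‖).sum -
        (s.map fun w => logMax ρ r ‖w - c‖).sum) := by
  induction s using Multiset.induction_on with
  | empty => simp
  | cons a s ih =>
    simp only [Multiset.map_cons, Multiset.sum_cons]
    rw [ih, annulusProfile, ← intervalIntegral.integral_add
      ((continuous_logMax_shift_sub hρ _).intervalIntegrable _ _)
      ((continuous_sum_logMax_shift_sub hρ s c).intervalIntegrable _ _)]
    refine intervalIntegral.integral_congr fun r _ => ?_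
    ring

/-- The additive constant `κ` is lost in the difference of the two averages that make up
`annulusProfile`. -/
lemma ofReal_abs_sum_annulusProfile_sub_le_logPotential (hρ : 0 < ρ) (κ : ℝ) (s t : Multiset ℂ)
    (c : ℂ) :
    ENNReal.ofReal |(s.map fun w => annulusProfile ρ ‖w - c‖).sum -
        (t.map fun w => annulusProfile ρ ‖w - c‖).sum| ≤
      ENNReal.ofReal ρ⁻¹ * ∫⁻ z in Metric.ball c (3 * ρ),
        ‖κ + (logPotential s z - logPotential t z)‖ₑ := by
  set A : ℝ → ℝ := fun r => κ + ((s.map fun w => logMax ρ r ‖w - c‖).sum -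
    (t.map fun w => logMax ρ r ‖w - c‖).sum)
  have hA : Continuous A :=
    continuous_const.add ((continuous_sum_logMax hρ s c).sub (continuous_sum_logMax hρ t c))
  have hdiff : (s.map fun w => annulusProfile ρ ‖w - c‖).sum -
      (t.map fun w => annulusProfile ρ ‖w - c‖).sum = ∫ r in ρ..2 * ρ, (A (r + ρ) - A r) := by
    rw [sum_annulusProfile hρ, sum_annulusProfile hρ, ← intervalIntegral.integral_sub
      ((continuous_sum_logMax_shift_sub hρ s c).intervalIntegrable _ _)
      ((continuous_sum_logMax_shift_sub hρ t c).intervalIntegrable _ _)]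
    refine intervalIntegral.integral_congr fun r _ => ?_
    simp only [A]
    ring
  calc _ ≤ ENNReal.ofReal (∫ r in ρ..3 * ρ, |A r|) := by
        rw [hdiff]
        exact ENNReal.ofReal_le_ofReal (abs_integral_shift_sub_le hA hρ.le)
    _ = ∫⁻ r in Set.Ioo ρ (3 * ρ), ‖A r‖ₑ := by
        rw [intervalIntegral.integral_of_le (by linarith), restrict_Ioo_eq_restrict_Ioc,
          ofReal_integral_eq_lintegral_ofReal (hA.abs.intervalIntegrable ρ (3 * ρ)).1
            (Eventually.of_forall fun _ => abs_nonneg _)]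
        simp only [Real.enorm_eq_ofReal_abs]
    _ = ∫⁻ r in Set.Ioo ρ (3 * ρ),
        ‖Real.circleAverage ((fun _ => κ) + (logPotential s - logPotential t)) c r‖ₑ :=
        setLIntegral_congr_fun measurableSet_Ioo fun r hr => by
          rw [circleAverage_const_add_logPotential_sub hρ hr.1.le]
    _ ≤ _ := lintegral_enorm_circleAverage_le
        (((measurable_logPotential s).sub (measurable_logPotential t)).const_add κ) hρ _ c

lemma log_norm_eval_eq_logPotential {p : ℂ[X]} {z : ℂ} (hz : p.eval z ≠ 0) :
    Real.log ‖p.eval z‖ = Real.log ‖p.leadingCoeff‖ + logPotential p.roots z := by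
  have hp : p ≠ 0 := by
    rintro rfl
    simp at hz
  have hroots : ∀ x ∈ p.roots.map fun w => ‖z - w‖, x ≠ 0 := by
    simp only [Multiset.mem_map, forall_exists_index, and_imp, forall_apply_eq_imp_iff₂,
      norm_ne_zero_iff, sub_ne_zero]
    rintro w hw rfl
    exact hz ((mem_roots hp).1 hw)
  rw [norm_eval_eq_prod_roots, Real.log_mul (by simpa using hp)
    (Multiset.prod_ne_zero fun h => hroots 0 h rfl), Real.log_multiset_prod hroots,
    Multiset.map_map]
  rfl

lemma ofReal_abs_sum_annulusProfile_sub_le {p q : ℂ[X]} (hp : p ≠ 0) (hq : q ≠ 0) (hρ : 0 < ρ)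
    (c : ℂ) :
    ENNReal.ofReal |(q.roots.map fun w => annulusProfile ρ ‖w - c‖).sum -
        (p.roots.map fun w => annulusProfile ρ ‖w - c‖).sum| ≤
      ENNReal.ofReal ρ⁻¹ * ∫⁻ z in Metric.ball c (3 * ρ), ENNReal.ofReal (absLogRatio p q z) := by
  refine (ofReal_abs_sum_annulusProfile_sub_le_logPotential hρ
    (Real.log ‖q.leadingCoeff‖ - Real.log ‖p.leadingCoeff‖) q.roots p.roots c).trans_eq ?_
  congr 1
  refine lintegral_congr_ae (ae_restrict_of_ae ?_)
  filter_upwards [(finite_setOf_eval_eq_zero hp).countable.ae_notMem volume,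
    (finite_setOf_eval_eq_zero hq).countable.ae_notMem volume] with z hpz hqz
  rw [absLogRatio, log_norm_eval_eq_logPotential hpz, log_norm_eval_eq_logPotential hqz,
    Real.enorm_eq_ofReal_abs]
  congr 2
  ring

end LogPotential

section KernelPortmanteau

variable {E : Type*} [NormedAddCommGroup E] [MeasurableSpace E] [BorelSpace E]
  [SecondCountableTopology E] {lam : Measure E} [lam.IsAddLeftInvariant] [lam.IsNegInvariant]
  [SFinite lam] {κ : E → ℝ≥0∞} {ρ : ℝ}

lemma lintegral_mul_measure_le_lintegral_kernel (hκ : Measurable κ)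
    (hκ0 : ∀ z, ρ ≤ ‖z‖ → κ z = 0) {μ : Measure E} [SFinite μ] {V W : Set E}
    (hV : MeasurableSet V) (hW : MeasurableSet W) (hVW : ∀ w ∈ W, ∀ c, ‖w - c‖ < ρ → c ∈ V) :
    (∫⁻ z, κ z ∂lam) * μ W ≤ ∫⁻ c in V, ∫⁻ w, κ (w - c) ∂μ ∂lam := by
  rw [lintegral_lintegral_swap (by fun_prop)]
  calc (∫⁻ z, κ z ∂lam) * μ W = ∫⁻ _ in W, (∫⁻ z, κ z ∂lam) ∂μ := by
        rw [lintegral_const, Measure.restrict_apply_univ]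
    _ ≤ ∫⁻ w in W, (∫⁻ c in V, κ (w - c) ∂lam) ∂μ := by
        refine setLIntegral_mono' hW fun w hw => ?_
        rw [← lintegral_sub_left_eq_self κ w, ← lintegral_indicator hV]
        refine lintegral_mono fun c => ?_
        by_cases hc : c ∈ V
        · rw [Set.indicator_of_mem hc]
        · rw [hκ0 _ (not_lt.1 fun h => hc (hVW w hw c h))]
          exact zero_le
    _ ≤ _ := setLIntegral_le_lintegral _ _

lemma lintegral_kernel_le_lintegral_mul_measure (hκ : Measurable κ)
    (hκ0 : ∀ z, ρ ≤ ‖z‖ → κ z = 0) {ν : Measure E} [SFinite ν] {U V : Set E}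
    (hU : MeasurableSet U) (hV : MeasurableSet V) (hUV : ∀ c ∈ V, ∀ w, ‖w - c‖ < ρ → w ∈ U) :
    ∫⁻ c in V, ∫⁻ w, κ (w - c) ∂ν ∂lam ≤ (∫⁻ z, κ z ∂lam) * ν U := by
  rw [lintegral_lintegral_swap (by fun_prop), ← lintegral_indicator_const hU]
  refine lintegral_mono fun w => ?_
  by_cases hw : w ∈ U
  · rw [Set.indicator_of_mem hw, ← lintegral_sub_left_eq_self κ w]
    exact setLIntegral_le_lintegral _ _
  · rw [Set.indicator_of_notMem hw, nonpos_iff_eq_zero, ← lintegral_zero (μ := lam.restrict V)]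
    exact setLIntegral_congr_fun hV fun c hc => hκ0 _ (not_lt.1 fun h => hw (hUV c hc w h))

lemma measure_compl_thickening_le_liminf {μ : Measure E} [SFinite μ] {ν : ℕ → Measure E}
    [∀ n, SFinite (ν n)] (hκ : Measurable κ) (hκ0 : ∀ z, ρ ≤ ‖z‖ → κ z = 0)
    (hpos : ∫⁻ z, κ z ∂lam ≠ 0) (hfin : ∫⁻ z, κ z ∂lam ≠ ∞)
    (hlim : ∀ c, ∫⁻ w, κ (w - c) ∂μ ≤ liminf (fun n => ∫⁻ w, κ (w - c) ∂ν n) atTop)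
    {F : Set E} (hF : IsClosed F) :
    μ (Metric.thickening (ρ + ρ) F)ᶜ ≤ liminf (fun n => ν n Fᶜ) atTop := by
  have hmeas : ∀ r, MeasurableSet (Metric.thickening r F)ᶜ :=
    fun r => Metric.isOpen_thickening.measurableSet.compl
  have hlower := lintegral_mul_measure_le_lintegral_kernel (lam := lam) (μ := μ) hκ hκ0 (hmeas ρ)
    (hmeas (ρ + ρ)) fun w hw c hwc hc => hw <| by
      obtain ⟨y, hy, hcy⟩ := Metric.mem_thickening_iff.1 hc
      rw [← dist_eq_norm] at hwc
      exact Metric.mem_thickening_iff.2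
        ⟨y, hy, (dist_triangle w c y).trans_lt (add_lt_add hwc hcy)⟩
  have hupper := fun n => lintegral_kernel_le_lintegral_mul_measure (lam := lam) (ν := ν n) hκ hκ0
    hF.isOpen_compl.measurableSet (hmeas ρ) fun c hc w hwc hw =>
      hc (Metric.mem_thickening_iff.2 ⟨w, hw, by rwa [dist_comm, dist_eq_norm]⟩)
  have hfatou : (∫⁻ z, κ z ∂lam) * μ (Metric.thickening (ρ + ρ) F)ᶜ ≤
      (∫⁻ z, κ z ∂lam) * liminf (fun n => ν n Fᶜ) atTop := by
    calc _ ≤ _ := hlower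
      _ ≤ ∫⁻ c in (Metric.thickening ρ F)ᶜ, liminf (fun n => ∫⁻ w, κ (w - c) ∂ν n) atTop ∂lam :=
        lintegral_mono hlim
      _ ≤ liminf (fun n => ∫⁻ c in (Metric.thickening ρ F)ᶜ, ∫⁻ w, κ (w - c) ∂ν n ∂lam) atTop :=
        lintegral_liminf_le fun n => Measurable.lintegral_prod_right (by fun_prop)
      _ ≤ liminf (fun n => (∫⁻ z, κ z ∂lam) * ν n Fᶜ) atTop :=
        liminf_le_liminf (Eventually.of_forall hupper)
      _ = _ := ENNReal.liminf_const_mul_of_ne_top hfin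
  exact (ENNReal.mul_le_mul_iff_right hpos hfin).1 hfatou

lemma tendsto_measure_compl_thickening {α : Type*} [PseudoEMetricSpace α] [MeasurableSpace α]
    [OpensMeasurableSpace α] (μ : Measure α) [IsFiniteMeasure μ] {F : Set α} (hF : IsClosed F) :
    Tendsto (fun r => μ (Metric.thickening r F)ᶜ) (𝓝[>] 0) (𝓝 (μ Fᶜ)) := by
  have h := ENNReal.Tendsto.sub (tendsto_const_nhds (x := μ Set.univ))
    (tendsto_measure_thickening_of_isClosed (μ := μ) ⟨1, one_pos, measure_ne_top _ _⟩ hF)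
    (Or.inl (measure_ne_top _ _))
  rw [← measure_compl hF.measurableSet (measure_ne_top _ _)] at h
  exact h.congr fun r => (measure_compl Metric.isOpen_thickening.measurableSet
    (measure_ne_top _ _)).symm

lemma measure_le_liminf_of_kernel (lam : Measure E) [lam.IsAddLeftInvariant] [lam.IsNegInvariant]
    [SFinite lam] {μ : Measure E} [IsFiniteMeasure μ] {ν : ℕ → Measure E} [∀ n, SFinite (ν n)]
    (h : ∀ ρ : ℝ, 0 < ρ → ∃ κ : E → ℝ≥0∞, Measurable κ ∧ (∀ z, ρ ≤ ‖z‖ → κ z = 0) ∧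
      ∫⁻ z, κ z ∂lam ≠ 0 ∧ ∫⁻ z, κ z ∂lam ≠ ∞ ∧
      ∀ c, ∫⁻ w, κ (w - c) ∂μ ≤ liminf (fun n => ∫⁻ w, κ (w - c) ∂ν n) atTop)
    {U : Set E} (hU : IsOpen U) : μ U ≤ liminf (fun n => ν n U) atTop := by
  have hlim := tendsto_measure_compl_thickening μ hU.isClosed_compl
  rw [compl_compl] at hlim
  refine le_of_tendsto hlim ?_
  filter_upwards [self_mem_nhdsWithin] with r hr
  obtain ⟨κ, hκ, hκ0, hpos, hfin, hκlim⟩ := h (r / 2) (half_pos hr)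
  simpa only [add_halves, compl_compl] using
    measure_compl_thickening_le_liminf hκ hκ0 hpos hfin hκlim hU.isClosed_compl

end KernelPortmanteau

section DerivZeroMeasure

lemma rootPoly_ne_zero (z : ℕ → ℂ) (n : ℕ) : rootPoly z n ≠ 0 :=
  (monic_prod_of_monic _ _ fun j _ => monic_X_sub_C (z j)).ne_zero

lemma natDegree_rootPoly (z : ℕ → ℂ) (n : ℕ) : (rootPoly z n).natDegree = n := by
  simp [rootPoly, natDegree_prod_of_monic _ _ fun j _ => monic_X_sub_C (z j)]

lemma roots_rootPoly (z : ℕ → ℂ) (n : ℕ) : (rootPoly z n).roots = (Multiset.range n).map z := by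
  rw [rootPoly, roots_prod _ _ (rootPoly_ne_zero z n)]
  simp [Multiset.bind_singleton]

lemma natDegree_iterate_derivative_rootPoly (z : ℕ → ℂ) (k n : ℕ) :
    (derivative^[k] (rootPoly z n)).natDegree = n - k := by
  induction k with
  | zero => exact natDegree_rootPoly z n
  | succ k ih => rw [Function.iterate_succ_apply', natDegree_derivative, ih, Nat.sub_sub]

lemma iterate_derivative_rootPoly_ne_zero (z : ℕ → ℂ) {k n : ℕ} (h : k < n) :
    derivative^[k] (rootPoly z n) ≠ 0 := by
  refine ne_zero_of_natDegree_gt (n := 0) ?_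
  rw [natDegree_iterate_derivative_rootPoly]
  omega

lemma lintegral_sum_diracProba {X : Type*} [MeasurableSpace X] [TopologicalSpace X]
    [OpensMeasurableSpace X] (s : Multiset X) {f : X → ℝ≥0∞} (hf : Measurable f) :
    ∫⁻ w, f w ∂((s.map fun w => (diracProba w).toFiniteMeasure).sum : FiniteMeasure X) =
      (s.map f).sum := by
  induction s using Multiset.induction_on with
  | empty => simp
  | cons a s ih =>
    rw [Multiset.map_cons, Multiset.sum_cons, FiniteMeasure.toMeasure_add,
      lintegral_add_measure, ih, Multiset.map_cons, Multiset.sum_cons]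
    exact congrArg (· + _) (lintegral_dirac' a hf)

lemma lintegral_derivZeroMeasure (z : ℕ → ℂ) {k n : ℕ} (h : k < n) {f : ℂ → ℝ≥0∞}
    (hf : Measurable f) :
    ∫⁻ w, f w ∂(derivZeroMeasure z k n : Measure ℂ) =
      ((n - k : ℕ) : ℝ≥0∞)⁻¹ * ((derivative^[k] (rootPoly z n)).roots.map f).sum := by
  rw [derivZeroMeasure, FiniteMeasure.toMeasure_smul, lintegral_smul_measure,
    lintegral_sum_diracProba _ hf, ENNReal.smul_def, smul_eq_mul,
    ENNReal.coe_inv (Nat.cast_ne_zero.2 (Nat.sub_pos_of_lt h).ne'), ENNReal.coe_natCast]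

lemma derivZeroMeasure_apply (z : ℕ → ℂ) {k n : ℕ} (h : k < n) {s : Set ℂ}
    (hs : MeasurableSet s) :
    (derivZeroMeasure z k n : Measure ℂ) s =
      ((n - k : ℕ) : ℝ≥0∞)⁻¹ *
        ((derivative^[k] (rootPoly z n)).roots.map (s.indicator 1)).sum := by
  rw [← lintegral_indicator_one hs]
  exact lintegral_derivZeroMeasure z h (measurable_one.indicator hs)

lemma isProbabilityMeasure_derivZeroMeasure (z : ℕ → ℂ) {k n : ℕ} (h : k < n) :
    IsProbabilityMeasure (derivZeroMeasure z k n : Measure ℂ) := by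
  constructor
  rw [derivZeroMeasure_apply z h MeasurableSet.univ]
  simp only [Set.indicator_univ, Pi.one_apply, Multiset.map_const', Multiset.sum_replicate,
    IsAlgClosed.card_roots_eq_natDegree, natDegree_iterate_derivative_rootPoly, nsmul_eq_mul,
    mul_one]
  exact ENNReal.inv_mul_cancel (Nat.cast_ne_zero.2 (Nat.sub_pos_of_lt h).ne')
    (ENNReal.natCast_ne_top _)

lemma tendsto_derivZeroMeasure_of_isOpen {μ : ProbabilityMeasure ℂ} {z : ℕ → ℂ} {k : ℕ}
    (h : ∀ U : Set ℂ, IsOpen U →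
      (μ : Measure ℂ) U ≤ liminf (fun n => (derivZeroMeasure z k n : Measure ℂ) U) atTop) :
    Tendsto (fun n => derivZeroMeasure z k n) atTop (𝓝 μ.toFiniteMeasure) := by
  rw [← tendsto_add_atTop_iff_nat (k + 1)]
  let ν : ℕ → ProbabilityMeasure ℂ := fun n =>
    ⟨derivZeroMeasure z k (n + (k + 1)), isProbabilityMeasure_derivZeroMeasure z (by omega)⟩
  have hν : Tendsto ν atTop (𝓝 μ) := by
    refine tendsto_of_forall_isOpen_le_liminf_nat' fun U hU => (h U hU).trans_eq ?_
    exact (liminf_nat_add (fun n => (derivZeroMeasure z k n : Measure ℂ) U) (k + 1)).symm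
  exact (ProbabilityMeasure.tendsto_nhds_iff_toFiniteMeasure_tendsto_nhds atTop).1 hν

end DerivZeroMeasure

section SmallPolynomial

lemma norm_eval_iterate_derivative_rootPoly_le {z : ℕ → ℂ} {n : ℕ} {w : ℂ}
    (hw : (rootPoly z n).eval w ≠ 0) (k : ℕ) :
    ‖(derivative^[k] (rootPoly z n)).eval w‖ ≤
      k.factorial * poleSum (rootPoly z n).roots w ^ k * ‖(rootPoly z n).eval w‖ := by
  have heval : (rootPoly z n).eval w = ∏ j ∈ Finset.range n, (w - z j) := by
    simp [rootPoly, eval_prod]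
  have hpole : (poleSum (rootPoly z n).roots w : ℝ) = ∑ j ∈ Finset.range n, ‖(w - z j)⁻¹‖ := by
    rw [poleSum, roots_rootPoly, Multiset.map_map]
    change ((∑ j ∈ Finset.range n, ‖w - z j‖₊⁻¹ : ℝ≥0) : ℝ) = _
    push_cast
    simp only [norm_inv]
  rw [rootPoly, eval_iterate_derivative_prod _ _ (Finset.prod_ne_zero_iff.1 (heval ▸ hw)),
    ← rootPoly, heval, hpole, norm_mul, norm_mul, Complex.norm_natCast]
  gcongr
  exact norm_coeff_esymmGen_le _ _ _

lemma measure_card_sq_le_poleSum_le {lam : Measure ℂ} {K : ℝ≥0∞}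
    (hK : ∀ w, ∫⁻ z, ↑‖z - w‖₊⁻¹ ∂lam ≤ K) {s : Multiset ℂ} (hs : s ≠ 0) :
    lam {z | (s.card : ℝ≥0∞) ^ 2 ≤ poleSum s z} ≤ K / s.card := by
  have hcard : (s.card : ℝ≥0∞) ≠ 0 := Nat.cast_ne_zero.2 (Multiset.card_eq_zero.not.2 hs)
  calc _ ≤ (∫⁻ z, poleSum s z ∂lam) / (s.card : ℝ≥0∞) ^ 2 :=
        meas_ge_le_lintegral_div (measurable_poleSum s).coe_nnreal_ennreal.aemeasurable
          (pow_ne_zero 2 hcard) (by finiteness)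
    _ ≤ s.card * K / (s.card : ℝ≥0∞) ^ 2 := ENNReal.div_le_div_right (lintegral_poleSum_le hK s) _
    _ = K / s.card := by
        rw [pow_two, ENNReal.mul_div_mul_left _ _ hcard (by finiteness)]

lemma eventually_exp_neg_mul_pow_lt_one {ε : ℝ} (hε : 0 < ε) (c : ℝ) (d : ℕ) :
    ∀ᶠ n : ℕ in atTop, Real.exp (-ε * n) * (c * (n : ℝ) ^ d) < 1 := by
  have hlim : Tendsto (fun n : ℕ => c / ε ^ d * ((ε * n) ^ d * Real.exp (-(ε * n)))) atTop
      (𝓝 (c / ε ^ d * 0)) :=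
    ((Real.tendsto_pow_mul_exp_neg_atTop_nhds_zero d).comp
      (tendsto_natCast_atTop_atTop.const_mul_atTop hε)).const_mul _
  rw [mul_zero] at hlim
  filter_upwards [hlim.eventually (gt_mem_nhds one_pos)] with n hn
  refine lt_of_eq_of_lt ?_ hn
  rw [mul_pow, neg_mul]
  field_simp

lemma tendsto_measure_norm_eval_rootPoly_le {lam : Measure ℂ} [NullSingletonClass lam]
    {K : ℝ≥0∞} (hKtop : K ≠ ∞) (hK : ∀ w, ∫⁻ z, ↑‖z - w‖₊⁻¹ ∂lam ≤ K) (z : ℕ → ℂ) (k : ℕ)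
    {ε : ℝ} (hε : 0 < ε) :
    Tendsto (fun n : ℕ => lam {w | ‖(rootPoly z n).eval w‖ ≤
      Real.exp (-ε * n) * ‖(derivative^[k] (rootPoly z n)).eval w‖}) atTop (𝓝 0) := by
  have hlim : Tendsto (fun n : ℕ => K / n) atTop (𝓝 0) := by
    simpa only [div_eq_mul_inv, mul_zero] using
      ENNReal.Tendsto.const_mul ENNReal.tendsto_inv_nat_nhds_zero (Or.inr hKtop)
  refine tendsto_of_tendsto_of_tendsto_of_le_of_le' tendsto_const_nhds hlim
    (Eventually.of_forall fun _ => zero_le) ?_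
  filter_upwards [eventually_exp_neg_mul_pow_lt_one hε k.factorial (2 * k),
    eventually_gt_atTop 0] with n hn hn0
  have hcard : (rootPoly z n).roots.card = n := by simp [roots_rootPoly]
  have hmarkov := measure_card_sq_le_poleSum_le hK (s := (rootPoly z n).roots)
    (Multiset.card_pos.1 (hn0.trans_eq hcard.symm))
  rw [hcard] at hmarkov
  have hne : ∀ᵐ w ∂lam, (rootPoly z n).eval w ≠ 0 := by
    simpa only [ae_iff, not_not] using
      (finite_setOf_eval_eq_zero (rootPoly_ne_zero z n)).measure_zero lam
  refine (measure_mono_ae ?_).trans hmarkov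
  filter_upwards [hne] with w hw hle
  by_contra hlt
  have hpole : (poleSum (rootPoly z n).roots w : ℝ) ≤ (n : ℝ) ^ 2 := by
    exact_mod_cast (not_le.1 hlt).le
  have hpos : 0 < ‖(rootPoly z n).eval w‖ := norm_pos_iff.2 hw
  refine (hle.trans_lt' ?_).false
  calc _ ≤ Real.exp (-ε * n) *
          (k.factorial * ((n : ℝ) ^ 2) ^ k * ‖(rootPoly z n).eval w‖) := by
        gcongr
        refine (norm_eval_iterate_derivative_rootPoly_le hw k).trans ?_
        gcongr
    _ = Real.exp (-ε * n) * (k.factorial * (n : ℝ) ^ (2 * k)) * ‖(rootPoly z n).eval w‖ := by ring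
    _ < ‖(rootPoly z n).eval w‖ := mul_lt_of_lt_one_left hpos hn

end SmallPolynomial

section Transfer

/-- On every disc, `‖q n‖ / ‖p n‖` decays at most subexponentially in Lebesgue measure. -/
def SubexponentialDecay (p q : ℕ → ℂ[X]) : Prop :=
  ∀ R ε : ℝ, 0 < ε → Tendsto (fun n : ℕ => volume {w ∈ Metric.ball (0 : ℂ) R |
    ‖(q n).eval w‖ ≤ Real.exp (-ε * n) * ‖(p n).eval w‖}) atTop (𝓝 0)

variable {z : ℕ → ℂ} {k : ℕ}

lemma SubexponentialDecay.tendsto_lintegral_absLogRatio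
    (h : SubexponentialDecay (rootPoly z) fun n => derivative^[k] (rootPoly z n)) {R : ℝ}
    (hR : 0 < R) :
    Tendsto (fun n : ℕ => (n : ℝ≥0∞)⁻¹ * ∫⁻ w in Metric.ball 0 R,
      ENNReal.ofReal (absLogRatio (rootPoly z n) (derivative^[k] (rootPoly z n)) w))
      atTop (𝓝 0) := by
  have hball : volume (Metric.ball (0 : ℂ) R) ≠ ∞ := measure_ball_lt_top.ne
  have : IsFiniteMeasure (volume.restrict (Metric.ball (0 : ℂ) R)) :=
    isFiniteMeasure_restrict.2 hball
  obtain ⟨K, hKtop, hK⟩ := exists_lintegral_inv_nnnorm_sub_le volume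
    (by simp [Complex.finrank_real_complex]) hball
  refine _root_.tendsto_lintegral_absLogRatio (s := Metric.ball 0 R) (ρ := R + R) ?_
    (ae_restrict_mem measurableSet_ball) (fun w hw w' hw' => ?_) hKtop hK
    (Eventually.of_forall (rootPoly_ne_zero z))
    ((eventually_gt_atTop k).mono fun n hn => iterate_derivative_rootPoly_ne_zero z hn)
    (fun n => (natDegree_rootPoly z n).le)
    (fun n => (natDegree_iterate_derivative_rootPoly z k n).trans_le (n.sub_le k))
    fun ε hε => tendsto_measure_lt_absLogRatio ?_
      (tendsto_measure_norm_eval_rootPoly_le hKtop hK z k hε)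
  · rw [Ne, Measure.restrict_eq_zero]
    exact (Metric.measure_ball_pos volume 0 hR).ne'
  · rw [mem_ball_zero_iff] at hw hw'
    exact (norm_sub_le w w').trans (add_le_add hw.le hw'.le)
  · refine (h R ε hε).congr fun n => ?_
    rw [Measure.restrict_apply (measurableSet_le (by fun_prop) (by fun_prop)), Set.inter_comm]
    rfl

lemma sum_map_ofReal {ι : Type*} (s : Multiset ι) {f : ι → ℝ} (hf : ∀ i, 0 ≤ f i) :
    (s.map fun i => ENNReal.ofReal (f i)).sum = ENNReal.ofReal (s.map f).sum := by
  induction s using Multiset.induction_on with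
  | empty => simp
  | cons a s ih =>
    rw [Multiset.map_cons, Multiset.sum_cons, Multiset.map_cons, Multiset.sum_cons, ih,
      ENNReal.ofReal_add (hf a) (Multiset.sum_nonneg (by simpa using fun i _ => hf i))]

lemma lintegral_annulusProfile_derivZeroMeasure_le {ρ : ℝ} (hρ : 0 < ρ) (c : ℂ) {n : ℕ}
    (hn : k < n) :
    ∫⁻ w, ENNReal.ofReal (annulusProfile ρ ‖w - c‖) ∂(derivZeroMeasure z 0 n : Measure ℂ) ≤
      ∫⁻ w, ENNReal.ofReal (annulusProfile ρ ‖w - c‖) ∂(derivZeroMeasure z k n : Measure ℂ) +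
        ENNReal.ofReal ρ⁻¹ * ((n : ℝ≥0∞)⁻¹ * ∫⁻ w in Metric.ball 0 (‖c‖ + 3 * ρ),
          ENNReal.ofReal (absLogRatio (rootPoly z n) (derivative^[k] (rootPoly z n)) w)) := by
  have hmeas : Measurable fun w => ENNReal.ofReal (annulusProfile ρ ‖w - c‖) :=
    ((continuous_annulusProfile_norm hρ).comp (continuous_sub_right c)).measurable.ennreal_ofReal
  have hnonneg (w : ℂ) : 0 ≤ annulusProfile ρ ‖w - c‖ := annulusProfile_nonneg hρ _
  rw [lintegral_derivZeroMeasure z (k.zero_le.trans_lt hn) hmeas,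
    lintegral_derivZeroMeasure z hn hmeas, sum_map_ofReal _ hnonneg, sum_map_ofReal _ hnonneg,
    Function.iterate_zero, id, Nat.sub_zero]
  have hdiff := ofReal_abs_sum_annulusProfile_sub_le (rootPoly_ne_zero z n)
    (iterate_derivative_rootPoly_ne_zero z hn) hρ c
  set a := ((rootPoly z n).roots.map fun w => annulusProfile ρ ‖w - c‖).sum
  set b := ((derivative^[k] (rootPoly z n)).roots.map fun w => annulusProfile ρ ‖w - c‖).sum
  have hab : ENNReal.ofReal a ≤ ENNReal.ofReal b + ENNReal.ofReal |b - a| := by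
    refine (ENNReal.ofReal_le_ofReal ?_).trans ENNReal.ofReal_add_le
    linarith [neg_abs_le (b - a)]
  have hball : Metric.ball c (3 * ρ) ⊆ Metric.ball 0 (‖c‖ + 3 * ρ) :=
    Metric.ball_subset_ball' (by rw [dist_zero_right, add_comm])
  calc _ ≤ (n : ℝ≥0∞)⁻¹ * (ENNReal.ofReal b + ENNReal.ofReal ρ⁻¹ *
        ∫⁻ w in Metric.ball 0 (‖c‖ + 3 * ρ),
          ENNReal.ofReal (absLogRatio (rootPoly z n) (derivative^[k] (rootPoly z n)) w)) := by
        gcongr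
        exact hab.trans (add_le_add_right (hdiff.trans
          (mul_le_mul_right (lintegral_mono_set hball) _)) _)
    _ = (n : ℝ≥0∞)⁻¹ * ENNReal.ofReal b + ENNReal.ofReal ρ⁻¹ * ((n : ℝ≥0∞)⁻¹ *
        ∫⁻ w in Metric.ball 0 (‖c‖ + 3 * ρ),
          ENNReal.ofReal (absLogRatio (rootPoly z n) (derivative^[k] (rootPoly z n)) w)) := by
        ring
    _ ≤ _ := by
        gcongr
        exact n.sub_le k

lemma measure_le_liminf_derivZeroMeasure {μ : Measure ℂ} [IsFiniteMeasure μ]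
    (h0 : ∀ U : Set ℂ, IsOpen U →
      μ U ≤ liminf (fun n => (derivZeroMeasure z 0 n : Measure ℂ) U) atTop)
    (h : SubexponentialDecay (rootPoly z) fun n => derivative^[k] (rootPoly z n))
    {U : Set ℂ} (hU : IsOpen U) :
    μ U ≤ liminf (fun n => (derivZeroMeasure z k n : Measure ℂ) U) atTop := by
  refine measure_le_liminf_of_kernel volume (fun δ hδ => ?_) hU
  have hρ : 0 < δ / 4 := by positivity
  have hcont := continuous_annulusProfile_norm hρ
  refine ⟨fun w => ENNReal.ofReal (annulusProfile (δ / 4) ‖w‖), hcont.measurable.ennreal_ofReal,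
    fun w hw => ?_, lintegral_annulusProfile_norm_ne_zero hρ,
    lintegral_annulusProfile_norm_ne_top hρ, fun c => ?_⟩
  · exact ENNReal.ofReal_eq_zero.2 (annulusProfile_eq_zero hρ (by linarith)).le
  have herr : Tendsto (fun n : ℕ => ENNReal.ofReal (δ / 4)⁻¹ * ((n : ℝ≥0∞)⁻¹ *
      ∫⁻ w in Metric.ball 0 (‖c‖ + 3 * (δ / 4)),
        ENNReal.ofReal (absLogRatio (rootPoly z n) (derivative^[k] (rootPoly z n)) w)))
      atTop (𝓝 0) := by
    simpa only [mul_zero] using ENNReal.Tendsto.const_mul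
      (h.tendsto_lintegral_absLogRatio (by positivity : 0 < ‖c‖ + 3 * (δ / 4)))
      (Or.inr ENNReal.ofReal_ne_top)
  calc ∫⁻ w, ENNReal.ofReal (annulusProfile (δ / 4) ‖w - c‖) ∂μ
      ≤ liminf (fun n => ∫⁻ w, ENNReal.ofReal (annulusProfile (δ / 4) ‖w - c‖)
          ∂(derivZeroMeasure z 0 n : Measure ℂ)) atTop :=
        lintegral_le_liminf_lintegral_of_forall_isOpen_measure_le_liminf_measure
          (hcont.comp (continuous_sub_right c)) (fun w => annulusProfile_nonneg hρ _) h0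
    _ ≤ _ := liminf_le_liminf ((eventually_gt_atTop k).mono fun n hn =>
        lintegral_annulusProfile_derivZeroMeasure_le hρ c hn)
    _ = _ := ENNReal.liminf_add_of_right_tendsto_zero herr _

end Transfer

section LawOfLargeNumbers

variable {Ω : Type*} [MeasurableSpace Ω] {P : Measure Ω} {Z : ℕ → Ω → ℂ}

lemma derivZeroMeasure_zero_apply (z : ℕ → ℂ) {n : ℕ} (h : 0 < n) {s : Set ℂ}
    (hs : MeasurableSet s) :
    (derivZeroMeasure z 0 n : Measure ℂ) s =
      ENNReal.ofReal ((∑ j ∈ Finset.range n, s.indicator 1 (z j)) / n) := by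
  rw [derivZeroMeasure_apply z h hs, Function.iterate_zero, id, roots_rootPoly, Multiset.map_map,
    Nat.sub_zero, ENNReal.ofReal_div_of_pos (Nat.cast_pos.2 h), ENNReal.ofReal_natCast,
    ENNReal.div_eq_inv_mul, ENNReal.ofReal_sum_of_nonneg fun j _ =>
      Set.indicator_nonneg (f := (1 : ℂ → ℝ)) (fun _ _ => zero_le_one) _]
  congr 1
  change ∑ j ∈ Finset.range n, _ = _
  refine Finset.sum_congr rfl fun j _ => ?_
  by_cases hj : z j ∈ s <;> simp [hj]

lemma ae_tendsto_derivZeroMeasure_zero {μ : Measure ℂ} [IsFiniteMeasure μ]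
    (hmeas : ∀ j, Measurable (Z j)) (hlaw : ∀ j, P.map (Z j) = μ) (hindep : iIndepFun Z P)
    {s : Set ℂ} (hs : MeasurableSet s) :
    ∀ᵐ ω ∂P, Tendsto (fun n => (derivZeroMeasure (fun j => Z j ω) 0 n : Measure ℂ) s) atTop
      (𝓝 (μ s)) := by
  have hf : Measurable (s.indicator (1 : ℂ → ℝ)) := measurable_one.indicator hs
  have hint : Integrable (s.indicator (1 : ℂ → ℝ)) (P.map (Z 0)) := by
    rw [hlaw 0]
    exact (integrable_const (1 : ℝ)).indicator hs
  have hmean : ∫ ω, s.indicator (1 : ℂ → ℝ) (Z 0 ω) ∂P = μ.real s := by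
    rw [← integral_indicator_one hs, ← hlaw 0,
      integral_map (hmeas 0).aemeasurable hf.aestronglyMeasurable]
  have hident (j : ℕ) : IdentDistrib (Z j) (Z 0) P P :=
    ⟨(hmeas j).aemeasurable, (hmeas 0).aemeasurable, by rw [hlaw, hlaw]⟩
  filter_upwards [strong_law_ae_real (fun j ω => s.indicator (1 : ℂ → ℝ) (Z j ω))
    (hint.comp_measurable (hmeas 0)) (fun i j hij => (hindep.indepFun hij).comp hf hf)
    (fun j => (hident j).comp hf)] with ω hω
  rw [hmean] at hω
  have hlim := ENNReal.tendsto_ofReal hω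
  rw [ofReal_measureReal] at hlim
  refine hlim.congr' ?_
  filter_upwards [eventually_gt_atTop 0] with n hn
  rw [derivZeroMeasure_zero_apply _ hn hs]

lemma exists_countable_forall_isOpen_measure_le_liminf {X : Type*} [TopologicalSpace X]
    [SecondCountableTopology X] [MeasurableSpace X] [OpensMeasurableSpace X]
    (μ : ProbabilityMeasure X) :
    ∃ 𝒞 : Set (Set X), 𝒞.Countable ∧ (∀ s ∈ 𝒞, MeasurableSet s) ∧ ∀ ν : ℕ → Measure X,
      (∀ s ∈ 𝒞, Tendsto (fun n => ν n s) atTop (𝓝 ((μ : Measure X) s))) →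
        ∀ U, IsOpen U → (μ : Measure X) U ≤ liminf (fun n => ν n U) atTop := by
  let B := TopologicalSpace.countableBasis X
  have hBo : ∀ t ∈ B, IsOpen t := fun t ht => TopologicalSpace.isOpen_of_mem_countableBasis ht
  refine ⟨(fun T : Finset (Set X) => ⋃ t ∈ T, t) '' {T | (T : Set (Set X)) ⊆ B},
    .image ?_ _, ?_, fun ν hν U hU => le_of_forall_lt fun r hr => ?_⟩
  · have hfin := Set.countable_ofPred_finite_subset (TopologicalSpace.countable_countableBasis X)
    refine (hfin.preimage (f := ((↑) : Finset (Set X) → Set (Set X))) Finset.coe_injective).mono ?_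
    exact fun T hT => ⟨T.finite_toSet, hT⟩
  · rintro _ ⟨T, hT, rfl⟩
    exact (isOpen_biUnion fun t ht => hBo t (hT ht)).measurableSet
  obtain ⟨r', hrr', hr'⟩ := exists_between hr
  lift r' to ℝ≥0 using hr'.ne_top
  rw [← ProbabilityMeasure.ennreal_coeFn_eq_coeFn_toMeasure, ENNReal.coe_lt_coe] at hr'
  obtain ⟨T, hTB, hrT, hTU⟩ := ProbabilityMeasure.exists_lt_measure_biUnion_of_isOpen (S := B) μ
    (fun u hu x hx => by
      obtain ⟨t, ht, hxt, htu⟩ :=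
        (TopologicalSpace.isBasis_countableBasis X).exists_subset_of_mem_open hx hu
      exact ⟨t, ht, (hBo t ht).mem_nhds hxt, htu⟩) hU hr'
  rw [← ENNReal.coe_lt_coe, ProbabilityMeasure.ennreal_coeFn_eq_coeFn_toMeasure] at hrT
  calc r < (μ : Measure X) (⋃ t ∈ T, t) := hrr'.trans hrT
    _ = liminf (fun n => ν n (⋃ t ∈ T, t)) atTop := (hν _ ⟨T, hTB, rfl⟩).liminf_eq.symm
    _ ≤ _ := liminf_le_liminf (Eventually.of_forall fun n => measure_mono hTU)

lemma ae_forall_isOpen_measure_le_liminf_derivZeroMeasure_zero {μ : ProbabilityMeasure ℂ}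
    (hmeas : ∀ j, Measurable (Z j)) (hlaw : ∀ j, P.map (Z j) = (μ : Measure ℂ))
    (hindep : iIndepFun Z P) :
    ∀ᵐ ω ∂P, ∀ U : Set ℂ, IsOpen U → (μ : Measure ℂ) U ≤
      liminf (fun n => (derivZeroMeasure (fun j => Z j ω) 0 n : Measure ℂ) U) atTop := by
  obtain ⟨𝒞, hcount, h𝒞, hliminf⟩ := exists_countable_forall_isOpen_measure_le_liminf μ
  filter_upwards [(ae_ball_iff hcount).2 fun s hs =>
    ae_tendsto_derivZeroMeasure_zero hmeas hlaw hindep (h𝒞 s hs)] with ω hω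
  exact hliminf _ hω

lemma ae_subexponentialDecay_derivative [IsProbabilityMeasure P] {μ : Measure ℂ}
    [IsProbabilityMeasure μ] (hμ : μ.support.Infinite) (hmeas : ∀ j, Measurable (Z j))
    (hlaw : ∀ j, P.map (Z j) = μ) (hindep : iIndepFun Z P) (k : ℕ) :
    ∀ᵐ ω ∂P, SubexponentialDecay (rootPoly fun j => Z j ω)
      fun n => derivative^[k] (rootPoly (fun j => Z j ω) n) := by
  filter_upwards [ae_all_iff.2 fun m : ℕ => ae_all_iff.2 fun l : ℕ =>
    ae_tendsto_volume_norm_eval_iterate_derivative_le hμ hmeas hlaw hindep k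
      (Metric.isBounded_ball (x := (0 : ℂ)) (r := m))
      (by positivity : (0 : ℝ) < 1 / ((l : ℝ) + 1))] with ω hω R ε hε
  obtain ⟨m, hm⟩ := exists_nat_ge R
  obtain ⟨l, hl⟩ := exists_nat_one_div_lt hε
  refine tendsto_of_tendsto_of_tendsto_of_le_of_le tendsto_const_nhds (hω m l)
    (fun _ => zero_le) fun n => measure_mono ?_
  rintro w ⟨hw, hle⟩
  refine ⟨Metric.ball_subset_ball hm hw, hle.trans ?_⟩
  gcongr

end LawOfLargeNumbers

section FiniteSupport

lemma rootMultiplicity_sub_le_iterate_derivative {R : Type*} [CommRing R] [IsDomain R] [CharZero R]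
    (p : R[X]) (a : R) (k : ℕ) :
    p.rootMultiplicity a - k ≤ (derivative^[k] p).rootMultiplicity a := by
  induction k with
  | zero => exact le_rfl
  | succ k ih =>
    rw [Function.iterate_succ_apply', ← Nat.sub_sub]
    exact (Nat.sub_le_sub_right ih 1).trans
      (rootMultiplicity_sub_one_le_derivative_rootMultiplicity _ _)

lemma derivZeroMeasure_singleton (z : ℕ → ℂ) {k n : ℕ} (h : k < n) (a : ℂ) :
    (derivZeroMeasure z k n : Measure ℂ) {a} = ((n - k : ℕ) : ℝ≥0∞)⁻¹ *
      (derivative^[k] (rootPoly z n)).rootMultiplicity a := by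
  have hcount (s : Multiset ℂ) :
      (s.map (({a} : Set ℂ).indicator (1 : ℂ → ℝ≥0∞))).sum = s.count a := by
    induction s using Multiset.induction_on with
    | empty => simp
    | cons b s ih =>
      rw [Multiset.map_cons, Multiset.sum_cons, ih, Multiset.count_cons, add_comm]
      by_cases hab : a = b <;> simp [hab, eq_comm (a := b)]
  rw [derivZeroMeasure_apply z h (measurableSet_singleton a), hcount, count_roots]

lemma derivZeroMeasure_zero_singleton_le (z : ℕ → ℂ) {k n : ℕ} (h : k < n) (a : ℂ) :
    (derivZeroMeasure z 0 n : Measure ℂ) {a} ≤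
      (derivZeroMeasure z k n : Measure ℂ) {a} + k * (n : ℝ≥0∞)⁻¹ := by
  rw [derivZeroMeasure_singleton z (k.zero_le.trans_lt h), derivZeroMeasure_singleton z h,
    Function.iterate_zero, id, Nat.sub_zero]
  have hmult : ((rootPoly z n).rootMultiplicity a : ℝ≥0∞) ≤
      (derivative^[k] (rootPoly z n)).rootMultiplicity a + k := by
    exact_mod_cast tsub_le_iff_right.1
      (rootMultiplicity_sub_le_iterate_derivative (rootPoly z n) a k)
  calc _ ≤ (n : ℝ≥0∞)⁻¹ * ((derivative^[k] (rootPoly z n)).rootMultiplicity a + k) := by gcongr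
    _ = (n : ℝ≥0∞)⁻¹ * (derivative^[k] (rootPoly z n)).rootMultiplicity a +
        k * (n : ℝ≥0∞)⁻¹ := by ring
    _ ≤ _ := by
        gcongr
        exact n.sub_le k

lemma measure_le_liminf_derivZeroMeasure_of_finite {μ : Measure ℂ} {S : Finset ℂ}
    (hS : μ (S : Set ℂ)ᶜ = 0) {z : ℕ → ℂ}
    (h : ∀ a ∈ S, Tendsto (fun n => (derivZeroMeasure z 0 n : Measure ℂ) {a}) atTop (𝓝 (μ {a})))
    (k : ℕ) (U : Set ℂ) :
    μ U ≤ liminf (fun n => (derivZeroMeasure z k n : Measure ℂ) U) atTop := by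
  classical
  set T := S.filter (· ∈ U)
  have hTU : (T : Set ℂ) ⊆ U := fun a ha => (Finset.mem_filter.1 ha).2
  have hμU : μ U ≤ ∑ a ∈ T, μ {a} := by
    rw [sum_measure_singleton]
    have hcover : U ⊆ (T : Set ℂ) ∪ (S : Set ℂ)ᶜ := fun a ha =>
      or_iff_not_imp_right.2 fun haS => Finset.mem_filter.2 ⟨not_not.1 haS, ha⟩
    exact (measure_mono hcover).trans ((measure_union_le _ _).trans_eq (by rw [hS, add_zero]))
  have hlim : Tendsto (fun n => ∑ a ∈ T, (derivZeroMeasure z 0 n : Measure ℂ) {a}) atTop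
      (𝓝 (∑ a ∈ T, μ {a})) :=
    tendsto_finsetSum _ fun a ha => h a (Finset.mem_filter.1 ha).1
  have herr : Tendsto (fun n : ℕ => (T.card * k : ℝ≥0∞) * (n : ℝ≥0∞)⁻¹) atTop (𝓝 0) := by
    simpa only [mul_zero] using ENNReal.Tendsto.const_mul ENNReal.tendsto_inv_nat_nhds_zero
      (Or.inr (by finiteness))
  calc μ U ≤ ∑ a ∈ T, μ {a} := hμU
    _ = liminf (fun n => ∑ a ∈ T, (derivZeroMeasure z 0 n : Measure ℂ) {a}) atTop :=
        hlim.liminf_eq.symm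
    _ ≤ liminf (fun n => (derivZeroMeasure z k n : Measure ℂ) U +
        (T.card * k : ℝ≥0∞) * (n : ℝ≥0∞)⁻¹) atTop := by
        refine liminf_le_liminf ((eventually_gt_atTop k).mono fun n hn => ?_)
        refine (Finset.sum_le_sum fun a _ => derivZeroMeasure_zero_singleton_le z hn a).trans ?_
        rw [Finset.sum_add_distrib, Finset.sum_const, nsmul_eq_mul, ← mul_assoc,
          sum_measure_singleton]
        gcongr
    _ = _ := ENNReal.liminf_add_of_right_tendsto_zero herr _

lemma ae_forall_tendsto_derivZeroMeasure_of_finite_support {Ω : Type*} [MeasurableSpace Ω]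
    {P : Measure Ω} {μ : ProbabilityMeasure ℂ} (hμ : (μ : Measure ℂ).support.Finite)
    {Z : ℕ → Ω → ℂ} (hmeas : ∀ j, Measurable (Z j)) (hlaw : ∀ j, P.map (Z j) = (μ : Measure ℂ))
    (hindep : iIndepFun Z P) :
    ∀ᵐ ω ∂P, ∀ k : ℕ, Tendsto (fun n => derivZeroMeasure (fun j => Z j ω) k n) atTop
      (𝓝 μ.toFiniteMeasure) := by
  have hS : (μ : Measure ℂ) (hμ.toFinset : Set ℂ)ᶜ = 0 := by
    rw [hμ.coe_toFinset]
    exact Measure.measure_compl_support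
  filter_upwards [(Finset.eventually_all hμ.toFinset).2 fun a _ =>
    ae_tendsto_derivZeroMeasure_zero hmeas hlaw hindep (measurableSet_singleton a)] with ω hω k
  exact tendsto_derivZeroMeasure_of_isOpen fun U _ =>
    measure_le_liminf_derivZeroMeasure_of_finite hS hω k U

end FiniteSupport

end

theorem theorem1p1 {Ω : Type*} [MeasurableSpace Ω] (P : Measure Ω) [IsProbabilityMeasure P]
    (μ : ProbabilityMeasure ℂ) (Z : ℕ → Ω → ℂ)
    (hmeas : ∀ j, Measurable (Z j))
    (hlaw : ∀ j, P.map (Z j) = (μ : Measure ℂ))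
    (hindep : iIndepFun Z P) :
    ∀ᵐ ω ∂P, ∀ k : ℕ,
      Tendsto (fun n : ℕ => derivZeroMeasure (fun j => Z j ω) k n) atTop
        (𝓝 μ.toFiniteMeasure) := by
  by_cases hμ : (μ : Measure ℂ).support.Finite
  · exact ae_forall_tendsto_derivZeroMeasure_of_finite_support hμ hmeas hlaw hindep
  · filter_upwards [ae_forall_isOpen_measure_le_liminf_derivZeroMeasure_zero hmeas hlaw hindep,
      ae_all_iff.2 fun k => ae_subexponentialDecay_derivative hμ hmeas hlaw hindep k]
      with ω hopen hdecay k
    exact tendsto_derivZeroMeasure_of_isOpen fun U hU =>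
      measure_le_liminf_derivZeroMeasure hopen (hdecay k) hU
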